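/- **Setting.** Let $A\in\mathbb C^{n\times n}$, $B\in\mathbb C^{n\times m}$, $C\in\mathbb C^{p\times n}$, $D\in\mathbb C^{p\times m}$, $G(\jmath\omega)=C(\jmath\omega I-A)^{-1}B+D$, let $\varpi_1<\varpi_2$ be real, $\varpi_d=(\varpi_2-\varpi_1)/2$, $\varpi_c=(\varpi_1+\varpi_2)/2$, and for a square matrix $X$ put $$F(X)=\varpi_d^2(\jmath\varpi_1I-X)^{-1}(\jmath\varpi_2I-X)^{-1},\qquad N(X)=(\jmath\varpi_cI-X)(\jmath\varpi_1I-X)^{-1}(\jmath\varpi_2I-X)^{-1}.$$ $[M]^{\frac12\star}$ is the principal square root of $M$ (all eigenvalues have positive real part), $[M]^{-\frac12\star}$ its inverse, $\mathrm{He}(M)=\frac12(M+M^*)$, and $\sigma_{\max}$ is the maximum singular value. A system is stable if all eigenvalues of its state matrix have negative real part. The interval-type extended system $G_{\varpi_1,\varpi_2}$ of $(A,B,C,D)$ is $(A,\tilde B,\tilde C,\tilde D)$ with $$\tilde B=[F(A)]^{\frac12\star}B,\quad \tilde C=C[F(A)]^{\frac12\star},\quad \tilde D=D+C\,N(A)\,B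 .$$ Assume that $[F(A)]^{\frac12\star}$ exists (automatic if the system is stable) and that the system is in interval-type frequency-dependent balanced realization: for $\Sigma=\mathrm{diag}(\sigma_1,\dots,\sigma_n)$ with $\sigma_1\ge\dots\ge\sigma_n\ge0$, $$A\Sigma+\Sigma A^*+\tilde B\tilde B^*=0,\qquad A^*\Sigma+\Sigma A+\tilde C^*\tilde C=0 .$$ For $k\le n$ let $Z_k=[I_k\ \ 0]\in\mathbb R^{k\times n}$, $A_k=Z_kAZ_k^T$, $\Sigma_k=Z_k\Sigma Z_k^T$. For $0\le r<n$ the reduced model $G_r=(A_r,B_r,C_r,D_r)$ is $$A_r=Z_rAZ_r^T,\quad B_r=[F(A_r)]^{-\frac12\star}Z_r\tilde B,\quad C_r=\tilde CZ_r^T[F(A_r)]^{-\frac12\star},\quad D_r=\tilde D-C_rN(A_r)B_r .$$ **Theorem.** 1. If the original system is stable and (when $r\ge1$) $\sigma_r>\sigma_{r+1}$, then $[F(A_r)]^{\frac12\star}$ exists, so that the reduced model is well defined, and the reduced model is stable. In 2 and 3 assume that $[F(A_r)]^{\frac12\star}$ exists. 2. Suppose $\sigma_n>0$, and for $r\le k\le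 n$ let $M_k$ be any invertible square root of $F(A_k)$. Then for every $\omega\in[\varpi_1,\varpi_2]$ for which $\jmath\omega$ is an eigenvalue of neither $A$ nor $A_r$, $$\sigma_{\max}\big(G(\jmath\omega)-G_r(\jmath\omega)\big)\le\sum_{i=r+1}^n\sqrt{\eta_i},$$ where $$\eta_i=\sigma_{\max}\Big((2\sigma_i)^2I+\mathrm{He}\big(-\mathscr C_{i}\,\mathcal N_{i}\,\mathscr B_{i}\,J_i\big)\Big),\qquad J_i=\tfrac12\begin{bmatrix}0&2\sigma_iI_m\\2\sigma_iI_p&0\end{bmatrix},$$ with $\mathcal M_i=\mathrm{diag}(M_{i-1},M_i)$, $\mathcal N_i=\mathrm{diag}(N(A_{i-1}),N(A_i))$, $\Sigma_{ei}=\mathrm{diag}(\Sigma_{i-1},\Sigma_i)$, $$\mathscr B_i=\Big[\mathcal M_i^{-1}\begin{bmatrix}Z_{i-1}\\Z_i\end{bmatrix}\tilde B\quad \sigma_i\mathcal M_i^{-1}\Sigma_{ei}^{-1}\begin{bmatrix}Z_{i-1}\\-Z_i\end{bmatrix}\tilde C^*\Big],\qquad \mathscr C_i^*=\Big[\mathcal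 M_i^{-*}\begin{bmatrix}-Z_{i-1}\\Z_i\end{bmatrix}\tilde C^*\quad \sigma_i\mathcal M_i^{-*}\Sigma_{ei}^{-1}\begin{bmatrix}-Z_{i-1}\\-Z_i\end{bmatrix}\tilde B\Big].$$ 3. Let $G_{r\varpi_1,\varpi_2}$ be the interval-type extended system of $G_r$. Then $G_{r\varpi_1,\varpi_2}=(A_r,\,Z_r\tilde B,\,\tilde CZ_r^T,\,\tilde D)$, and for every real $\omega$ for which $\jmath\omega$ is an eigenvalue of neither $A$ nor $A_r$, and also for $\omega=\pm\infty$ (where $G=D$ and $G_r=D_r$), $$\sigma_{\max}\big(G(\jmath\omega)-G_r(\jmath\omega)\big)\le 2\sum_{i=r+1}^n\sigma_i+\|G-G_{\varpi_1,\varpi_2}\|_\infty+\|G_r-G_{r\varpi_1,\varpi_2}\|_\infty ,$$ where $\|\cdot\|_\infty$ denotes the supremum of $\sigma_{\max}$ over all real frequencies at which the transfer functions involved are defined. -/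

import Mathlib

noncomputable section

namespace FDBT

open Matrix

/-- A state-space model `x' = A x + B u`, `y = C x + D u` with complex matrices,
`n` states, `m` inputs and `p` outputs. -/
structure StateSpace (n m p : ℕ) where
  A : Matrix (Fin n) (Fin n) ℂ
  B : Matrix (Fin n) (Fin m) ℂ
  C : Matrix (Fin p) (Fin n) ℂ
  D : Matrix (Fin p) (Fin m) ℂ

/-- The matrix `jωI - A`. -/
def pencil {n : ℕ} (ω : ℝ) (A : Matrix (Fin n) (Fin n) ℂ) : Matrix (Fin n) (Fin n) ℂ :=
  (Complex.I * (ω : ℂ)) • (1 : Matrix (Fin n) (Fin n) ℂ) - A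

/-- The frequency response `G(jω) = C (jωI - A)⁻¹ B + D`
(meaningful when `jω` is not an eigenvalue of `A`). -/
def StateSpace.freq {n m p : ℕ} (G : StateSpace n m p) (ω : ℝ) : Matrix (Fin p) (Fin m) ℂ :=
  G.C * (pencil ω G.A)⁻¹ * G.B + G.D

/-- `jω` is not an eigenvalue of the state matrix, so that `G.freq ω` is meaningful.
A stable system is regular at every real frequency. -/
def StateSpace.Regular {n m p : ℕ} (G : StateSpace n m p) (ω : ℝ) : Prop :=
  IsUnit (pencil ω G.A)

/-- (Hurwitz) stability: all eigenvalues of the state matrix have negative real part. -/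
def StateSpace.Stable {n m p : ℕ} (G : StateSpace n m p) : Prop :=
  ∀ z ∈ spectrum ℂ G.A, z.re < 0

/-- The maximum singular value of a matrix (`0` if the matrix has no rows or no columns). -/
def sigmaMax {a b : Type} [Fintype a] [Fintype b] [DecidableEq b]
    (M : Matrix a b ℂ) : ℝ :=
  (Matrix.toEuclideanLin M).singularValues 0

/-- The Hermitian part `He(M) = 0.5 (M + M*)`. -/
def He {a : Type} (M : Matrix a a ℂ) : Matrix a a ℂ :=
  (1 / 2 : ℂ) • (M + Mᴴ)

/-- The `H∞` distance `‖G - H‖_∞ = sup_ω σ_max(G(jω) - H(jω))`, as an extended nonnegative real;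
the supremum is over the real frequencies at which both frequency responses are defined. -/
def hinfDist {n n' m p : ℕ} (G : StateSpace n m p) (H : StateSpace n' m p) : ENNReal :=
  ⨆ (ω : ℝ) (_ : G.Regular ω) (_ : H.Regular ω), ENNReal.ofReal (sigmaMax (G.freq ω - H.freq ω))

/-- `S` is a positive principal square root of `X`: `S² = X` and all the eigenvalues of `S`
have positive real part. -/
def IsPrincipalSqrt {n : ℕ} (S X : Matrix (Fin n) (Fin n) ℂ) : Prop :=
  S * S = X ∧ ∀ z ∈ spectrum ℂ S, 0 < z.re

/-- `X` has a positive principal square root (such a root is automatically unique). -/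
def HasPrincipalSqrt {n : ℕ} (X : Matrix (Fin n) (Fin n) ℂ) : Prop :=
  ∃ S, IsPrincipalSqrt S X

open Classical in
/-- The positive principal square root of `X` (by convention `0` if there is none). -/
def principalSqrt {n : ℕ} (X : Matrix (Fin n) (Fin n) ℂ) : Matrix (Fin n) (Fin n) ℂ :=
  if h : HasPrincipalSqrt X then h.choose else 0

/-- `S` is an invertible square root of `X`, principal or not. -/
def IsInvertibleSqrt {n : ℕ} (S X : Matrix (Fin n) (Fin n) ℂ) : Prop :=
  IsUnit S ∧ S * S = X

/-- `ϖ_d² (jϖ₁I - A)⁻¹ (jϖ₂I - A)⁻¹` with `ϖ_d = (ϖ₂ - ϖ₁)/2`. If `jϖ₁` or `jϖ₂` is an eigenvalue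
of `A`, the value of this expression in Lean is `0`, which for `n ≥ 1` has neither
a principal nor an invertible square root. -/
def bandMatrix {n : ℕ} (w₁ w₂ : ℝ) (A : Matrix (Fin n) (Fin n) ℂ) : Matrix (Fin n) (Fin n) ℂ :=
  ((((w₂ - w₁) / 2) ^ 2 : ℝ) : ℂ) • ((pencil w₁ A)⁻¹ * (pencil w₂ A)⁻¹)

/-- `(jϖ_cI - A) (jϖ₁I - A)⁻¹ (jϖ₂I - A)⁻¹` with `ϖ_c = (ϖ₁ + ϖ₂)/2`. -/
def centerMatrix {n : ℕ} (w₁ w₂ : ℝ) (A : Matrix (Fin n) (Fin n) ℂ) :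
    Matrix (Fin n) (Fin n) ℂ :=
  pencil ((w₂ + w₁) / 2) A * (pencil w₁ A)⁻¹ * (pencil w₂ A)⁻¹

/-- The interval-type frequency-dependent extended system of `G` for `[ϖ₁, ϖ₂]`. -/
def StateSpace.extend {n m p : ℕ} (G : StateSpace n m p) (w₁ w₂ : ℝ) : StateSpace n m p where
  A := G.A
  B := principalSqrt (bandMatrix w₁ w₂ G.A) * G.B
  C := G.C * principalSqrt (bandMatrix w₁ w₂ G.A)
  D := G.D + G.C * centerMatrix w₁ w₂ G.A * G.B

/-- `G` is an interval-type frequency-dependent balanced realization for `[ϖ₁, ϖ₂]` with respect to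
the Gramian `Σ = diag(σ)`: its extended system is defined, and `Σ` solves both Lyapunov equations
of the extended system. -/
structure IsIntervalBalanced {n m p : ℕ} (G : StateSpace n m p) (w₁ w₂ : ℝ) (σ : Fin n → ℝ) :
    Prop where
  hasSqrt : HasPrincipalSqrt (bandMatrix w₁ w₂ G.A)
  controllability :
    (G.extend w₁ w₂).A * diagonal (fun i => (σ i : ℂ))
      + diagonal (fun i => (σ i : ℂ)) * (G.extend w₁ w₂).Aᴴ
      + (G.extend w₁ w₂).B * (G.extend w₁ w₂).Bᴴ = 0
  observability :
    (G.extend w₁ w₂).Aᴴ * diagonal (fun i => (σ i : ℂ))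
      + diagonal (fun i => (σ i : ℂ)) * (G.extend w₁ w₂).A
      + (G.extend w₁ w₂).Cᴴ * (G.extend w₁ w₂).C = 0

/-- The truncation matrix `Z_k = [I 0]` of size `k × n` (used for `k ≤ n`). -/
def Z (k n : ℕ) : Matrix (Fin k) (Fin n) ℂ :=
  Matrix.of fun i j => if (i : ℕ) = (j : ℕ) then 1 else 0

/-- The truncated square matrix `Z_k A Z_kᵀ`; for `A` the state matrix this is `A_k`. -/
def trunc {n : ℕ} (k : ℕ) (A : Matrix (Fin n) (Fin n) ℂ) : Matrix (Fin k) (Fin k) ℂ :=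
  Z k n * A * (Z k n)ᵀ

/-- The input matrix `B_r` of the reduced model. -/
def reducedB {n m p : ℕ} (G : StateSpace n m p) (w₁ w₂ : ℝ) (r : ℕ) :
    Matrix (Fin r) (Fin m) ℂ :=
  (principalSqrt (bandMatrix w₁ w₂ (trunc r G.A)))⁻¹ * Z r n * (G.extend w₁ w₂).B

/-- The output matrix `C_r` of the reduced model. -/
def reducedC {n m p : ℕ} (G : StateSpace n m p) (w₁ w₂ : ℝ) (r : ℕ) :
    Matrix (Fin p) (Fin r) ℂ :=
  (G.extend w₁ w₂).C * (Z r n)ᵀ * (principalSqrt (bandMatrix w₁ w₂ (trunc r G.A)))⁻¹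

/-- The reduced model of order `r` produced by interval-type frequency-dependent balanced
truncation. -/
def reducedModel {n m p : ℕ} (G : StateSpace n m p) (w₁ w₂ : ℝ) (r : ℕ) : StateSpace r m p where
  A := trunc r G.A
  B := reducedB G w₁ w₂ r
  C := reducedC G w₁ w₂ r
  D := (G.extend w₁ w₂).D
    - reducedC G w₁ w₂ r * centerMatrix w₁ w₂ (trunc r G.A) * reducedB G w₁ w₂ r

section Dilation

/-! The dilated matrices for the step from order `k + 1` to order `k`. With indices counted from
zero, `k : Fin n` is the (one-based) index `i = k + 1`, so `Z_{i-1}`, `Z_i`, `σ_i` are `Z k n`,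
`Z (k + 1) n`, `σ k`. The matrices `M₀`, `M₁` stand for the square roots `M_{i-1}`, `M_i`. -/

variable {n m p : ℕ} (G : StateSpace n m p) (w₁ w₂ : ℝ) (σ : Fin n → ℝ) (k : Fin n)
  (M₀ : Matrix (Fin (k : ℕ)) (Fin (k : ℕ)) ℂ) (M₁ : Matrix (Fin (k + 1 : ℕ)) (Fin (k + 1 : ℕ)) ℂ)

/-- `diag{M_{i-1}, M_i}`. -/
def dilM : Matrix (Fin (k : ℕ) ⊕ Fin (k + 1 : ℕ)) (Fin (k : ℕ) ⊕ Fin (k + 1 : ℕ)) ℂ :=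
  fromBlocks M₀ 0 0 M₁

/-- `diag{N_{i-1}, N_i}`. -/
def dilN : Matrix (Fin (k : ℕ) ⊕ Fin (k + 1 : ℕ)) (Fin (k : ℕ) ⊕ Fin (k + 1 : ℕ)) ℂ :=
  fromBlocks (centerMatrix w₁ w₂ (trunc k G.A)) 0 0 (centerMatrix w₁ w₂ (trunc (k + 1) G.A))

/-- `diag{Z_{i-1} Σ Z_{i-1}ᵀ, Z_i Σ Z_iᵀ}`. -/
def dilSigma : Matrix (Fin (k : ℕ) ⊕ Fin (k + 1 : ℕ)) (Fin (k : ℕ) ⊕ Fin (k + 1 : ℕ)) ℂ :=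
  fromBlocks (trunc k (diagonal fun i => (σ i : ℂ))) 0 0
    (trunc (k + 1) (diagonal fun i => (σ i : ℂ)))

/-- The dilated input matrix. -/
def dilB : Matrix (Fin (k : ℕ) ⊕ Fin (k + 1 : ℕ)) (Fin m ⊕ Fin p) ℂ :=
  fromCols
    ((dilM k M₀ M₁)⁻¹ * fromRows (Z k n) (Z (k + 1) n) * (G.extend w₁ w₂).B)
    ((σ k : ℂ) • ((dilM k M₀ M₁)⁻¹ * (dilSigma σ k)⁻¹ *
      fromRows (Z k n) (-Z (k + 1) n) * (G.extend w₁ w₂).Cᴴ))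

/-- The dilated output matrix (given through its conjugate transpose). -/
def dilC : Matrix (Fin p ⊕ Fin m) (Fin (k : ℕ) ⊕ Fin (k + 1 : ℕ)) ℂ :=
  (fromCols
    (((dilM k M₀ M₁)⁻¹)ᴴ * fromRows (-Z k n) (Z (k + 1) n) * (G.extend w₁ w₂).Cᴴ)
    ((σ k : ℂ) • (((dilM k M₀ M₁)⁻¹)ᴴ * (dilSigma σ k)⁻¹ *
      fromRows (-Z k n) (-Z (k + 1) n) * (G.extend w₁ w₂).B)))ᴴ

/-- `He([0 I]ᵀ (2c) [I 0])`, that is, the matrix with zero diagonal blocks and off-diagonal blocks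
`0.5 · 2c · I`. -/
def dilSwap (m p : ℕ) (c : ℝ) : Matrix (Fin m ⊕ Fin p) (Fin p ⊕ Fin m) ℂ :=
  (1 / 2 : ℂ) • fromBlocks 0 (((2 * c : ℝ) : ℂ) • (1 : Matrix (Fin m) (Fin m) ℂ))
    (((2 * c : ℝ) : ℂ) • (1 : Matrix (Fin p) (Fin p) ℂ)) 0

/-- `η_i = σ_max((2σ_i)² I + He(-𝒞 𝒩 ℬ He([0 I]ᵀ (2σ_i) [I 0])))`. -/
def eta : ℝ :=
  sigmaMax ((((2 * σ k) ^ 2 : ℝ) : ℂ) • (1 : Matrix (Fin p ⊕ Fin m) (Fin p ⊕ Fin m) ℂ)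
    + He (-(dilC G w₁ w₂ σ k M₀ M₁ * dilN G w₁ w₂ k * dilB G w₁ w₂ σ k M₀ M₁
        * dilSwap m p (σ k))))

end Dilation

end FDBT

end

noncomputable section

namespace FDBT

open Matrix
open scoped Matrix.Norms.L2Operator

set_option linter.unusedSectionVars false

/-! ### Matrix norms and frequency responses -/

/-! Let c and d be the centre and half-width of the band, E = jcI - A and t = (ω - c)/d. Since (jϖ₁I
- A)(jϖ₂I - A) = E² + d², the band matrix is d²(E² + d²)⁻¹. Dividing E² + d² by jωI - A with
remainder gives the identity behind the band bound: with (A, B̃, C̃, D̃) the extended system and G̃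
its frequency response, G(jω) = D̃ + (1 - t²)(G̃(jω) - D̃) - j(t/d) C̃B̃ (`inv_sqrt_mul_resolvent`,
`freq_eq_bandFreq`). The reduced model obeys the same identity with the truncated extended system.
So G - G_r combines an ordinary balanced-truncation error with a difference of first Markov
parameters C̃B̃.

Consider removing one state with singular value s > 0, with truncation matrix J and Gramian S. Put U
= [J; I] and V = [J; -I]. The error system sits in a larger system with Gramian P = U S U* + s² V
S⁻¹ V* whose response L satisfies L L* = (2s)² I on the imaginary axis. Its corner is the error,
which is therefore at most 2s (`norm_freq_sub_le`). The ω⁻² coefficient at infinity of the same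
all-pass relation (`allPass_mul_feedthrough`) turns the Hermitian part in `eta` into QQ*/(2d)²,
where Q is the first Markov parameter of the dilation. Testing Q on suitable vectors shows that ‖Q‖
is at least twice the Markov-parameter difference x, so η ≥ (2s)² + (x/d)². Cauchy–Schwarz and (1 -
t²)² + t² ≤ 1 for |t| ≤ 1 then bound the step by √η. The square roots in `eta` need not commute with
the state matrices; `sqrt_sandwich` shows by a Lyapunov trace argument that the value of `eta` does
not feel this.

The steps are telescoped. Intermediate truncations may have imaginary eigenvalues, but only at
finitely many frequencies, and these are reached by continuity of the two end responses.

For the entire-frequency bound, extending the reduced model gives the truncated extended system, so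
the triangle inequality through the two extended systems suffices; ω → ∞ gives the feedthrough
bound. Stability comes from the Pernebo–Silverman type argument in `re_neg_of_mem_spectrum_trunc`.
Existence of the principal root comes from lifting an interpolated root modulo the characteristic
polynomial. -/

lemma norm_toLp_sq {a : Type*} [Fintype a] (x : a → ℂ) :
    ‖WithLp.toLp 2 x‖ ^ 2 = (star x ⬝ᵥ x).re := by
  rw [EuclideanSpace.norm_sq_eq, dotProduct, Complex.re_sum]
  refine Finset.sum_congr rfl fun i _ => ?_
  simp [Complex.sq_norm, Complex.normSq_apply]

lemma norm_toLp_mulVec_le {a b : Type*} [Fintype a] [Fintype b] [DecidableEq b]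
    (M : Matrix a b ℂ) (x : b → ℂ) :
    ‖WithLp.toLp 2 (M *ᵥ x)‖ ≤ ‖M‖ * ‖WithLp.toLp 2 x‖ :=
  l2_opNorm_mulVec M (WithLp.toLp 2 x)

lemma opNorm_le_of_mulVec_le {a b : Type*} [Fintype a] [Fintype b] [DecidableEq b]
    (M : Matrix a b ℂ) {c : ℝ} (hc : 0 ≤ c)
    (h : ∀ x : b → ℂ, ‖WithLp.toLp 2 (M *ᵥ x)‖ ≤ c * ‖WithLp.toLp 2 x‖) : ‖M‖ ≤ c :=
  ContinuousLinearMap.opNorm_le_bound _ hc fun x => h x.ofLp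

lemma norm_star_dotProduct_le {a : Type*} [Fintype a] (x y : a → ℂ) :
    ‖star x ⬝ᵥ y‖ ≤ ‖WithLp.toLp 2 x‖ * ‖WithLp.toLp 2 y‖ := by
  have := norm_inner_le_norm (𝕜 := ℂ) (WithLp.toLp 2 x) (WithLp.toLp 2 y)
  rwa [EuclideanSpace.inner_toLp_toLp, dotProduct_comm] at this

lemma star_mulVec_dotProduct_mulVec {a b c : Type*} [Fintype a] [Fintype b] [Fintype c]
    (M : Matrix a b ℂ) (N : Matrix a c ℂ) (x : b → ℂ) (y : c → ℂ) :
    star (M *ᵥ x) ⬝ᵥ (N *ᵥ y) = star x ⬝ᵥ ((Mᴴ * N) *ᵥ y) := by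
  rw [star_mulVec, ← dotProduct_mulVec, mulVec_mulVec]

/-- The largest eigenvalue of T*T is the square of the top singular value. An eigenvector for it
gives one inequality, and expanding ‖Tx‖² in an eigenbasis of T*T gives the other. -/
lemma sigmaMax_eq_norm {a b : Type} [Fintype a] [Fintype b] [DecidableEq b]
    (M : Matrix a b ℂ) : sigmaMax M = ‖M‖ := by
  set T := Matrix.toEuclideanLin M with hT
  have hTn : ∀ x, ‖T x‖ ≤ ‖M‖ * ‖x‖ := fun x => l2_opNorm_mulVec M x
  have key : ∀ x, ‖T x‖ ^ 2 = (inner ℂ x ((LinearMap.adjoint T ∘ₗ T) x)).re := by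
    intro x
    rw [LinearMap.comp_apply, LinearMap.adjoint_inner_right, inner_self_eq_norm_sq_to_K]
    norm_cast
  apply le_antisymm
  · show T.singularValues 0 ≤ _
    by_cases h0 : 0 < Module.finrank ℂ (EuclideanSpace ℂ b)
    · obtain ⟨v, hv⟩ :=
        (T.hasEigenvalue_adjoint_comp_self_sq_singularValues h0).exists_hasEigenvector
      have h1 := key v
      rw [hv.apply_eq_smul, inner_smul_right, inner_self_eq_norm_sq_to_K] at h1
      have h1' : ‖T v‖ ^ 2 = T.singularValues 0 ^ 2 * ‖v‖ ^ 2 := by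
        rw [h1, ← Complex.ofReal_re (T.singularValues 0 ^ 2 * ‖v‖ ^ 2)]
        push_cast
        rfl
      have hvn : 0 < ‖v‖ := norm_pos_iff.2 hv.2
      have h2 : ‖T v‖ = T.singularValues 0 * ‖v‖ := by
        rw [← sq_eq_sq₀ (norm_nonneg _) (mul_nonneg (T.singularValues_nonneg 0) hvn.le), h1']
        ring
      have := hTn v
      rw [h2] at this
      exact le_of_mul_le_mul_right this hvn
    -- On a zero-dimensional domain there is no eigenvector, and the singular value of index 0 is 0
    -- by default.
    · rw [T.singularValues_of_finrank_le (not_lt.1 h0)]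
      exact norm_nonneg _
  · have hs := T.isSymmetric_adjoint_comp_self
    refine ContinuousLinearMap.opNorm_le_bound _ (T.singularValues_nonneg 0) fun x => ?_
    show ‖T x‖ ≤ T.singularValues 0 * ‖x‖
    rw [← sq_le_sq₀ (norm_nonneg _) (mul_nonneg (T.singularValues_nonneg 0) (norm_nonneg _)),
      key x, ← (hs.eigenvectorBasis rfl).sum_inner_mul_inner, mul_pow,
      ← (hs.eigenvectorBasis rfl).sum_sq_norm_inner_right, Finset.mul_sum, Complex.re_sum]
    refine Finset.sum_le_sum fun i _ => ?_
    rw [← OrthonormalBasis.repr_apply_apply _ (((LinearMap.adjoint T) ∘ₗ T) x),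
      hs.eigenvectorBasis_apply_self_apply rfl, OrthonormalBasis.repr_apply_apply,
      mul_left_comm, ← inner_conj_symm x, Complex.conj_mul']
    have h0 : 0 < Module.finrank ℂ (EuclideanSpace ℂ b) := i.pos
    have h1 : hs.eigenvalues rfl i ≤ T.singularValues 0 ^ 2 := by
      rw [T.sq_singularValues_of_lt rfl h0]
      exact hs.eigenvalues_antitone rfl (Nat.zero_le _)
    have h2 : (((hs.eigenvalues rfl i : ℝ) : ℂ) *
        ((‖inner ℂ ((hs.eigenvectorBasis rfl) i) x‖ : ℝ) : ℂ) ^ 2).re =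
        hs.eigenvalues rfl i * ‖inner ℂ ((hs.eigenvectorBasis rfl) i) x‖ ^ 2 := by
      rw [← Complex.ofReal_pow, ← Complex.ofReal_mul, Complex.ofReal_re]
    exact h2.le.trans (mul_le_mul_of_nonneg_right h1 (sq_nonneg _))

/-- YY* is positive semidefinite, so XX* ≤ s². This extracts a norm bound for one block of an
all-pass response. -/
lemma norm_le_of_mul_conjTranspose_add {a b c : Type*} [Fintype a] [Fintype b] [Fintype c]
    [DecidableEq a] [DecidableEq b] (X : Matrix a b ℂ) (Y : Matrix a c ℂ) {s : ℝ} (hs : 0 ≤ s)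
    (h : X * Xᴴ + Y * Yᴴ = ((s ^ 2 : ℝ) : ℂ) • (1 : Matrix a a ℂ)) : ‖X‖ ≤ s := by
  rw [← l2_opNorm_conjTranspose]
  refine opNorm_le_of_mulVec_le _ hs fun x => ?_
  rw [← sq_le_sq₀ (norm_nonneg _) (by positivity), mul_pow, norm_toLp_sq, norm_toLp_sq,
    star_mulVec_dotProduct_mulVec, conjTranspose_conjTranspose]
  have h1 := congrArg (fun W => (star x ⬝ᵥ (W *ᵥ x)).re) h
  have h2 : 0 ≤ (star x ⬝ᵥ ((Y * Yᴴ) *ᵥ x)).re := by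
    have := star_mulVec_dotProduct_mulVec Yᴴ Yᴴ x x
    rw [conjTranspose_conjTranspose] at this
    rw [← this, ← norm_toLp_sq]
    positivity
  simp only [add_mulVec, dotProduct_add, Complex.add_re, smul_mulVec, one_mulVec, dotProduct_smul,
    smul_eq_mul, Complex.re_ofReal_mul] at h1
  linarith

/-- The norm dominates every Rayleigh quotient, and those of QQ* have supremum ‖Q‖². -/
lemma add_norm_sq_le_norm_smul_one_add {a b : Type*} [Fintype a] [Fintype b]
    [DecidableEq a] [DecidableEq b] [Nonempty a] (Q : Matrix a b ℂ) (c : ℝ) :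
    c + ‖Q‖ ^ 2 ≤ ‖(c : ℂ) • (1 : Matrix a a ℂ) + Q * Qᴴ‖ := by
  set W := (c : ℂ) • (1 : Matrix a a ℂ) + Q * Qᴴ with hW
  have key : ∀ x : a → ℂ, ‖WithLp.toLp 2 (Qᴴ *ᵥ x)‖ ^ 2 ≤ (‖W‖ - c) * ‖WithLp.toLp 2 x‖ ^ 2 := by
    intro x
    have h1 : (star x ⬝ᵥ (W *ᵥ x)).re ≤ ‖W‖ * ‖WithLp.toLp 2 x‖ ^ 2 := by
      refine (Complex.re_le_norm _).trans ((norm_star_dotProduct_le _ _).trans ?_)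
      calc _ ≤ ‖WithLp.toLp 2 x‖ * (‖W‖ * ‖WithLp.toLp 2 x‖) :=
            mul_le_mul_of_nonneg_left (norm_toLp_mulVec_le W x) (norm_nonneg _)
        _ = _ := by ring
    rw [hW] at h1
    simp only [add_mulVec, dotProduct_add, Complex.add_re, smul_mulVec, one_mulVec,
      dotProduct_smul, smul_eq_mul, Complex.re_ofReal_mul] at h1
    rw [← norm_toLp_sq, ← hW] at h1
    rw [norm_toLp_sq (Qᴴ *ᵥ x), star_mulVec_dotProduct_mulVec, conjTranspose_conjTranspose]
    linarith
  -- Here a unit vector is needed: on an empty index type `‖W‖` is 0, while `c` may be positive.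
  have hc : 0 ≤ ‖W‖ - c := by
    obtain ⟨i⟩ := ‹Nonempty a›
    have h1 := key (Pi.single i (1 : ℂ))
    have h2 : ‖WithLp.toLp 2 (Pi.single i (1 : ℂ) : a → ℂ)‖ = 1 := by
      simp
    rw [h2] at h1
    nlinarith [sq_nonneg ‖WithLp.toLp 2 (Qᴴ *ᵥ Pi.single i (1 : ℂ))‖]
  have h3 : ‖Q‖ ≤ Real.sqrt (‖W‖ - c) := by
    rw [← l2_opNorm_conjTranspose]
    refine opNorm_le_of_mulVec_le _ (Real.sqrt_nonneg _) fun x => ?_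
    rw [← sq_le_sq₀ (norm_nonneg _) (by positivity), mul_pow, Real.sq_sqrt hc]
    exact key x
  have h4 : ‖Q‖ ^ 2 ≤ ‖W‖ - c := by
    rw [← Real.sq_sqrt hc]
    exact pow_le_pow_left₀ (norm_nonneg _) h3 2
  linarith

/-! ### Frequency responses as functions of the frequency -/

lemma pencil_eq {n : ℕ} (ω : ℝ) (A : Matrix (Fin n) (Fin n) ℂ) :
    pencil ω A = algebraMap ℂ _ (Complex.I * ω) - A := by
  rw [pencil, Algebra.algebraMap_eq_smul_one]

lemma inv_pencil_eq_resolvent {n : ℕ} (ω : ℝ) (A : Matrix (Fin n) (Fin n) ℂ) :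
    (pencil ω A)⁻¹ = resolvent A (Complex.I * ω) := by
  rw [resolvent, pencil_eq, nonsing_inv_eq_ringInverse]

lemma isUnit_pencil_iff {n : ℕ} (ω : ℝ) (A : Matrix (Fin n) (Fin n) ℂ) :
    IsUnit (pencil ω A) ↔ Complex.I * ω ∉ spectrum ℂ A := by
  rw [pencil_eq, spectrum.notMem_iff]

lemma finite_not_isUnit_pencil {n : ℕ} (A : Matrix (Fin n) (Fin n) ℂ) :
    {ω : ℝ | ¬ IsUnit (pencil ω A)}.Finite := by
  have h : Set.InjOn (fun ω : ℝ => Complex.I * (ω : ℂ)) Set.univ := by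
    intro x _ y _ hxy
    simpa using hxy
  refine ((Matrix.finite_spectrum A).preimage (h.mono (Set.subset_univ _))).subset ?_
  intro ω hω
  simpa [isUnit_pencil_iff] using hω

lemma continuousAt_inv_pencil {n : ℕ} {ω : ℝ} {A : Matrix (Fin n) (Fin n) ℂ}
    (h : IsUnit (pencil ω A)) : ContinuousAt (fun ω : ℝ => (pencil ω A)⁻¹) ω := by
  have h1 : ContinuousAt (fun ω : ℝ => pencil ω A) ω := by
    unfold pencil
    fun_prop
  have h2 := NormedRing.inverse_continuousAt h.unit
  rw [IsUnit.unit_spec] at h2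
  have h3 : (fun ω : ℝ => (pencil ω A)⁻¹) = fun ω => Ring.inverse (pencil ω A) := by
    funext ω
    rw [nonsing_inv_eq_ringInverse]
  rw [h3]
  exact ContinuousAt.comp (f := fun ω : ℝ => pencil ω A) h2 h1

lemma tendsto_inv_pencil_atTop {n : ℕ} (A : Matrix (Fin n) (Fin n) ℂ) :
    Filter.Tendsto (fun ω : ℝ => (pencil ω A)⁻¹) Filter.atTop (nhds 0) := by
  simp_rw [inv_pencil_eq_resolvent]
  refine (spectrum.resolvent_tendsto_cobounded A).comp ?_
  rw [← tendsto_norm_atTop_iff_cobounded]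
  simpa using Filter.tendsto_abs_atTop_atTop

lemma continuous_mul_mul {a b c d : Type*} [Fintype a] [Fintype b] [Fintype c] [Fintype d]
    (C : Matrix a b ℂ) (B : Matrix c d ℂ) :
    Continuous fun X : Matrix b c ℂ => C * X * B := by
  fun_prop

lemma StateSpace.continuousAt_freq {n m p : ℕ} (G : StateSpace n m p) {ω : ℝ}
    (h : G.Regular ω) : ContinuousAt G.freq ω :=
  (((continuous_mul_mul G.C G.B).continuousAt.comp (continuousAt_inv_pencil h))).add
    continuousAt_const

lemma StateSpace.tendsto_freq_atTop {n m p : ℕ} (G : StateSpace n m p) :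
    Filter.Tendsto G.freq Filter.atTop (nhds G.D) := by
  have h := (((continuous_mul_mul G.C G.B).tendsto 0).comp
    (tendsto_inv_pencil_atTop G.A)).add_const G.D
  simp only [Matrix.mul_zero, Matrix.zero_mul, zero_add] at h
  exact h

/-! ### All-pass systems -/

section AllPass

variable {ν a b : Type*} [Fintype ν] [DecidableEq ν] [Fintype a] [Fintype b]

/-- Here N plays the role of zI - A with z imaginary, so that `hN` is the Lyapunov equation of A.
Substituting NP + PN* for BB* splits CXBB*X*C* into two terms, and `hPC` makes each cancel a cross
term with D. -/
lemma allPass_mul_conjTranspose {N X P : Matrix ν ν ℂ} {B : Matrix ν b ℂ} {C : Matrix a ν ℂ}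
    {D : Matrix a b ℂ} (hX : X * N = 1) (hP : Pᴴ = P) (hN : N * P + P * Nᴴ = B * Bᴴ)
    (hPC : P * Cᴴ = -(B * Dᴴ)) :
    (C * X * B + D) * (C * X * B + D)ᴴ = D * Dᴴ := by
  have hX' : Nᴴ * Xᴴ = 1 := by rw [← conjTranspose_mul, hX, conjTranspose_one]
  have hBD : B * Dᴴ = -(P * Cᴴ) := by rw [hPC, neg_neg]
  have hDB : D * Bᴴ = -(C * P) := by
    have := congrArg conjTranspose hBD
    simpa [conjTranspose_mul, hP] using this
  have e1 : C * X * B * (C * X * B)ᴴ = C * (P * (Xᴴ * Cᴴ)) + C * (X * (P * Cᴴ)) := by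
    calc C * X * B * (C * X * B)ᴴ = C * (X * (B * Bᴴ) * Xᴴ) * Cᴴ := by
          simp only [conjTranspose_mul, Matrix.mul_assoc]
      _ = C * ((X * N) * P * Xᴴ + X * P * (Nᴴ * Xᴴ)) * Cᴴ := by
          rw [← hN]
          simp only [Matrix.mul_add, Matrix.add_mul, Matrix.mul_assoc]
      _ = _ := by
          rw [hX, hX']
          simp only [Matrix.mul_add, Matrix.add_mul, Matrix.mul_assoc, Matrix.one_mul,
            Matrix.mul_one]
  have e2 : C * X * B * Dᴴ = -(C * (X * (P * Cᴴ))) := by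
    rw [Matrix.mul_assoc, hBD, Matrix.mul_neg, Matrix.mul_assoc]
  have e3 : D * (C * X * B)ᴴ = -(C * (P * (Xᴴ * Cᴴ))) := by
    rw [conjTranspose_mul, ← Matrix.mul_assoc, hDB, conjTranspose_mul, Matrix.neg_mul,
      Matrix.mul_assoc]
  rw [conjTranspose_add, Matrix.add_mul, Matrix.mul_add, Matrix.mul_add, e1, e2, e3]
  abel

/-- This is the ω⁻² coefficient of the all-pass relation at infinity, where the response is D +
CB/(jω) + CAB/(jω)² + …. It also follows directly from the Lyapunov equation sandwiched between C
and C*. -/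
lemma allPass_mul_feedthrough {A P : Matrix ν ν ℂ} {B : Matrix ν b ℂ} {C : Matrix a ν ℂ}
    {D : Matrix a b ℂ} (hP : Pᴴ = P) (hA : A * P + P * Aᴴ + B * Bᴴ = 0)
    (hPC : P * Cᴴ = -(B * Dᴴ)) :
    (C * A * B * Dᴴ) + (C * A * B * Dᴴ)ᴴ = (C * B) * (C * B)ᴴ := by
  have hBD : B * Dᴴ = -(P * Cᴴ) := by rw [hPC, neg_neg]
  have e : C * A * B * Dᴴ = -(C * (A * P) * Cᴴ) := by
    rw [Matrix.mul_assoc, hBD]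
    simp only [Matrix.mul_neg, Matrix.mul_assoc]
  have e2 : (C * A * B * Dᴴ)ᴴ = -(C * (P * Aᴴ) * Cᴴ) := by
    rw [e]
    simp only [conjTranspose_neg, conjTranspose_mul, conjTranspose_conjTranspose, hP,
      Matrix.mul_assoc]
  have hB : B * Bᴴ = -(A * P + P * Aᴴ) := by
    rw [eq_neg_iff_add_eq_zero, add_comm]
    exact hA
  have e3 : (C * B) * (C * B)ᴴ = C * (B * Bᴴ) * Cᴴ := by
    simp only [conjTranspose_mul, Matrix.mul_assoc]
  rw [e2, e, e3, hB]
  simp only [Matrix.mul_add, Matrix.add_mul, Matrix.mul_neg, Matrix.neg_mul, neg_add]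

end AllPass

/-! ### The dilation of one truncation step -/

section OneStep

variable {ι κ a b : Type*} [Fintype ι] [Fintype κ] [Fintype a] [Fintype b]
  [DecidableEq ι] [DecidableEq κ]

/-- A balanced realization `(A, B, C)` with invertible Gramian `S` (with inverse `T`), together
with a truncation matrix `J` whose discarded states all have the singular value `s`. -/
structure TruncationStep (J : Matrix ι κ ℂ) (A S T : Matrix κ κ ℂ) (B : Matrix κ b ℂ)
    (C : Matrix a κ ℂ) (s : ℝ) : Prop where
  coisometry : J * Jᴴ = 1
  inv_mul : T * S = 1
  hermitian : Sᴴ = S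
  discarded : S * (1 - Jᴴ * J) = (s : ℂ) • (1 - Jᴴ * J)
  pos : 0 < s
  controllability : A * S + S * Aᴴ + B * Bᴴ = 0
  observability : Aᴴ * S + S * A + Cᴴ * C = 0

namespace TruncationStep

variable {J : Matrix ι κ ℂ} {A S T : Matrix κ κ ℂ} {B : Matrix κ b ℂ} {C : Matrix a κ ℂ} {s : ℝ}

lemma mul_inv (h : TruncationStep J A S T B C s) : S * T = 1 :=
  mul_eq_one_comm.1 h.inv_mul

lemma inv_hermitian (h : TruncationStep J A S T B C s) : Tᴴ = T := by
  have h1 : Tᴴ * S = 1 := by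
    have := congrArg conjTranspose h.mul_inv
    rwa [conjTranspose_mul, h.hermitian, conjTranspose_one] at this
  calc Tᴴ = Tᴴ * (S * T) := by rw [h.mul_inv, Matrix.mul_one]
    _ = T := by rw [← Matrix.mul_assoc, h1, Matrix.one_mul]

lemma ne_zero (h : TruncationStep J A S T B C s) : (s : ℂ) ≠ 0 := by
  exact_mod_cast h.pos.ne'

lemma mul_compl (h : TruncationStep J A S T B C s) : J * (1 - Jᴴ * J) = 0 := by
  rw [Matrix.mul_sub, ← Matrix.mul_assoc, h.coisometry, Matrix.mul_one, Matrix.one_mul, sub_self]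

lemma compl_conjTranspose : (1 - Jᴴ * J)ᴴ = 1 - Jᴴ * J := by
  simp [conjTranspose_mul]

lemma compl_mul (h : TruncationStep J A S T B C s) : (1 - Jᴴ * J) * Jᴴ = 0 := by
  have := congrArg conjTranspose h.mul_compl
  rwa [conjTranspose_mul, compl_conjTranspose, conjTranspose_zero] at this

lemma inv_mul_compl (h : TruncationStep J A S T B C s) :
    T * (1 - Jᴴ * J) = (s : ℂ)⁻¹ • (1 - Jᴴ * J) := by
  have h1 := congrArg (fun W => (s : ℂ)⁻¹ • (T * W)) h.discarded
  simp only [← Matrix.mul_assoc, h.inv_mul, Matrix.one_mul, Matrix.mul_smul] at h1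
  rw [h1, smul_smul, inv_mul_cancel₀ h.ne_zero, one_smul]

lemma compl_mul_inv (h : TruncationStep J A S T B C s) :
    (1 - Jᴴ * J) * T = (s : ℂ)⁻¹ • (1 - Jᴴ * J) := by
  have := congrArg conjTranspose h.inv_mul_compl
  simpa only [conjTranspose_mul, conjTranspose_smul, compl_conjTranspose, h.inv_hermitian,
    star_inv₀, Complex.star_def, Complex.conj_ofReal] using this

/-- Congruence by T = S⁻¹ turns observability into a controllability equation with input TC*, which
supplies the second half of the dilated Gramian. -/
lemma dual_observability (h : TruncationStep J A S T B C s) :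
    A * T + T * Aᴴ + T * Cᴴ * (C * T) = 0 := by
  have h1 := congrArg (fun W => T * W * T) h.observability
  simp only [Matrix.mul_add, Matrix.add_mul, Matrix.mul_zero, Matrix.zero_mul] at h1
  have e1 : T * (Aᴴ * S) * T = T * Aᴴ := by
    rw [Matrix.mul_assoc, Matrix.mul_assoc, h.mul_inv, Matrix.mul_one]
  have e2 : T * (S * A) * T = A * T := by
    rw [← Matrix.mul_assoc, h.inv_mul, Matrix.one_mul]
  rw [e1, e2] at h1
  rw [← h1]
  simp only [Matrix.mul_assoc]
  abel

end TruncationStep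

/-- The stacked matrix `[J; I]`. -/
def stackPos (J : Matrix ι κ ℂ) : Matrix (ι ⊕ κ) κ ℂ := fromRows J 1

/-- The stacked matrix `[J; -I]`. -/
def stackNeg (J : Matrix ι κ ℂ) : Matrix (ι ⊕ κ) κ ℂ := fromRows J (-1)

/-- The state matrix of the error system of a truncation. -/
def errorA (J : Matrix ι κ ℂ) (A : Matrix κ κ ℂ) : Matrix (ι ⊕ κ) (ι ⊕ κ) ℂ :=
  fromBlocks (J * A * Jᴴ) 0 0 A

/-- The input matrix of the all-pass dilation of the error system. -/
def errorB (J : Matrix ι κ ℂ) (T : Matrix κ κ ℂ) (B : Matrix κ b ℂ) (C : Matrix a κ ℂ) (s : ℝ) :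
    Matrix (ι ⊕ κ) (b ⊕ a) ℂ :=
  fromCols (stackPos J * B) ((s : ℂ) • (stackNeg J * (T * Cᴴ)))

/-- The output matrix of the all-pass dilation of the error system. -/
def errorC (J : Matrix ι κ ℂ) (T : Matrix κ κ ℂ) (B : Matrix κ b ℂ) (C : Matrix a κ ℂ) (s : ℝ) :
    Matrix (a ⊕ b) (ι ⊕ κ) ℂ :=
  (fromCols (-(stackNeg J * Cᴴ)) (-((s : ℂ) • (stackPos J * (T * B)))))ᴴ

/-- The Gramian of the all-pass dilation of the error system. -/
def errorP (J : Matrix ι κ ℂ) (S T : Matrix κ κ ℂ) (s : ℝ) : Matrix (ι ⊕ κ) (ι ⊕ κ) ℂ :=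
  stackPos J * S * (stackPos J)ᴴ + ((s : ℂ) ^ 2) • (stackNeg J * T * (stackNeg J)ᴴ)

/-- The feedthrough matrix of the all-pass dilation of the error system. -/
def errorD (a b : Type*) [DecidableEq a] [DecidableEq b] (s : ℝ) : Matrix (a ⊕ b) (b ⊕ a) ℂ :=
  fromBlocks 0 (((2 * s : ℝ) : ℂ) • 1) (((2 * s : ℝ) : ℂ) • 1) 0

namespace TruncationStep

variable {J : Matrix ι κ ℂ} {A S T : Matrix κ κ ℂ} {B : Matrix κ b ℂ} {C : Matrix a κ ℂ} {s : ℝ}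

lemma stackPos_gram : (stackPos J)ᴴ * stackPos J = (2 : ℂ) • 1 - (1 - Jᴴ * J) := by
  rw [stackPos, conjTranspose_fromRows_eq_fromCols_conjTranspose, fromCols_mul_fromRows,
    conjTranspose_one, Matrix.mul_one]
  module

lemma stackNeg_gram : (stackNeg J)ᴴ * stackNeg J = (2 : ℂ) • 1 - (1 - Jᴴ * J) := by
  rw [stackNeg, conjTranspose_fromRows_eq_fromCols_conjTranspose, fromCols_mul_fromRows,
    conjTranspose_neg, conjTranspose_one, neg_mul_neg, Matrix.mul_one]
  module

lemma stackPos_stackNeg : (stackPos J)ᴴ * stackNeg J = -(1 - Jᴴ * J) := by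
  rw [stackPos, stackNeg, conjTranspose_fromRows_eq_fromCols_conjTranspose, fromCols_mul_fromRows,
    conjTranspose_one, Matrix.mul_neg, Matrix.mul_one]
  abel

lemma stackNeg_stackPos : (stackNeg J)ᴴ * stackPos J = -(1 - Jᴴ * J) := by
  rw [stackPos, stackNeg, conjTranspose_fromRows_eq_fromCols_conjTranspose, fromCols_mul_fromRows,
    conjTranspose_neg, conjTranspose_one, Matrix.mul_one]
  abel

lemma stackNeg_mul_compl (h : TruncationStep J A S T B C s) :
    stackNeg J * (1 - Jᴴ * J) = -(stackPos J * (1 - Jᴴ * J)) := by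
  rw [stackPos, stackNeg, fromRows_mul, fromRows_mul, h.mul_compl, Matrix.neg_mul]
  ext (i | i) j <;> simp

/-- The stacked matrix intertwines the two state matrices up to a defect that sees only the
discarded states; `stackNeg` has the same defect. -/
lemma errorA_mul_stackPos :
    errorA J A * stackPos J = stackPos J * A - fromRows (J * A * (1 - Jᴴ * J)) 0 := by
  rw [errorA, stackPos, fromBlocks_mul_fromRows, fromRows_mul]
  simp only [Matrix.mul_sub, Matrix.mul_one, Matrix.mul_assoc, Matrix.zero_mul, Matrix.one_mul]
  ext (i | i) j <;> simp

lemma errorA_mul_stackNeg :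
    errorA J A * stackNeg J = stackNeg J * A - fromRows (J * A * (1 - Jᴴ * J)) 0 := by
  rw [errorA, stackNeg, fromBlocks_mul_fromRows, fromRows_mul]
  simp only [Matrix.mul_sub, Matrix.mul_one, Matrix.mul_assoc, Matrix.zero_mul]
  ext (i | i) j <;> simp

lemma errorP_conjTranspose (h : TruncationStep J A S T B C s) :
    (errorP J S T s)ᴴ = errorP J S T s := by
  simp [errorP, conjTranspose_mul, h.hermitian, h.inv_hermitian, Matrix.mul_assoc]

/-- On the discarded states S acts as s, T as s⁻¹, and V as -U. The two defects therefore contribute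
-s and s²·s⁻¹ times the same matrix and cancel; this fixes the weight s² in `errorP`. -/
lemma errorA_mul_errorP (h : TruncationStep J A S T B C s) :
    errorA J A * errorP J S T s = stackPos J * (A * S) * (stackPos J)ᴴ
      + ((s : ℂ) ^ 2) • (stackNeg J * (A * T) * (stackNeg J)ᴴ) := by
  set L : Matrix (ι ⊕ κ) κ ℂ := fromRows (J * A * (1 - Jᴴ * J)) 0 with hL
  have hL' : L = fromRows (J * A) 0 * (1 - Jᴴ * J) := by
    rw [hL, fromRows_mul, Matrix.zero_mul]
  have hLS : L * S = (s : ℂ) • L := by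
    have := congrArg conjTranspose h.discarded
    simp only [conjTranspose_mul, conjTranspose_smul, compl_conjTranspose, h.hermitian,
      Complex.star_def, Complex.conj_ofReal] at this
    rw [hL', Matrix.mul_assoc, this, Matrix.mul_smul]
  have hLT : L * T = (s : ℂ)⁻¹ • L := by
    rw [hL', Matrix.mul_assoc, h.compl_mul_inv, Matrix.mul_smul]
  have hLV : L * (stackNeg J)ᴴ = -(L * (stackPos J)ᴴ) := by
    have := congrArg conjTranspose h.stackNeg_mul_compl
    rw [conjTranspose_neg, conjTranspose_mul, conjTranspose_mul, compl_conjTranspose] at this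
    rw [hL', Matrix.mul_assoc, this, Matrix.mul_neg, Matrix.mul_assoc]
  have e1 : errorA J A * (stackPos J * S * (stackPos J)ᴴ)
      = stackPos J * (A * S) * (stackPos J)ᴴ - (s : ℂ) • (L * (stackPos J)ᴴ) := by
    rw [← Matrix.mul_assoc, ← Matrix.mul_assoc, errorA_mul_stackPos, ← hL, Matrix.sub_mul, hLS,
      Matrix.sub_mul, Matrix.smul_mul]
    simp only [Matrix.mul_assoc]
  have e2 : errorA J A * (stackNeg J * T * (stackNeg J)ᴴ)
      = stackNeg J * (A * T) * (stackNeg J)ᴴ + (s : ℂ)⁻¹ • (L * (stackPos J)ᴴ) := by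
    rw [← Matrix.mul_assoc, ← Matrix.mul_assoc, errorA_mul_stackNeg, ← hL, Matrix.sub_mul, hLT,
      Matrix.sub_mul, Matrix.smul_mul, hLV, smul_neg, sub_neg_eq_add]
    simp only [Matrix.mul_assoc]
  have hs : (s : ℂ) ^ 2 * (s : ℂ)⁻¹ = s := by
    have := h.ne_zero
    field_simp
  rw [errorP, Matrix.mul_add, Matrix.mul_smul, e1, e2, smul_add, smul_smul, hs]
  abel

lemma errorB_gram (h : TruncationStep J A S T B C s) :
    errorB J T B C s * (errorB J T B C s)ᴴ = stackPos J * (B * Bᴴ) * (stackPos J)ᴴ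
      + ((s : ℂ) ^ 2) • (stackNeg J * (T * Cᴴ * (C * T)) * (stackNeg J)ᴴ) := by
  rw [errorB, conjTranspose_fromCols_eq_fromRows_conjTranspose, fromCols_mul_fromRows]
  simp only [conjTranspose_smul, conjTranspose_mul, conjTranspose_conjTranspose, h.inv_hermitian,
    Matrix.mul_assoc, Matrix.smul_mul, Matrix.mul_smul, smul_smul, Complex.star_def,
    Complex.conj_ofReal, pow_two]

lemma errorP_lyapunov (h : TruncationStep J A S T B C s) :
    errorA J A * errorP J S T s + errorP J S T s * (errorA J A)ᴴ
      + errorB J T B C s * (errorB J T B C s)ᴴ = 0 := by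
  have e1 := h.errorA_mul_errorP
  have e2 : errorP J S T s * (errorA J A)ᴴ = stackPos J * (S * Aᴴ) * (stackPos J)ᴴ
      + ((s : ℂ) ^ 2) • (stackNeg J * (T * Aᴴ) * (stackNeg J)ᴴ) := by
    have := congrArg conjTranspose e1
    rw [conjTranspose_mul, h.errorP_conjTranspose] at this
    rw [this]
    simp [conjTranspose_mul, h.hermitian, h.inv_hermitian, Matrix.mul_assoc]
  have e3 := congrArg (fun W => stackPos J * W * (stackPos J)ᴴ) h.controllability
  have e4 := congrArg (fun W => ((s : ℂ) ^ 2) • (stackNeg J * W * (stackNeg J)ᴴ))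
    h.dual_observability
  simp only [Matrix.mul_add, Matrix.add_mul, Matrix.mul_zero, Matrix.zero_mul, smul_add,
    smul_zero] at e3 e4
  rw [e1, e2, h.errorB_gram]
  have e5 := congrArg₂ (· + ·) e3 e4
  simp only [add_zero] at e5
  rw [← e5]
  abel

/-- The Gram matrices of U and V are 2 - R and their cross products -R, where R projects onto the
discarded states. The weight s² again cancels the R terms. -/
lemma errorP_mul_stackNeg (h : TruncationStep J A S T B C s) :
    errorP J S T s * stackNeg J = ((2 : ℂ) * s ^ 2) • (stackNeg J * T) := by
  have e1 : stackPos J * S * (stackPos J)ᴴ * stackNeg J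
      = -((s : ℂ) • (stackPos J * (1 - Jᴴ * J))) := by
    rw [Matrix.mul_assoc, stackPos_stackNeg, Matrix.mul_assoc, Matrix.mul_neg, h.discarded,
      Matrix.mul_neg, Matrix.mul_smul]
  have e2 : stackNeg J * T * (stackNeg J)ᴴ * stackNeg J
      = (2 : ℂ) • (stackNeg J * T) + (s : ℂ)⁻¹ • (stackPos J * (1 - Jᴴ * J)) := by
    rw [Matrix.mul_assoc, stackNeg_gram, Matrix.mul_sub, Matrix.mul_assoc _ T (1 - _),
      h.inv_mul_compl, Matrix.mul_smul, Matrix.mul_smul, Matrix.mul_one, h.stackNeg_mul_compl,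
      smul_neg, sub_neg_eq_add]
  have hs : (s : ℂ) ^ 2 * (s : ℂ)⁻¹ = s := by
    have := h.ne_zero
    field_simp
  rw [errorP, Matrix.add_mul, e1, Matrix.smul_mul, e2, smul_add, smul_smul, smul_smul, hs,
    mul_comm]
  abel

lemma errorP_mul_stackPos (h : TruncationStep J A S T B C s) :
    errorP J S T s * stackPos J = (2 : ℂ) • (stackPos J * S) := by
  have e1 : stackPos J * S * (stackPos J)ᴴ * stackPos J
      = (2 : ℂ) • (stackPos J * S) - (s : ℂ) • (stackPos J * (1 - Jᴴ * J)) := by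
    rw [Matrix.mul_assoc, stackPos_gram, Matrix.mul_sub, Matrix.mul_assoc _ S (1 - _),
      h.discarded, Matrix.mul_smul, Matrix.mul_smul, Matrix.mul_one]
  have e2 : stackNeg J * T * (stackNeg J)ᴴ * stackPos J
      = (s : ℂ)⁻¹ • (stackPos J * (1 - Jᴴ * J)) := by
    rw [Matrix.mul_assoc, stackNeg_stackPos, Matrix.mul_neg, Matrix.mul_assoc,
      h.inv_mul_compl, Matrix.mul_smul, h.stackNeg_mul_compl, smul_neg, neg_neg]
  have hs : (s : ℂ) ^ 2 * (s : ℂ)⁻¹ = s := by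
    have := h.ne_zero
    field_simp
  rw [errorP, Matrix.add_mul, e1, Matrix.smul_mul, e2, smul_smul, hs]
  abel

lemma errorP_mul_output (h : TruncationStep J A S T B C s) :
    errorP J S T s * (-(stackNeg J * Cᴴ)) = -(((2 : ℂ) * s ^ 2) • (stackNeg J * (T * Cᴴ))) := by
  rw [Matrix.mul_neg, ← Matrix.mul_assoc, h.errorP_mul_stackNeg, Matrix.smul_mul, Matrix.mul_assoc]

variable [DecidableEq a] [DecidableEq b]

lemma errorP_mul_errorC (h : TruncationStep J A S T B C s) :
    errorP J S T s * (errorC J T B C s)ᴴ = -(errorB J T B C s * (errorD a b s)ᴴ) := by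
  have e1 : errorB J T B C s * (errorD a b s)ᴴ = fromCols
      (((2 : ℂ) * s ^ 2) • (stackNeg J * (T * Cᴴ))) (((2 : ℂ) * s) • (stackPos J * B)) := by
    have hs : star (2 * (s : ℂ)) = 2 * (s : ℂ) := by
      rw [← Complex.ofReal_ofNat, ← Complex.ofReal_mul]
      exact Complex.conj_ofReal _
    rw [errorB, errorD, fromBlocks_conjTranspose, fromCols_mul_fromBlocks]
    simp only [conjTranspose_zero, conjTranspose_smul, conjTranspose_one, Matrix.mul_zero,
      Matrix.mul_smul, Matrix.mul_one, zero_add, add_zero, smul_smul, hs,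
      Complex.ofReal_mul, Complex.ofReal_ofNat, pow_two, mul_assoc]
  have e2 : errorP J S T s * (-((s : ℂ) • (stackPos J * (T * B))))
      = -(((2 : ℂ) * s) • (stackPos J * B)) := by
    rw [Matrix.mul_neg, Matrix.mul_smul, ← Matrix.mul_assoc, h.errorP_mul_stackPos,
      Matrix.smul_mul, smul_smul, Matrix.mul_assoc, ← Matrix.mul_assoc S, h.mul_inv,
      Matrix.one_mul, mul_comm]
  rw [errorC, conjTranspose_conjTranspose, mul_fromCols, h.errorP_mul_output, e2, e1]
  ext i (j | j) <;> simp

end TruncationStep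

end OneStep

/-! ### Consequences of the dilation: the error of one step and its first Markov parameter -/

section OneStepBounds

variable {ι κ a b : Type*} [Fintype ι] [Fintype κ] [Fintype a] [Fintype b]
  [DecidableEq ι] [DecidableEq κ] [DecidableEq a] [DecidableEq b]

namespace TruncationStep

variable {J : Matrix ι κ ℂ} {A S T : Matrix κ κ ℂ} {B : Matrix κ b ℂ} {C : Matrix a κ ℂ} {s : ℝ}

/-- One truncation step changes the frequency response by at most twice the discarded
singular value. -/
lemma norm_freq_sub_le (h : TruncationStep J A S T B C s) {z : ℂ} (hz : z + star z = 0)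
    {X : Matrix κ κ ℂ} {Y : Matrix ι ι ℂ} (hX : X * (z • 1 - A) = 1)
    (hY : Y * (z • 1 - J * A * Jᴴ) = 1) :
    ‖C * X * B - C * Jᴴ * Y * (J * B)‖ ≤ 2 * s := by
  set N : Matrix (ι ⊕ κ) (ι ⊕ κ) ℂ := z • 1 - errorA J A with hN
  set X' : Matrix (ι ⊕ κ) (ι ⊕ κ) ℂ := fromBlocks Y 0 0 X with hX'
  have hNb : N = fromBlocks (z • 1 - J * A * Jᴴ) 0 0 (z • 1 - A) := by
    rw [hN, errorA, ← fromBlocks_one, fromBlocks_smul, sub_eq_add_neg, fromBlocks_neg,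
      fromBlocks_add]
    simp [sub_eq_add_neg]
  have h1 : X' * N = 1 := by
    rw [hX', hNb, fromBlocks_multiply, hX, hY]
    simp
  set P := errorP J S T s with hP
  have h2 : N * P + P * Nᴴ = errorB J T B C s * (errorB J T B C s)ᴴ := by
    have e := eq_neg_of_add_eq_zero_right h.errorP_lyapunov
    rw [e, hN, conjTranspose_sub, conjTranspose_smul, conjTranspose_one, Matrix.sub_mul,
      Matrix.mul_sub, Matrix.smul_mul, Matrix.mul_smul, Matrix.one_mul, Matrix.mul_one]
    have e2 : z • P + star z • P = 0 := by rw [← add_smul, hz, zero_smul]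
    calc _ = (z • P + star z • P) - (errorA J A * P + P * (errorA J A)ᴴ) := by abel
      _ = _ := by rw [e2, zero_sub]
  -- The first block row of the dilation is enough: its feedthrough [0, 2sI] has Gram matrix (2s)²
  -- I, and the first block of its response is the truncation error.
  set C₁ : Matrix a (ι ⊕ κ) ℂ := (-(stackNeg J * Cᴴ))ᴴ with hC₁
  set D₁ : Matrix a (b ⊕ a) ℂ := fromCols 0 (((2 * s : ℝ) : ℂ) • 1) with hD₁
  have hs : star ((2 * s : ℝ) : ℂ) = 2 * s := by
    rw [← Complex.ofReal_ofNat, ← Complex.ofReal_mul]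
    exact Complex.conj_ofReal _
  have h3 : P * C₁ᴴ = -(errorB J T B C s * D₁ᴴ) := by
    rw [hC₁, conjTranspose_conjTranspose, h.errorP_mul_output, errorB, hD₁,
      conjTranspose_fromCols_eq_fromRows_conjTranspose, fromCols_mul_fromRows]
    simp only [conjTranspose_zero, conjTranspose_smul, conjTranspose_one, Matrix.mul_zero, zero_add,
      Matrix.mul_smul, Matrix.mul_one, smul_smul, hs, pow_two, mul_assoc]
  have h4 := allPass_mul_conjTranspose h1 h.errorP_conjTranspose h2 h3
  have h5 : D₁ * D₁ᴴ = (((2 * s) ^ 2 : ℝ) : ℂ) • (1 : Matrix a a ℂ) := by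
    rw [hD₁, conjTranspose_fromCols_eq_fromRows_conjTranspose, fromCols_mul_fromRows]
    simp [smul_smul, pow_two]
  have h6 : C₁ * X' * errorB J T B C s + D₁ = fromCols (C₁ * X' * (stackPos J * B))
      (C₁ * X' * ((s : ℂ) • (stackNeg J * (T * Cᴴ))) + ((2 * s : ℝ) : ℂ) • 1) := by
    rw [errorB, hD₁, mul_fromCols]
    ext i (j | j) <;> simp
  rw [h5, h6, conjTranspose_fromCols_eq_fromRows_conjTranspose, fromCols_mul_fromRows] at h4
  have h7 := norm_le_of_mul_conjTranspose_add _ _ (by linarith [h.pos]) h4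
  have h8 : C₁ * X' * (stackPos J * B) = C * X * B - C * Jᴴ * Y * (J * B) := by
    rw [hC₁, hX', stackPos, stackNeg, fromRows_mul, fromRows_mul,
      conjTranspose_neg, conjTranspose_fromRows_eq_fromCols_conjTranspose, Matrix.neg_mul,
      fromCols_mul_fromBlocks, Matrix.neg_mul, fromCols_mul_fromRows]
    simp [Matrix.mul_assoc, conjTranspose_mul]
    abel
  rwa [h8] at h7

/-- The Gram relations of U and V, together with TR = RT = s⁻¹R, reduce each block to expressions in
R = 1 - J*J and T. The upper left block is the Markov parameter that truncation removes. -/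
lemma errorC_mul_errorB (h : TruncationStep J A S T B C s) :
    errorC J T B C s * errorB J T B C s = fromBlocks (C * (1 - Jᴴ * J) * B)
      (C * (1 - Jᴴ * J) * Cᴴ - (2 * s : ℂ) • (C * T * Cᴴ))
      (Bᴴ * (1 - Jᴴ * J) * B - (2 * s : ℂ) • (Bᴴ * T * B)) (Bᴴ * (1 - Jᴴ * J) * Cᴴ) := by
  have hs := h.ne_zero
  have c : (s : ℂ) * (s : ℂ)⁻¹ = 1 := mul_inv_cancel₀ hs
  set R := 1 - Jᴴ * J with hR
  have e1 : -(stackNeg J * Cᴴ)ᴴ * (stackPos J * B) = C * R * B := by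
    rw [conjTranspose_mul, conjTranspose_conjTranspose, Matrix.neg_mul, Matrix.mul_assoc,
      ← Matrix.mul_assoc _ (stackPos J) B, stackNeg_stackPos, ← hR]
    simp [Matrix.mul_assoc]
  have e2 : -(stackNeg J * Cᴴ)ᴴ * ((s : ℂ) • (stackNeg J * (T * Cᴴ)))
      = C * R * Cᴴ - (2 * s : ℂ) • (C * T * Cᴴ) := by
    rw [conjTranspose_mul, conjTranspose_conjTranspose, Matrix.neg_mul, Matrix.mul_smul,
      Matrix.mul_assoc, ← Matrix.mul_assoc _ (stackNeg J) _, stackNeg_gram, ← hR, Matrix.sub_mul,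
      ← Matrix.mul_assoc R, h.compl_mul_inv, Matrix.mul_sub, Matrix.smul_mul, Matrix.smul_mul,
      Matrix.mul_smul, Matrix.mul_smul, smul_sub, smul_smul, smul_smul, c, Matrix.one_mul,
      one_smul, neg_sub, mul_comm]
    simp only [Matrix.mul_assoc, ← hR]
  have e3 : -((s : ℂ) • (stackPos J * (T * B)))ᴴ * (stackPos J * B)
      = Bᴴ * R * B - (2 * s : ℂ) • (Bᴴ * T * B) := by
    rw [conjTranspose_smul, conjTranspose_mul, conjTranspose_mul, h.inv_hermitian, Matrix.neg_mul,
      Matrix.smul_mul, Matrix.mul_assoc, Matrix.mul_assoc, ← Matrix.mul_assoc _ (stackPos J) _,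
      stackPos_gram, ← hR, Matrix.sub_mul, Matrix.mul_sub, ← Matrix.mul_assoc T R, h.inv_mul_compl,
      Matrix.mul_sub, Matrix.smul_mul, Matrix.smul_mul,
      Matrix.mul_smul, Matrix.mul_smul, Matrix.mul_smul, smul_sub, smul_smul, smul_smul,
      Complex.star_def, Complex.conj_ofReal, c, Matrix.one_mul, one_smul, neg_sub, mul_comm]
    simp only [Matrix.mul_assoc, ← hR]
  have e4 : -((s : ℂ) • (stackPos J * (T * B)))ᴴ * ((s : ℂ) • (stackNeg J * (T * Cᴴ)))
      = Bᴴ * R * Cᴴ := by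
    rw [conjTranspose_smul, conjTranspose_mul, conjTranspose_mul, h.inv_hermitian, Matrix.neg_mul,
      Matrix.smul_mul, Matrix.mul_smul, Matrix.mul_assoc, Matrix.mul_assoc,
      ← Matrix.mul_assoc _ (stackNeg J) _,
      stackPos_stackNeg, ← hR, ← Matrix.mul_assoc _ T Cᴴ, Matrix.neg_mul, h.compl_mul_inv,
      ← hR, Matrix.neg_mul, Matrix.mul_neg, Matrix.mul_neg, Matrix.smul_mul, Matrix.mul_smul,
      ← Matrix.mul_assoc T, h.inv_mul_compl, ← hR]
    simp only [Matrix.mul_smul, smul_neg, neg_neg, smul_smul, Matrix.smul_mul, Complex.star_def,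
      Complex.conj_ofReal, Matrix.mul_assoc]
    rw [show (s : ℂ) * (s * ((s : ℂ)⁻¹ * (s : ℂ)⁻¹)) = 1 by field_simp, one_smul]
  rw [errorC, errorB, conjTranspose_fromCols_eq_fromRows_conjTranspose, fromRows_mul_fromCols,
    conjTranspose_neg, conjTranspose_neg, e1, e2, e3, e4]

/-- If a single state is discarded, then the Markov parameter of the error system is at most half
as large as that of its all-pass dilation. -/
lemma two_mul_norm_le_norm_errorC_mul_errorB (h : TruncationStep J A S T B C s) {e : κ → ℂ}
    (he : 1 - Jᴴ * J = vecMulVec e (star e)) (hJe : J *ᵥ e = 0)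
    (hT : ∀ y : κ → ℂ, (star y ⬝ᵥ ((1 - Jᴴ * J) *ᵥ y)).re ≤ s * (star y ⬝ᵥ (T *ᵥ y)).re) :
    2 * ‖C * (1 - Jᴴ * J) * B‖ ≤ ‖errorC J T B C s * errorB J T B C s‖ := by
  set Q := errorC J T B C s * errorB J T B C s with hQ
  set c := C *ᵥ e with hc
  set d := Bᴴ *ᵥ e with hd
  set R := 1 - Jᴴ * J with hR
  have hRe : R *ᵥ e = e := by
    rw [hR, sub_mulVec, ← mulVec_mulVec, hJe]
    simp
  have hSe : S *ᵥ e = (s : ℂ) • e := by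
    have := congrArg (fun W => W *ᵥ e) h.discarded
    simpa only [← mulVec_mulVec, smul_mulVec, ← hR, hRe] using this
  set α := star e ⬝ᵥ (A *ᵥ e) with hα
  have hα' : star e ⬝ᵥ (Aᴴ *ᵥ e) = star α := by
    have := star_mulVec_dotProduct_mulVec A 1 e e
    rw [one_mulVec, Matrix.mul_one] at this
    rw [← this, star_dotProduct, hα]
  have hSe' : ∀ y, star e ⬝ᵥ (S *ᵥ y) = s * (star e ⬝ᵥ y) := by
    intro y
    have := star_mulVec_dotProduct_mulVec S 1 e y
    rw [hSe, h.hermitian, one_mulVec, Matrix.mul_one] at this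
    rw [← this]
    simp
  -- Testing both Lyapunov equations on the discarded eigenvector e of S gives ‖B*e‖² = ‖Ce‖² = -2s
  -- Re(e*Ae). Hence the rank-one matrix CRB = cd* has norm at most the common value β.
  have hdd : star d ⬝ᵥ d = -(s * (α + star α)) := by
    have h1 := congrArg (fun W => star e ⬝ᵥ (W *ᵥ e)) h.controllability
    simp only [add_mulVec, dotProduct_add, ← mulVec_mulVec, hSe, mulVec_smul, dotProduct_smul,
      hSe', hα', zero_mulVec, dotProduct_zero, smul_eq_mul] at h1
    have h2 : star e ⬝ᵥ (B *ᵥ (Bᴴ *ᵥ e)) = star d ⬝ᵥ d := by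
      rw [hd, star_mulVec, conjTranspose_conjTranspose, dotProduct_mulVec]
    rw [h2] at h1
    rw [eq_neg_iff_add_eq_zero, ← h1, hα]
    ring
  have hcc : star c ⬝ᵥ c = -(s * (α + star α)) := by
    have h1 := congrArg (fun W => star e ⬝ᵥ (W *ᵥ e)) h.observability
    simp only [add_mulVec, dotProduct_add, ← mulVec_mulVec, hSe, mulVec_smul, dotProduct_smul,
      hSe', hα', zero_mulVec, dotProduct_zero, smul_eq_mul] at h1
    have h2 : star e ⬝ᵥ (Cᴴ *ᵥ (C *ᵥ e)) = star c ⬝ᵥ c := by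
      rw [hc, star_mulVec, dotProduct_mulVec]
    rw [h2] at h1
    rw [eq_neg_iff_add_eq_zero, ← h1, hα]
    ring
  set β := ‖WithLp.toLp 2 c‖ ^ 2 with hβ
  have hβd : ‖WithLp.toLp 2 d‖ ^ 2 = β := by
    rw [hβ, norm_toLp_sq, norm_toLp_sq, hdd, hcc]
  have hcβ : star c ⬝ᵥ c = (β : ℂ) := by
    have : (star c ⬝ᵥ c).im = 0 := by
      rw [hcc]; simp
    rw [hβ, norm_toLp_sq]
    exact Complex.ext (by simp) (by simpa using this)
  have hdβ : star d ⬝ᵥ d = (β : ℂ) := by rw [hdd, ← hcc, hcβ]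
  have hβ0 : 0 ≤ β := sq_nonneg _
  have hdn : ‖WithLp.toLp 2 d‖ = ‖WithLp.toLp 2 c‖ := by
    rw [← sq_eq_sq₀ (norm_nonneg _) (norm_nonneg _), hβd]
  have hup : ‖C * R * B‖ ≤ β := by
    refine opNorm_le_of_mulVec_le _ hβ0 fun x => ?_
    have h1 : (C * R * B) *ᵥ x = (star d ⬝ᵥ x) • c := by
      have h2 : star e ⬝ᵥ (B *ᵥ x) = star d ⬝ᵥ x := by
        rw [hd, star_mulVec, conjTranspose_conjTranspose, dotProduct_mulVec]
      rw [← mulVec_mulVec, ← mulVec_mulVec, he, vecMulVec_mulVec, h2,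
        op_smul_eq_smul, mulVec_smul]
    rw [h1, WithLp.toLp_smul, norm_smul]
    calc _ ≤ (‖WithLp.toLp 2 d‖ * ‖WithLp.toLp 2 x‖) * ‖WithLp.toLp 2 c‖ :=
          mul_le_mul_of_nonneg_right (norm_star_dotProduct_le _ _) (norm_nonneg _)
      _ = _ := by rw [hdn, hβ]; ring
  suffices hlow : 2 * β ≤ ‖Q‖ by linarith
  set x := Cᴴ *ᵥ c with hx
  set y := B *ᵥ d with hy
  have hex : star e ⬝ᵥ x = β := by
    rw [hx, dotProduct_mulVec, ← star_mulVec, ← hc, hcβ]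
  have hey : star e ⬝ᵥ y = β := by
    rw [hy, ← hdβ, hd, star_mulVec, conjTranspose_conjTranspose, dotProduct_mulVec]
  have hRf : ∀ u v : κ → ℂ, star u ⬝ᵥ (R *ᵥ v) = star (star e ⬝ᵥ u) * (star e ⬝ᵥ v) := by
    intro u v
    rw [he, vecMulVec_mulVec, op_smul_eq_smul, dotProduct_smul, smul_eq_mul,
      mul_comm, star_dotProduct u e]
  have hR1 : star x ⬝ᵥ (R *ᵥ x) = (β : ℂ) * β := by simp [hRf, hex]
  have hR2 : star x ⬝ᵥ (R *ᵥ y) = (β : ℂ) * β := by simp [hRf, hex, hey]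
  have hR3 : star y ⬝ᵥ (R *ᵥ x) = (β : ℂ) * β := by simp [hRf, hex, hey]
  have hR4 : star y ⬝ᵥ (R *ᵥ y) = (β : ℂ) * β := by simp [hRf, hey]
  have hTx := hT x
  have hTy := hT y
  -- With these signs the four R terms, each equal to β², cancel in u*Qv. What remains is 2s(x*Tx +
  -- y*Ty) ≥ 4β² by `hT`, while ‖u‖‖v‖ = 2β, so ‖Q‖ ≥ 2β.
  set u : a ⊕ b → ℂ := Sum.elim c (-d) with hu
  set v : b ⊕ a → ℂ := Sum.elim d (-c) with hv
  have hsu : star u = Sum.elim (star c) (-star d) := by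
    ext (i | i) <;> simp [hu]
  have hsv : star v = Sum.elim (star d) (-star c) := by
    ext (i | i) <;> simp [hv]
  have hun : ‖WithLp.toLp 2 u‖ ^ 2 = 2 * β := by
    rw [norm_toLp_sq, hsu, hu, sumElim_dotProduct_sumElim, neg_dotProduct_neg, hcβ, hdβ]
    simp; ring
  have hvn : ‖WithLp.toLp 2 v‖ ^ 2 = 2 * β := by
    rw [norm_toLp_sq, hsv, hv, sumElim_dotProduct_sumElim, neg_dotProduct_neg, hcβ, hdβ]
    simp; ring
  have hval : star u ⬝ᵥ (Q *ᵥ v) = star x ⬝ᵥ (R *ᵥ y) - star x ⬝ᵥ (R *ᵥ x)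
      + 2 * s * (star x ⬝ᵥ (T *ᵥ x)) - star y ⬝ᵥ (R *ᵥ y) + 2 * s * (star y ⬝ᵥ (T *ᵥ y))
      + star y ⬝ᵥ (R *ᵥ x) := by
    have hsx : ∀ w, star c ⬝ᵥ (C *ᵥ w) = star x ⬝ᵥ w := fun w => by
      rw [hx, star_mulVec Cᴴ c, conjTranspose_conjTranspose, dotProduct_mulVec]
    have hsy : ∀ w, star d ⬝ᵥ (Bᴴ *ᵥ w) = star y ⬝ᵥ w := fun w => by
      rw [hy, star_mulVec B d, dotProduct_mulVec]
    rw [hQ, h.errorC_mul_errorB, ← hR, hsu, hv, fromBlocks_mulVec, sumElim_dotProduct_sumElim]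
    simp only [Sum.elim_comp_inl, Sum.elim_comp_inr, sub_mulVec, mulVec_neg, dotProduct_add,
      dotProduct_neg, neg_dotProduct, dotProduct_sub, smul_mulVec, ← mulVec_mulVec, ← hx, ← hy,
      dotProduct_smul, hsx, hsy, smul_eq_mul]
    ring
  have hlow : 4 * β ^ 2 ≤ (star u ⬝ᵥ (Q *ᵥ v)).re := by
    rw [hval, hR1, hR2, hR3, hR4]
    rw [hR1] at hTx
    rw [hR4] at hTy
    rw [← Complex.ofReal_mul, Complex.ofReal_re] at hTx hTy
    have e1 : ∀ w : ℂ, (2 * (s : ℂ) * w).re = 2 * (s * w.re) := fun w => by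
      simp; ring
    simp only [Complex.add_re, Complex.sub_re, e1, ← Complex.ofReal_mul, Complex.ofReal_re]
    linarith
  have hhigh : (star u ⬝ᵥ (Q *ᵥ v)).re ≤ ‖Q‖ * (2 * β) := by
    refine (Complex.re_le_norm _).trans ((norm_star_dotProduct_le _ _).trans ?_)
    have huv : ‖WithLp.toLp 2 u‖ = ‖WithLp.toLp 2 v‖ := by
      rw [← sq_eq_sq₀ (norm_nonneg _) (norm_nonneg _), hun, hvn]
    calc _ ≤ ‖WithLp.toLp 2 u‖ * (‖Q‖ * ‖WithLp.toLp 2 v‖) :=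
          mul_le_mul_of_nonneg_left (norm_toLp_mulVec_le Q v) (norm_nonneg _)
      _ = ‖Q‖ * ‖WithLp.toLp 2 v‖ ^ 2 := by rw [huv]; ring
      _ = _ := by rw [hvn]
  rcases hβ0.eq_or_lt with h0 | h0
  · rw [← h0]; simp
  · nlinarith

end TruncationStep

end OneStepBounds

/-! ### Square roots that do not commute with the state matrix -/

section SquareRoot

variable {ν a b c : Type*} [Fintype ν] [Fintype a] [Fintype b] [Fintype c] [DecidableEq ν]

open scoped ComplexOrder in
/-- If `K` intertwines `E` and `-E`, and `E` has Gramians `P ≥ 0` and `Q > 0`, then `K` vanishes on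
the controllable directions. -/
lemma mul_eq_zero_of_anticommute [DecidableEq b] {E K P Q : Matrix ν ν ℂ} {B : Matrix ν b ℂ}
    {C : Matrix c ν ℂ} (hP : P.PosSemidef) (hQ : Q.PosDef) (hK : E * K + K * E = 0)
    (hEP : E * P + P * Eᴴ + B * Bᴴ = 0) (hEQ : Eᴴ * Q + Q * E + Cᴴ * C = 0) : K * B = 0 := by
  set Y := K * P * Kᴴ with hY
  have hYps : Y.PosSemidef := hP.mul_mul_conjTranspose_same K
  have hEK : E * K = -(K * E) := eq_neg_of_add_eq_zero_left hK
  have hEK' : Kᴴ * Eᴴ = -(Eᴴ * Kᴴ) := by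
    rw [← conjTranspose_mul, hEK, conjTranspose_neg, conjTranspose_mul]
  -- Anticommutation reverses the sign of the Lyapunov equation for Y = KPK*. Pairing it with Q
  -- under the trace then makes two nonnegative traces sum to zero.
  have h1 : E * Y + Y * Eᴴ = K * B * (K * B)ᴴ := by
    have e : B * Bᴴ = -(E * P + P * Eᴴ) := eq_neg_of_add_eq_zero_right hEP
    calc E * Y + Y * Eᴴ = (E * K) * P * Kᴴ + K * P * (Kᴴ * Eᴴ) := by
          simp only [hY, Matrix.mul_assoc]
      _ = K * (-(E * P + P * Eᴴ)) * Kᴴ := by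
          rw [hEK, hEK']
          simp only [Matrix.mul_neg, Matrix.neg_mul, Matrix.mul_add, Matrix.add_mul,
            Matrix.mul_assoc, neg_add]
      _ = _ := by
          rw [← e]
          simp only [conjTranspose_mul, Matrix.mul_assoc]
  have h2 : ((K * B)ᴴ * Q * (K * B)).trace + (C * Y * Cᴴ).trace = 0 := by
    have e1 : ((K * B)ᴴ * Q * (K * B)).trace = (Q * (K * B * (K * B)ᴴ)).trace := by
      rw [Matrix.mul_assoc, trace_mul_comm, Matrix.mul_assoc]
    have e2 : (C * Y * Cᴴ).trace = (Cᴴ * C * Y).trace := by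
      rw [trace_mul_comm, Matrix.mul_assoc]
    have e3 : (Q * (Y * Eᴴ)).trace = (Eᴴ * Q * Y).trace := by
      rw [← Matrix.mul_assoc, trace_mul_comm, Matrix.mul_assoc]
    rw [e1, e2, ← h1, Matrix.mul_add, trace_add, e3, ← Matrix.mul_assoc, ← trace_add, ← trace_add,
      ← Matrix.add_mul, ← Matrix.add_mul, add_comm (Q * E), hEQ, Matrix.zero_mul, trace_zero]
  have h3 := hQ.posSemidef.conjTranspose_mul_mul_same (K * B)
  have h4 := hYps.mul_mul_conjTranspose_same C
  have h5 : ((K * B)ᴴ * Q * (K * B)).trace = 0 :=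
    ((add_eq_zero_iff_of_nonneg h3.trace_nonneg h4.trace_nonneg).1 h2).1
  have h6 := h3.trace_eq_zero_iff.1 h5
  apply Matrix.ext_of_mulVec_single
  intro i
  rw [zero_mulVec]
  by_contra hne
  have h7 := hQ.dotProduct_mulVec_pos hne
  have h8 := star_mulVec_dotProduct_mulVec (K * B) (Q * (K * B)) (Pi.single i 1) (Pi.single i 1)
  rw [← Matrix.mul_assoc (K * B)ᴴ Q, h6, zero_mulVec, dotProduct_zero,
    ← mulVec_mulVec _ Q] at h8
  rw [h8] at h7
  exact lt_irrefl _ h7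

open scoped ComplexOrder in
/-- The product `M⁻¹ E M² M⁻¹ B` collapses to `E B`, even if the square root `M` does not commute
with `E`. -/
lemma sqrt_sandwich [DecidableEq b] {E M P Q : Matrix ν ν ℂ} {B : Matrix ν b ℂ}
    {C : Matrix c ν ℂ} {t : ℂ} (ht : t ≠ 0)
    (hP : P.PosSemidef) (hQ : Q.PosDef) (hEP : E * P + P * Eᴴ + B * Bᴴ = 0)
    (hEQ : Eᴴ * Q + Q * E + Cᴴ * C = 0) (hM : M * M * (E * E + t • 1) = t • 1) :
    M⁻¹ * (E * (M * M)) * (M⁻¹ * B) = E * B := by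
  have hMu : IsUnit M := by
    have h1 : M * (t⁻¹ • (M * (E * E + t • 1))) = 1 := by
      rw [Matrix.mul_smul, ← Matrix.mul_assoc, hM, smul_smul, inv_mul_cancel₀ ht, one_smul]
    exact IsUnit.of_mul_eq_one _ h1
  have hdet : IsUnit M.det := (isUnit_iff_isUnit_det M).1 hMu
  -- `hM` says E² + t = tM⁻². Thus M commutes with E², though perhaps not with E, and the commutator
  -- EM - ME anticommutes with E.
  have hcomm : M * (E * E) = E * E * M := by
    have h1 : E * E + t • 1 = t • (M⁻¹ * M⁻¹) := by
      calc E * E + t • 1 = M⁻¹ * (M⁻¹ * (M * M * (E * E + t • 1))) := by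
            rw [Matrix.mul_assoc M M, nonsing_inv_mul_cancel_left _ _ hdet,
              nonsing_inv_mul_cancel_left _ _ hdet]
        _ = _ := by rw [hM, Matrix.mul_smul, Matrix.mul_smul, Matrix.mul_one]
    have h2 : M * (E * E + t • 1) = (E * E + t • 1) * M := by
      rw [h1, Matrix.mul_smul, Matrix.smul_mul, ← Matrix.mul_assoc, mul_nonsing_inv _ hdet,
        Matrix.mul_assoc, nonsing_inv_mul _ hdet, Matrix.one_mul, Matrix.mul_one]
    rw [Matrix.mul_add, Matrix.add_mul, Matrix.mul_smul, Matrix.smul_mul, Matrix.mul_one,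
      Matrix.one_mul] at h2
    exact add_right_cancel h2
  have hK : E * (E * M - M * E) + (E * M - M * E) * E = 0 := by
    rw [Matrix.mul_sub, Matrix.sub_mul, Matrix.mul_assoc M E E, hcomm]
    simp only [Matrix.mul_assoc]
    abel
  have h1 := mul_eq_zero_of_anticommute hP hQ hK hEP hEQ
  rw [Matrix.sub_mul, sub_eq_zero, Matrix.mul_assoc, Matrix.mul_assoc] at h1
  calc M⁻¹ * (E * (M * M)) * (M⁻¹ * B) = M⁻¹ * (E * (M * (M * (M⁻¹ * B)))) := by
        simp only [Matrix.mul_assoc]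
    _ = M⁻¹ * (M * (E * B)) := by rw [mul_nonsing_inv_cancel_left _ _ hdet, h1]
    _ = _ := nonsing_inv_mul_cancel_left _ _ hdet

end SquareRoot

/-! ### Principal square roots -/

section PrincipalSqrt

open Polynomial

/-- A Sylvester equation whose coefficients S and -S have disjoint spectra. The relation gives q(S)K
= Kq(-S) for every q; for the characteristic polynomial of S the left side vanishes and q(-S) is
invertible. -/
lemma aeval_eq_zero_of_mul_eq_neg_mul {n : ℕ} {S K : Matrix (Fin n) (Fin n) ℂ}
    (hS : ∀ z ∈ spectrum ℂ S, 0 < z.re) (h : S * K = -(K * S)) : K = 0 := by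
  have h1 : ∀ q : ℂ[X], aeval S q * K = K * aeval (-S) q := by
    intro q
    induction q using Polynomial.induction_on' with
    | add p q hp hq => simp only [map_add, Matrix.add_mul, Matrix.mul_add, hp, hq]
    | monomial k c =>
      simp only [aeval_monomial, ← Algebra.smul_def, Matrix.smul_mul, Matrix.mul_smul]
      congr 1
      induction k with
      | zero => simp
      | succ k ih =>
        rw [pow_succ', pow_succ', Matrix.mul_assoc, ih, ← Matrix.mul_assoc, h, Matrix.neg_mul,
          Matrix.mul_assoc, Matrix.neg_mul, Matrix.mul_neg]
  have h2 := h1 S.charpoly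
  rw [aeval_self_charpoly, Matrix.zero_mul] at h2
  have h3 : IsUnit (aeval (-S) S.charpoly) := by
    rw [← spectrum.zero_notMem_iff ℂ]
    intro h0
    rcases isEmpty_or_nonempty (Fin n) with he | he
    · rw [spectrum.of_subsingleton] at h0
      exact h0
    · have hdeg : 0 < S.charpoly.degree := by
        rw [charpoly_degree_eq_dim]
        exact_mod_cast Fintype.card_pos
      rw [spectrum.map_polynomial_aeval_of_degree_pos _ _ hdeg] at h0
      obtain ⟨z, hz, hz0⟩ := h0
      have hz1 := hS z (mem_spectrum_iff_isRoot_charpoly.2 hz0)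
      rw [← spectrum.neg_eq, Set.mem_neg] at hz
      have hz2 := hS _ hz
      simp at hz2
      linarith
  obtain ⟨V, hV⟩ := h3.exists_right_inv
  calc K = K * (aeval (-S) S.charpoly * V) := by rw [hV, Matrix.mul_one]
    _ = 0 := by rw [← Matrix.mul_assoc, ← h2, Matrix.zero_mul]

lemma IsPrincipalSqrt.isUnit {n : ℕ} {S X : Matrix (Fin n) (Fin n) ℂ} (h : IsPrincipalSqrt S X) :
    IsUnit S := by
  rw [← spectrum.zero_notMem_iff ℂ]
  intro h0
  simpa using h.2 0 h0

/-- Since A commutes with S², the commutator AS - SA anticommutes with S and so vanishes. -/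
lemma IsPrincipalSqrt.commute {n : ℕ} {S X A : Matrix (Fin n) (Fin n) ℂ}
    (h : IsPrincipalSqrt S X) (hA : A * X = X * A) : A * S = S * A := by
  rw [← sub_eq_zero]
  apply aeval_eq_zero_of_mul_eq_neg_mul h.2
  have h1 := h.1
  rw [Matrix.mul_sub, Matrix.sub_mul, Matrix.mul_assoc A S S, ← Matrix.mul_assoc S S A, h1, hA,
    Matrix.mul_assoc]
  abel

lemma isPrincipalSqrt_principalSqrt {n : ℕ} {X : Matrix (Fin n) (Fin n) ℂ}
    (h : HasPrincipalSqrt X) : IsPrincipalSqrt (principalSqrt X) X := by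
  rw [principalSqrt, dif_pos h]
  exact h.choose_spec

lemma dvd_pow_of_forall_isRoot {f q : ℂ[X]} (hf : f.Monic) (h : ∀ z, f.IsRoot z → q.IsRoot z) :
    ∃ k : ℕ, f ∣ q ^ k := by
  refine ⟨f.roots.card, ?_⟩
  have h1 := (IsAlgClosed.splits f).eq_prod_roots_of_monic hf
  have h2 : (f.roots.map fun _ => q).prod = q ^ f.roots.card := by
    rw [Multiset.map_const', Multiset.prod_replicate]
  rw [← h2]
  nth_rewrite 1 [h1]
  refine Multiset.prod_dvd_prod_of_dvd _ _ fun z hz => ?_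
  exact dvd_iff_isRoot.2 (h z (isRoot_of_mem_roots hz))

/-- A polynomial in `A` with no eigenvalues on the closed negative real axis has a principal
square root. -/
lemma exists_sqrt_aeval {n : ℕ} (A : Matrix (Fin n) (Fin n) ℂ) (g : ℂ[X])
    (hg : ∀ z ∈ spectrum ℂ A, g.eval z ∈ Complex.slitPlane) :
    HasPrincipalSqrt (aeval A g) := by
  set s : Finset ℂ := (Matrix.finite_spectrum A).toFinset with hs
  have hmem : ∀ z, z ∈ s ↔ A.charpoly.IsRoot z := fun z => by
    rw [hs, Set.Finite.mem_toFinset, mem_spectrum_iff_isRoot_charpoly]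
  set w : ℂ → ℂ := fun z => Complex.exp (Complex.log (g.eval z) / 2) with hw
  -- Interpolation ignores multiplicities, so q² - g vanishes at the eigenvalues only. It is
  -- therefore nilpotent, not zero, modulo the characteristic polynomial f.
  set q : ℂ[X] := Lagrange.interpolate s id w with hq
  have hqe : ∀ z ∈ s, q.eval z = w z := fun z hz =>
    Lagrange.eval_interpolate_at_node w (Function.injective_id.injOn) hz
  have hw2 : ∀ z ∈ s, w z * w z = g.eval z := by
    intro z hz
    have hz' := hg z ((Matrix.finite_spectrum A).mem_toFinset.1 hz)
    rw [hw, ← Complex.exp_add, add_halves, Complex.exp_log (Complex.slitPlane_ne_zero hz')]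
  have hwre : ∀ z ∈ s, 0 < (w z).re := by
    intro z hz
    have hz' := hg z ((Matrix.finite_spectrum A).mem_toFinset.1 hz)
    rw [hw, Complex.exp_re]
    refine mul_pos (Real.exp_pos _) (Real.cos_pos_of_mem_Ioo ?_)
    have h1 : (Complex.log (g.eval z) / 2).im = Complex.arg (g.eval z) / 2 := by
      rw [Complex.div_ofNat_im, Complex.log_im]
    have h2 := Complex.neg_pi_lt_arg (g.eval z)
    have h3 := (Complex.arg_le_pi (g.eval z)).lt_of_ne (Complex.mem_slitPlane_iff_arg.1 hz').1
    rw [h1]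
    constructor <;> linarith
  set f := A.charpoly with hf
  -- Newton lifting is done in this commutative quotient, which maps to matrices by Cayley–Hamilton.
  -- The derivative 2q is a unit there because q has no zero on the spectrum.
  let R := ℂ[X] ⧸ Ideal.span {f}
  let mk : ℂ[X] →ₐ[ℂ] R := Ideal.Quotient.mkₐ ℂ (Ideal.span {f})
  let φ : R →ₐ[ℂ] Matrix (Fin n) (Fin n) ℂ := Ideal.Quotient.liftₐ (Ideal.span {f}) (aeval A) (by
    intro a ha
    obtain ⟨c, rfl⟩ := Ideal.mem_span_singleton'.1 ha
    rw [map_mul, hf, aeval_self_charpoly, mul_zero])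
  have hφ : ∀ a, φ (mk a) = aeval A a := fun a => Ideal.Quotient.lift_mk _ _ _
  have hmk0 : ∀ a, f ∣ a → mk a = 0 := fun a ha =>
    Ideal.Quotient.eq_zero_iff_mem.2 (Ideal.mem_span_singleton.2 ha)
  let P : R[X] := X * X + C (-mk g)
  have hP : IsNilpotent (aeval (mk q) P) := by
    obtain ⟨k, hk⟩ := dvd_pow_of_forall_isRoot (f := f) (q := q * q - g) A.charpoly_monic (by
      intro z hz
      rw [IsRoot, eval_sub, eval_mul, hqe z ((hmem z).2 hz), hw2 z ((hmem z).2 hz), sub_self])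
    refine ⟨k, ?_⟩
    have : aeval (mk q) P = mk (q * q - g) := by
      simp [P, sub_eq_add_neg]
    rw [this, ← map_pow, hmk0 _ hk]
  have hP' : IsUnit (aeval (mk q) (derivative P)) := by
    have hcop : IsCoprime q f := by
      refine isCoprime_of_irreducible_dvd (fun h => A.charpoly_monic.ne_zero h.2) ?_
      intro p hp hpq hpf
      obtain ⟨z, hz⟩ := IsAlgClosed.exists_root p hp.degree_pos.ne'
      have hzs : z ∈ s := (hmem z).2 (hz.dvd hpf)
      have h0 := hwre z hzs
      rw [← hqe z hzs, (hz.dvd hpq).eq_zero] at h0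
      exact lt_irrefl _ h0
    obtain ⟨a, b, hab⟩ := hcop
    have h1 : mk q * mk a = 1 := by
      rw [← map_mul, ← map_one mk, ← hab, map_add, hmk0 (b * f) (dvd_mul_left _ _), add_zero,
        mul_comm]
    have h2 : aeval (mk q) (derivative P) = algebraMap ℂ R 2 * mk q := by
      simp only [P, derivative_mul, derivative_X, derivative_C, one_mul, mul_one,
        add_zero, map_add, aeval_X, map_ofNat, two_mul]
    rw [h2]
    exact ((isUnit_iff_ne_zero.2 two_ne_zero).map (algebraMap ℂ R)).mul (IsUnit.of_mul_eq_one _ h1)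
  obtain ⟨x, ⟨hx1, hx2⟩, -⟩ := existsUnique_nilpotent_sub_and_aeval_eq_zero hP hP'
  have hx3 : x * x = mk g := by
    have : x * x + -mk g = 0 := by simpa [P] using hx2
    rw [← sub_eq_zero, sub_eq_add_neg, this]
  refine ⟨φ x, ?_, ?_⟩
  · rw [← map_mul, hx3, hφ]
  -- The lifted root differs from q(A) by a commuting nilpotent, so its eigenvalues are eigenvalues
  -- of q(A), that is, values of w.
  · intro z hz
    have hz' : z ∈ spectrum ℂ (aeval A q) := by
      by_contra hne
      rw [spectrum.notMem_iff] at hne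
      apply hz
      have h1 : IsNilpotent (φ (mk q - x)) := hx1.map φ
      have h2 : algebraMap ℂ _ z - φ x = φ (mk q - x) + (algebraMap ℂ _ z - aeval A q) := by
        rw [map_sub, hφ]
        abel
      have h3 : Commute (φ (mk q - x)) (algebraMap ℂ _ z - aeval A q) := by
        rw [← hφ, ← AlgHom.commutes φ z, ← map_sub]
        exact (Commute.all _ _).map φ
      rw [spectrum.mem_resolventSet_iff, h2]
      exact h1.isUnit_add_right_of_commute hne h3
    rcases isEmpty_or_nonempty (Fin n) with he | he
    · rw [spectrum.of_subsingleton] at hz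
      exact hz.elim
    · rw [spectrum.map_polynomial_aeval_of_nonempty _ _
        (spectrum.nonempty_of_isAlgClosed_of_finiteDimensional ℂ A)] at hz'
      obtain ⟨l, hl, rfl⟩ := hz'
      have hl' : l ∈ s := (Matrix.finite_spectrum A).mem_toFinset.2 hl
      show 0 < (q.eval l).re
      rw [hqe l hl']
      exact hwre l hl'

end PrincipalSqrt

/-! ### The band and centre matrices -/

section Band

variable {n : ℕ} {w₁ w₂ : ℝ} {A : Matrix (Fin n) (Fin n) ℂ}

/-- With E the pencil at the centre and d the half-width, the factors are E - jd and E + jd. -/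
lemma pencil_mul_pencil (w₁ w₂ : ℝ) (A : Matrix (Fin n) (Fin n) ℂ) :
    pencil w₁ A * pencil w₂ A = pencil ((w₂ + w₁) / 2) A * pencil ((w₂ + w₁) / 2) A
      + ((((w₂ - w₁) / 2) ^ 2 : ℝ) : ℂ) • 1 := by
  have h : Complex.I * Complex.I = -1 := Complex.I_mul_I
  simp only [pencil, Matrix.sub_mul, Matrix.mul_sub, Matrix.smul_mul, Matrix.mul_smul,
    Matrix.one_mul, Matrix.mul_one, smul_sub, smul_smul]
  have e : (Complex.I * w₂ * (Complex.I * w₁) : ℂ) = Complex.I * ((w₂ + w₁) / 2 : ℝ)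
      * (Complex.I * ((w₂ + w₁) / 2 : ℝ)) + ((((w₂ - w₁) / 2) ^ 2 : ℝ) : ℂ) := by
    push_cast
    linear_combination ((w₁ : ℂ) * w₂ - (w₂ + w₁) ^ 2 / 4) * h
  rw [e]
  push_cast
  module

lemma pencil_mul_comm (w₁ w₂ : ℝ) (A : Matrix (Fin n) (Fin n) ℂ) :
    pencil w₁ A * pencil w₂ A = pencil w₂ A * pencil w₁ A := by
  rw [pencil_mul_pencil, pencil_mul_pencil w₂ w₁, add_comm w₁ w₂]
  congr 3
  ring

/-- A singular pencil has `⁻¹` equal to a noninvertible matrix, so invertibility of the product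
forces both pencils to be regular. -/
lemma isUnit_pencil_of_isUnit_bandMatrix (h : IsUnit (bandMatrix w₁ w₂ A)) :
    IsUnit (pencil w₁ A) ∧ IsUnit (pencil w₂ A) := by
  rw [isUnit_iff_isUnit_det, bandMatrix, det_smul, det_mul] at h
  have h1 := isUnit_of_mul_isUnit_right h
  refine ⟨?_, ?_⟩
  · rw [← isUnit_nonsing_inv_iff, isUnit_iff_isUnit_det]
    exact isUnit_of_mul_isUnit_left h1
  · rw [← isUnit_nonsing_inv_iff, isUnit_iff_isUnit_det]
    exact isUnit_of_mul_isUnit_right h1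

lemma bandMatrix_mul_shift (h : IsUnit (bandMatrix w₁ w₂ A)) :
    bandMatrix w₁ w₂ A * (pencil ((w₂ + w₁) / 2) A * pencil ((w₂ + w₁) / 2) A
      + ((((w₂ - w₁) / 2) ^ 2 : ℝ) : ℂ) • 1) = ((((w₂ - w₁) / 2) ^ 2 : ℝ) : ℂ) • 1 := by
  obtain ⟨h1, h2⟩ := isUnit_pencil_of_isUnit_bandMatrix h
  rw [← pencil_mul_pencil, pencil_mul_comm, bandMatrix, Matrix.smul_mul, Matrix.mul_assoc,
    ← Matrix.mul_assoc (pencil w₂ A)⁻¹, nonsing_inv_mul _ ((isUnit_iff_isUnit_det _).1 h2),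
    Matrix.one_mul, nonsing_inv_mul _ ((isUnit_iff_isUnit_det _).1 h1)]

lemma centerMatrix_eq (hw : w₁ < w₂) : centerMatrix w₁ w₂ A =
    ((((w₂ - w₁) / 2) ^ 2 : ℝ) : ℂ)⁻¹ • (pencil ((w₂ + w₁) / 2) A * bandMatrix w₁ w₂ A) := by
  have : ((((w₂ - w₁) / 2) ^ 2 : ℝ) : ℂ) ≠ 0 := by
    have : 0 < ((w₂ - w₁) / 2) ^ 2 := by
      have : 0 < (w₂ - w₁) / 2 := by linarith
      positivity
    exact_mod_cast this.ne'
  rw [bandMatrix, Matrix.mul_smul, smul_smul, inv_mul_cancel₀ this, one_smul, centerMatrix,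
    Matrix.mul_assoc]

lemma commute_bandMatrix (h : IsUnit (bandMatrix w₁ w₂ A)) :
    A * bandMatrix w₁ w₂ A = bandMatrix w₁ w₂ A * A := by
  obtain ⟨h1, h2⟩ := isUnit_pencil_of_isUnit_bandMatrix h
  have hc : ∀ w, IsUnit (pencil w A) → A * (pencil w A)⁻¹ = (pencil w A)⁻¹ * A := by
    intro w hu
    have hd := (isUnit_iff_isUnit_det _).1 hu
    have e : A * pencil w A = pencil w A * A := by
      simp [pencil, Matrix.mul_sub, Matrix.sub_mul]
    calc A * (pencil w A)⁻¹ = (pencil w A)⁻¹ * (pencil w A * A) * (pencil w A)⁻¹ := by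
          rw [nonsing_inv_mul_cancel_left _ _ hd]
      _ = _ := by
          rw [← e, ← Matrix.mul_assoc, mul_nonsing_inv_cancel_right _ _ hd]
  rw [bandMatrix, Matrix.mul_smul, Matrix.smul_mul, ← Matrix.mul_assoc, hc w₁ h1,
    Matrix.mul_assoc, hc w₂ h2, Matrix.mul_assoc]

/-- The shaping by a commuting square root of the band matrix, at a regular frequency. -/
lemma inv_sqrt_mul_resolvent (hw : w₁ < w₂) {S : Matrix (Fin n) (Fin n) ℂ} (hS : IsUnit S)
    (hSS : S * S = bandMatrix w₁ w₂ A) (hAS : A * S = S * A) {ω : ℝ} (hω : IsUnit (pencil ω A)) :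
    S⁻¹ * (pencil ω A)⁻¹ * S⁻¹ - S⁻¹ * centerMatrix w₁ w₂ A * S⁻¹ =
      (((1 - ((ω - (w₂ + w₁) / 2) / ((w₂ - w₁) / 2)) ^ 2 : ℝ) : ℂ)) • (pencil ω A)⁻¹
      - (Complex.I * (((ω - (w₂ + w₁) / 2) / ((w₂ - w₁) / 2) ^ 2 : ℝ) : ℂ)) • 1 := by
  have hSd := (isUnit_iff_isUnit_det _).1 hS
  have hd := (isUnit_iff_isUnit_det _).1 hω
  have hF : IsUnit (bandMatrix w₁ w₂ A) := hSS ▸ hS.mul hS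
  set d := (w₂ - w₁) / 2 with hdd
  have hd0 : 0 < d := by rw [hdd]; linarith
  set c := (w₂ + w₁) / 2 with hc
  set E := pencil c A with hE
  set X := (pencil ω A)⁻¹ with hX
  have hdc : (((d ^ 2 : ℝ)) : ℂ) ≠ 0 := by exact_mod_cast (pow_pos hd0 2).ne'
  have hES : E * S = S * E := by
    simp [hE, pencil, Matrix.mul_sub, Matrix.sub_mul, hAS]
  have hPS : pencil ω A * S = S * pencil ω A := by
    simp [pencil, Matrix.mul_sub, Matrix.sub_mul, hAS]
  have hXS : X * S⁻¹ = S⁻¹ * X := by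
    rw [hX, ← Matrix.mul_inv_rev, ← Matrix.mul_inv_rev, hPS]
  have hband := bandMatrix_mul_shift hF
  rw [← hSS] at hband
  have hSi : S⁻¹ * S⁻¹ = (((d ^ 2 : ℝ)) : ℂ)⁻¹ • (E * E + ((d ^ 2 : ℝ) : ℂ) • 1) := by
    calc S⁻¹ * S⁻¹ = (((d ^ 2 : ℝ)) : ℂ)⁻¹ • (S⁻¹ * (S⁻¹ * (((d ^ 2 : ℝ) : ℂ) • 1))) := by
          rw [Matrix.mul_smul, Matrix.mul_smul, smul_smul, inv_mul_cancel₀ hdc, one_smul,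
            Matrix.mul_one]
      _ = _ := by
          nth_rewrite 1 [← hband]
          rw [Matrix.mul_assoc S S, nonsing_inv_mul_cancel_left _ _ hSd,
            nonsing_inv_mul_cancel_left _ _ hSd]
  have h1 : S⁻¹ * centerMatrix w₁ w₂ A * S⁻¹ = (((d ^ 2 : ℝ)) : ℂ)⁻¹ • E := by
    rw [centerMatrix_eq hw, ← hSS, Matrix.mul_smul, Matrix.smul_mul,
      ← Matrix.mul_assoc (pencil _ _),
      hES, Matrix.mul_assoc S, hES, nonsing_inv_mul_cancel_left _ _ hSd]
    rw [← hES, mul_nonsing_inv_cancel_right _ _ hSd]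
  have hPE : pencil ω A = (Complex.I * ((ω - c : ℝ) : ℂ)) • 1 + E := by
    rw [hE, pencil, pencil]
    push_cast
    module
  -- Division with remainder by jωI - A = E + j(ω - c). The scalar remainder becomes the factor 1 -
  -- t².
  have hE2 : E * E + ((d ^ 2 : ℝ) : ℂ) • 1 = ((d ^ 2 - (ω - c) ^ 2 : ℝ) : ℂ) • 1
      + pencil ω A * (E - (Complex.I * ((ω - c : ℝ) : ℂ)) • 1) := by
    rw [hPE]
    simp only [Matrix.add_mul, Matrix.mul_sub, Matrix.smul_mul, Matrix.mul_smul, Matrix.one_mul,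
      Matrix.mul_one, smul_add, smul_smul]
    have e : Complex.I * ((ω - c : ℝ) : ℂ) * (Complex.I * ((ω - c : ℝ) : ℂ))
        = -(((ω - c) ^ 2 : ℝ) : ℂ) := by
      push_cast
      linear_combination ((ω : ℂ) - c) ^ 2 * Complex.I_mul_I
    rw [e]
    push_cast
    module
  have h2 : S⁻¹ * X * S⁻¹ = (((d ^ 2 : ℝ)) : ℂ)⁻¹ • (((d ^ 2 - (ω - c) ^ 2 : ℝ) : ℂ) • X
      + (E - (Complex.I * ((ω - c : ℝ) : ℂ)) • 1)) := by
    rw [← hXS, Matrix.mul_assoc, hSi, hE2, Matrix.mul_smul, Matrix.mul_add, Matrix.mul_smul,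
      Matrix.mul_one, hX, nonsing_inv_mul_cancel_left _ _ hd]
  have e1 : ((1 - ((ω - c) / d) ^ 2 : ℝ) : ℂ)
      = ((d ^ 2 : ℝ) : ℂ)⁻¹ * ((d ^ 2 - (ω - c) ^ 2 : ℝ) : ℂ) := by
    rw [← Complex.ofReal_inv, ← Complex.ofReal_mul]
    congr 1
    field_simp
  have e2 : (((ω - c) / d ^ 2 : ℝ) : ℂ) = ((d ^ 2 : ℝ) : ℂ)⁻¹ * ((ω - c : ℝ) : ℂ) := by
    rw [← Complex.ofReal_inv, ← Complex.ofReal_mul]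
    congr 1
    field_simp
  rw [h2, h1, e1, e2]
  module

/-- The inverse of the band matrix is a polynomial in A, so its root is taken and inverted. For Re z
< 0, (jϖ₂ - z)(jϖ₁ - z) is real only if Im z is the band centre, where it equals (Re z)² + d² > 0.
-/
lemma hasPrincipalSqrt_bandMatrix (hw : w₁ < w₂) (hA : ∀ z ∈ spectrum ℂ A, z.re < 0) :
    HasPrincipalSqrt (bandMatrix w₁ w₂ A) := by
  set d := (w₂ - w₁) / 2 with hdd
  have hd0 : 0 < d := by rw [hdd]; linarith
  have hu : ∀ w : ℝ, IsUnit (pencil w A) := by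
    intro w
    rw [isUnit_pencil_iff]
    intro h
    have := hA _ h
    simp at this
  have hdc : (((d ^ 2 : ℝ)) : ℂ) ≠ 0 := by exact_mod_cast (pow_pos hd0 2).ne'
  obtain ⟨R, hR⟩ := exists_sqrt_aeval A (Polynomial.C ((((d ^ 2 : ℝ)) : ℂ)⁻¹) *
    ((Polynomial.C (Complex.I * w₂) - Polynomial.X) *
      (Polynomial.C (Complex.I * w₁) - Polynomial.X))) (by
    intro z hz
    have hz0 := hA z hz
    rw [← Complex.ofReal_inv, Polynomial.eval_mul, Polynomial.eval_C, Polynomial.eval_mul,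
      Polynomial.eval_sub, Polynomial.eval_sub, Polynomial.eval_C, Polynomial.eval_C,
      Polynomial.eval_X, Complex.mem_slitPlane_iff, Complex.re_ofReal_mul, Complex.im_ofReal_mul]
    have hdi : 0 < (d ^ 2)⁻¹ := by positivity
    by_cases him : w₁ + w₂ - 2 * z.im = 0
    · left
      refine mul_pos hdi ?_
      have e : ((Complex.I * w₂ - z) * (Complex.I * w₁ - z)).re = z.re ^ 2 + d ^ 2 := by
        have : z.im = (w₁ + w₂) / 2 := by linarith
        simp [this, hdd]
        ring
      rw [e]
      positivity
    · right
      refine mul_ne_zero hdi.ne' ?_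
      have e : ((Complex.I * w₂ - z) * (Complex.I * w₁ - z)).im
          = -z.re * (w₁ + w₂ - 2 * z.im) := by
        simp
        ring
      rw [e]
      exact mul_ne_zero (by linarith) him)
  have hRu := hR.isUnit
  have hRd := (isUnit_iff_isUnit_det _).1 hRu
  refine ⟨R⁻¹, ?_, ?_⟩
  · rw [← Matrix.mul_inv_rev, hR.1]
    have e : Polynomial.aeval A (Polynomial.C ((((d ^ 2 : ℝ)) : ℂ)⁻¹) *
        ((Polynomial.C (Complex.I * w₂) - Polynomial.X) *
          (Polynomial.C (Complex.I * w₁) - Polynomial.X)))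
        = (((d ^ 2 : ℝ)) : ℂ)⁻¹ • (pencil w₂ A * pencil w₁ A) := by
      simp only [map_mul (Polynomial.aeval A), map_sub, Polynomial.aeval_C, Polynomial.aeval_X,
        ← Algebra.smul_def]
      rw [pencil_eq, pencil_eq]
    rw [e, bandMatrix, ← Matrix.mul_inv_rev]
    apply inv_eq_left_inv
    rw [Matrix.smul_mul, Matrix.mul_smul, smul_smul, ← hdd, mul_inv_cancel₀ hdc, one_smul,
      nonsing_inv_mul]
    rw [← isUnit_iff_isUnit_det]
    exact (hu w₂).mul (hu w₁)
  -- Inversion preserves the sign of the real part.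
  · intro z hz
    have h0 : z ≠ 0 := by
      rintro rfl
      rw [spectrum.zero_mem_iff] at hz
      exact hz ((isUnit_nonsing_inv_iff).2 hRu)
    have h1 : z⁻¹ ∈ spectrum ℂ R := by
      apply (spectrum.inv₀_mem_iff (r := z) (a := hRu.unit)).2
      rwa [coe_units_inv, IsUnit.unit_spec]
    have h3 := hR.2 _ h1
    rw [Complex.inv_re] at h3
    have h4 : 0 < Complex.normSq z := Complex.normSq_pos.2 h0
    have := mul_pos h3 h4
    rwa [div_mul_cancel₀ _ h4.ne'] at this

end Band

/-! ### Truncation matrices -/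

section Truncation

lemma Z_conjTranspose (k n : ℕ) : (Z k n)ᴴ = (Z k n)ᵀ := by
  ext i j
  simp only [conjTranspose_apply, transpose_apply, Z, of_apply]
  split_ifs <;> simp

lemma Z_mulVec {k n : ℕ} (h : k ≤ n) (x : Fin n → ℂ) (i : Fin k) :
    (Z k n *ᵥ x) i = x (Fin.castLE h i) := by
  rw [mulVec, dotProduct, Finset.sum_eq_single (Fin.castLE h i)]
  · simp [Z]
  · intro j _ hj
    have : (i : ℕ) ≠ j := fun e => hj (Fin.ext (by simp [e]))
    simp [Z, this]
  · simp

lemma Z_mul_apply {k n : ℕ} {a : Type*} (h : k ≤ n) (M : Matrix (Fin n) a ℂ) (i : Fin k) (j : a) :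
    (Z k n * M) i j = M (Fin.castLE h i) j :=
  Z_mulVec h (fun l => M l j) i

lemma mul_Z_transpose_apply {k n : ℕ} {a : Type*} (h : k ≤ n) (M : Matrix a (Fin n) ℂ) (i : a)
    (j : Fin k) : (M * (Z k n)ᵀ) i j = M i (Fin.castLE h j) := by
  rw [← transpose_apply (M * _), transpose_mul, transpose_transpose, Z_mul_apply h, transpose_apply]

lemma trunc_apply {k n : ℕ} (h : k ≤ n) (A : Matrix (Fin n) (Fin n) ℂ) (i j : Fin k) :
    trunc k A i j = A (Fin.castLE h i) (Fin.castLE h j) := by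
  rw [trunc, mul_Z_transpose_apply h, Z_mul_apply h]

lemma Z_mul_transpose {k n : ℕ} (h : k ≤ n) : Z k n * (Z k n)ᵀ = 1 := by
  ext i j
  rw [Z_mul_apply h, transpose_apply, one_apply]
  simp [Z, Fin.ext_iff, eq_comm]

lemma Z_mul_Z {k l n : ℕ} (h : k ≤ l) : Z k l * Z l n = Z k n := by
  ext i j
  rw [Z_mul_apply h]
  simp [Z]

lemma Z_self (n : ℕ) : Z n n = 1 := by
  ext i j
  simp [Z, one_apply, Fin.ext_iff]

lemma trunc_self {n : ℕ} (A : Matrix (Fin n) (Fin n) ℂ) : trunc n A = A := by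
  rw [trunc, Z_self, transpose_one, Matrix.mul_one, Matrix.one_mul]

lemma trunc_trunc {k l n : ℕ} (h : k ≤ l) (A : Matrix (Fin n) (Fin n) ℂ) :
    trunc k (trunc l A) = trunc k A := by
  simp only [trunc]
  rw [← Z_mul_Z (n := n) h, transpose_mul]
  simp only [Matrix.mul_assoc]

lemma trunc_diagonal {k n : ℕ} (h : k ≤ n) (v : Fin n → ℂ) :
    trunc k (diagonal v) = diagonal fun i => v (Fin.castLE h i) := by
  ext i j
  rw [trunc_apply h, diagonal_apply, diagonal_apply]
  simp [Fin.ext_iff]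

lemma star_dotProduct_gram_mulVec {l a : Type*} [Fintype l] [Fintype a] (M : Matrix l a ℂ)
    (x : a → ℂ) :
    star x ⬝ᵥ ((Mᴴ * M) *ᵥ x) = ((∑ i, Complex.normSq ((M *ᵥ x) i) : ℝ) : ℂ) := by
  rw [← star_mulVec_dotProduct_mulVec, dotProduct, Complex.ofReal_sum]
  refine Finset.sum_congr rfl fun i _ => ?_
  rw [Complex.normSq_eq_conj_mul_self]
  rfl

lemma eq_zero_of_sum_normSq_nonpos {l : Type*} [Fintype l] {x : l → ℂ}
    (hx : ∑ i, Complex.normSq (x i) ≤ 0) : x = 0 := by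
  have h0 := le_antisymm hx (Finset.sum_nonneg fun i _ => Complex.normSq_nonneg _)
  rw [Finset.sum_eq_zero_iff_of_nonneg fun i _ => Complex.normSq_nonneg _] at h0
  funext i
  exact Complex.normSq_eq_zero.1 (h0 i (Finset.mem_univ _))

lemma mem_spectrum_iff_exists_mulVec {n : ℕ} {A : Matrix (Fin n) (Fin n) ℂ} {z : ℂ} :
    z ∈ spectrum ℂ A ↔ ∃ v, v ≠ 0 ∧ A *ᵥ v = z • v := by
  rw [← spectrum_toLin', ← Module.End.hasEigenvalue_iff_mem_spectrum]
  constructor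
  · intro h
    obtain ⟨v, hv⟩ := h.exists_hasEigenvector
    exact ⟨v, hv.2, hv.apply_eq_smul⟩
  · rintro ⟨v, hv, hAv⟩
    exact Module.End.hasEigenvalue_of_hasEigenvector
      (Module.End.hasEigenvector_iff.2 ⟨Module.End.mem_eigenspace_iff.2 hAv, hv⟩)

/-- Balanced truncation preserves stability if there is a gap between the kept and the discarded
singular values. -/
lemma re_neg_of_mem_spectrum_trunc {n r : ℕ} {b c : Type*} [Fintype b] [Fintype c]
    {A : Matrix (Fin n) (Fin n) ℂ} {B : Matrix (Fin n) b ℂ} {C : Matrix c (Fin n) ℂ}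
    {σ : Fin n → ℝ} (hr : r < n) (hσ : ∀ i, 0 ≤ σ i)
    (hc : A * diagonal (fun i => (σ i : ℂ)) + diagonal (fun i => (σ i : ℂ)) * Aᴴ + B * Bᴴ = 0)
    (ho : Aᴴ * diagonal (fun i => (σ i : ℂ)) + diagonal (fun i => (σ i : ℂ)) * A + Cᴴ * C = 0)
    (hgap : ∀ i j : Fin n, (i : ℕ) < r → r ≤ (j : ℕ) → σ j < σ i)
    (hA : ∀ z ∈ spectrum ℂ A, z.re < 0) : ∀ z ∈ spectrum ℂ (trunc r A), z.re < 0 := by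
  intro μ hμ
  by_contra hre
  rw [not_lt] at hre
  have hpos : ∀ i : Fin n, (i : ℕ) < r → 0 < σ i := fun i hi =>
    (hσ ⟨r, hr⟩).trans_lt (hgap i ⟨r, hr⟩ hi le_rfl)
  set S : Matrix (Fin n) (Fin n) ℂ := diagonal fun i => (σ i : ℂ) with hS
  have hSv : ∀ (x : Fin n → ℂ) i, (S *ᵥ x) i = σ i * x i := fun x i => mulVec_diagonal _ _ _
  have hSh : Sᴴ = S := by
    rw [hS, diagonal_conjTranspose]
    congr 1
    funext i
    simp
  -- The eigenspace of the truncated matrix for μ, padded by zeros to the full state space.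
  let V : Submodule ℂ (Fin n → ℂ) :=
    { carrier := {w | (∀ i : Fin n, r ≤ (i : ℕ) → w i = 0) ∧
        ∀ i : Fin n, (i : ℕ) < r → (A *ᵥ w) i = μ * w i}
      add_mem' := by
        rintro x y ⟨hx1, hx2⟩ ⟨hy1, hy2⟩
        refine ⟨fun i hi => ?_, fun i hi => ?_⟩
        · simp [hx1 i hi, hy1 i hi]
        · rw [mulVec_add, Pi.add_apply, Pi.add_apply, hx2 i hi, hy2 i hi, mul_add]
      zero_mem' := by simp
      smul_mem' := by
        rintro a x ⟨hx1, hx2⟩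
        refine ⟨fun i hi => ?_, fun i hi => ?_⟩
        · simp [hx1 i hi]
        · rw [mulVec_smul, Pi.smul_apply, Pi.smul_apply, hx2 i hi, smul_eq_mul, smul_eq_mul]
          ring }
  have hsum : ∀ (x u : Fin n → ℂ) (a : ℂ), (∀ i : Fin n, r ≤ (i : ℕ) → x i = 0) →
      (∀ i : Fin n, (i : ℕ) < r → u i = a * x i) →
      star x ⬝ᵥ (S *ᵥ u) = a * ((∑ i, σ i * Complex.normSq (x i) : ℝ) : ℂ) := by
    intro x u a hx hu
    rw [dotProduct, Complex.ofReal_sum, Finset.mul_sum]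
    refine Finset.sum_congr rfl fun i _ => ?_
    rw [hSv, Pi.star_apply]
    rcases lt_or_ge (i : ℕ) r with hi | hi
    · rw [hu i hi, Complex.ofReal_mul, Complex.normSq_eq_conj_mul_self, Complex.star_def]
      ring
    · simp [hx i hi]
  have hqpos : ∀ x : Fin n → ℂ, (∀ i : Fin n, r ≤ (i : ℕ) → x i = 0) → x ≠ 0 →
      0 < ∑ i, σ i * Complex.normSq (x i) := by
    intro x hx hx0
    obtain ⟨i, hi⟩ := Function.ne_iff.1 hx0
    have hir : (i : ℕ) < r := by
      by_contra h
      exact hi (hx i (not_lt.1 h))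
    exact Finset.sum_pos' (fun j _ => mul_nonneg (hσ j) (Complex.normSq_nonneg _))
      ⟨i, Finset.mem_univ _, mul_pos (hpos i hir) (Complex.normSq_pos.2 hi)⟩
  have hconj : ∀ (M : Matrix (Fin n) (Fin n) ℂ) (x : Fin n → ℂ),
      star x ⬝ᵥ (Mᴴ *ᵥ (S *ᵥ x)) = star (star x ⬝ᵥ (S *ᵥ (M *ᵥ x))) := by
    intro M x
    have h1 := star_mulVec_dotProduct_mulVec M S x x
    have h2 := star_mulVec_dotProduct_mulVec S M x x
    rw [mulVec_mulVec, ← h1, star_dotProduct, mulVec_mulVec, ← hSh, ← h2, hSh]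
  -- Imaginary eigenvectors of the truncated matrix are unobservable and uncontrollable.
  have key1 : ∀ w ∈ V, w ≠ 0 → μ.re = 0 ∧ C *ᵥ w = 0 := by
    rintro w ⟨hw1, hw2⟩ hw0
    have h1 := congrArg (fun W => (star w ⬝ᵥ (W *ᵥ w)).re) ho
    simp only [add_mulVec, dotProduct_add, star_dotProduct_gram_mulVec, zero_mulVec,
      dotProduct_zero,
      ← mulVec_mulVec _ Aᴴ, ← mulVec_mulVec _ S, hconj, Complex.add_re,
      hsum w (A *ᵥ w) μ hw1 hw2, Complex.star_def, Complex.conj_re, Complex.re_mul_ofReal,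
      Complex.ofReal_re, Complex.zero_re] at h1
    have h2 := hqpos w hw1 hw0
    have h3 : 0 ≤ ∑ i, Complex.normSq ((C *ᵥ w) i) :=
      Finset.sum_nonneg fun i _ => Complex.normSq_nonneg _
    have h4 := mul_nonneg hre h2.le
    refine ⟨?_, eq_zero_of_sum_normSq_nonpos (by linarith)⟩
    have h5 : μ.re * ∑ i, σ i * Complex.normSq (w i) = 0 := by linarith
    exact (mul_eq_zero.1 h5).resolve_right h2.ne'
  -- Cw = 0 in the observability equation gives A*Sw = -SAw. Hence Sw is a truncated eigenvector of
  -- A* for -μ, so B*Sw = 0, and the controllability equation gives AS²w = S²Aw.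
  have key2 : ∀ w ∈ V, S *ᵥ (S *ᵥ w) ∈ V ∧
      ∀ j : Fin n, r ≤ (j : ℕ) → (A *ᵥ (S *ᵥ (S *ᵥ w))) j = σ j ^ 2 * (A *ᵥ w) j := by
    rintro w ⟨hw1, hw2⟩
    rcases eq_or_ne w 0 with rfl | hw0
    · simp [V.zero_mem]
    obtain ⟨hμ0, hCw⟩ := key1 w ⟨hw1, hw2⟩ hw0
    set y := S *ᵥ w with hy
    have hy1 : ∀ i : Fin n, r ≤ (i : ℕ) → y i = 0 := fun i hi => by rw [hy, hSv, hw1 i hi, mul_zero]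
    have h1 : Aᴴ *ᵥ y = -(S *ᵥ (A *ᵥ w)) := by
      have := congrArg (fun W => W *ᵥ w) ho
      simp only [add_mulVec, ← mulVec_mulVec, hCw, mulVec_zero, add_zero, zero_mulVec] at this
      exact eq_neg_of_add_eq_zero_left this
    have hy2 : ∀ i : Fin n, (i : ℕ) < r → (Aᴴ *ᵥ y) i = -μ * y i := by
      intro i hi
      rw [h1, Pi.neg_apply, hSv, hw2 i hi, hy, hSv]
      ring
    have hBy : Bᴴ *ᵥ y = 0 := by
      have h2 := congrArg (fun W => (star y ⬝ᵥ (W *ᵥ y)).re) hc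
      have h3 := star_dotProduct_gram_mulVec Bᴴ y
      have h4 := hconj Aᴴ y
      rw [conjTranspose_conjTranspose] at h3 h4
      simp only [add_mulVec, dotProduct_add, h3, zero_mulVec, dotProduct_zero,
        ← mulVec_mulVec _ A, ← mulVec_mulVec _ S, h4, Complex.add_re,
        hsum y (Aᴴ *ᵥ y) (-μ) hy1 hy2, Complex.star_def, Complex.conj_re, Complex.re_mul_ofReal,
        Complex.ofReal_re, Complex.zero_re, Complex.neg_re, hμ0] at h2
      exact eq_zero_of_sum_normSq_nonpos (by linarith)
    have h2 : A *ᵥ (S *ᵥ y) = -(S *ᵥ (Aᴴ *ᵥ y)) := by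
      have := congrArg (fun W => W *ᵥ y) hc
      simp only [add_mulVec, ← mulVec_mulVec, hBy, mulVec_zero, add_zero, zero_mulVec] at this
      exact eq_neg_of_add_eq_zero_left this
    refine ⟨⟨fun i hi => by rw [hSv, hy1 i hi, mul_zero], fun i hi => ?_⟩, fun j hj => ?_⟩
    · rw [h2, Pi.neg_apply, hSv, hy2 i hi, hSv]
      ring
    · rw [h2, Pi.neg_apply, hSv, h1, Pi.neg_apply, hSv]
      ring
  have hVne : Nontrivial V := by
    obtain ⟨v, hv, hAv⟩ := mem_spectrum_iff_exists_mulVec.1 hμ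
    have hZ : ∀ i : Fin r, ((Z r n)ᵀ *ᵥ v) (Fin.castLE hr.le i) = v i := fun i => by
      rw [← Z_mulVec hr.le ((Z r n)ᵀ *ᵥ v) i, mulVec_mulVec, Z_mul_transpose hr.le, one_mulVec]
    refine ⟨⟨⟨(Z r n)ᵀ *ᵥ v, ?_, ?_⟩, 0, ?_⟩⟩
    · intro i hi
      rw [mulVec, dotProduct]
      refine Finset.sum_eq_zero fun j _ => ?_
      have : (j : ℕ) ≠ i := fun e => absurd (e ▸ j.2) (not_lt.2 hi)
      simp [Z, this]
    · intro i hi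
      have h1 := congrFun hAv ⟨i, hi⟩
      rw [trunc, ← mulVec_mulVec, ← mulVec_mulVec, Z_mulVec hr.le] at h1
      have h2 := hZ ⟨i, hi⟩
      have h3 : Fin.castLE hr.le ⟨i, hi⟩ = i := rfl
      rw [h3] at h1 h2
      rw [h1, h2]
      rfl
    · intro h
      apply hv
      funext i
      rw [← hZ i]
      exact congrFun (congrArg Subtype.val h) _
  -- An eigenvector of S² inside V has eigenvalue σᵢ² for some kept i. Then (σᵢ² - σⱼ²)(Aw)ⱼ = 0 for
  -- discarded j, and the gap makes w an eigenvector of A itself, contradicting its stability.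
  obtain ⟨lam, hlam⟩ := Module.End.exists_eigenvalue
    ((Matrix.toLin' (S * S)).restrict (p := V) (q := V) fun w hw => by
      rw [toLin'_apply, ← mulVec_mulVec]
      exact (key2 w hw).1)
  obtain ⟨⟨w, hwV⟩, hw⟩ := hlam.exists_hasEigenvector
  have hw0 : w ≠ 0 := fun h => hw.2 (Subtype.ext h)
  have hwe : S *ᵥ (S *ᵥ w) = lam • w := by
    have := congrArg Subtype.val hw.apply_eq_smul
    rw [mulVec_mulVec]
    exact this
  obtain ⟨i, hi⟩ := Function.ne_iff.1 hw0
  have hir : (i : ℕ) < r := by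
    by_contra h
    exact hi (hwV.1 i (not_lt.1 h))
  have hlami : lam = σ i ^ 2 := by
    have h1 := congrFun hwe i
    rw [hSv, hSv, Pi.smul_apply, smul_eq_mul] at h1
    apply mul_right_cancel₀ hi
    rw [← h1]
    ring
  have hAw : A *ᵥ w = μ • w := by
    funext j
    rcases lt_or_ge (j : ℕ) r with hj | hj
    · exact hwV.2 j hj
    · rw [Pi.smul_apply, hwV.1 j hj, smul_zero]
      have h1 := (key2 w hwV).2 j hj
      rw [hwe, mulVec_smul, Pi.smul_apply, smul_eq_mul, hlami, ← sub_eq_zero, ← sub_mul] at h1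
      refine (mul_eq_zero.1 h1).resolve_left ?_
      have h2 : σ j ^ 2 < σ i ^ 2 := pow_lt_pow_left₀ (hgap i j hir hj) (hσ j) two_ne_zero
      exact_mod_cast (sub_pos.2 h2).ne'
  exact absurd (hA μ (mem_spectrum_iff_exists_mulVec.2 ⟨w, hw0, hAw⟩)) (not_lt.2 hre)

end Truncation

/-! ### Truncated systems -/

section TruncatedSystem

variable {n m p : ℕ}

/-- Direct truncation of a state-space model to its first `k` states. -/
def StateSpace.truncate (G : StateSpace n m p) (k : ℕ) : StateSpace k m p where
  A := trunc k G.A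
  B := Z k n * G.B
  C := G.C * (Z k n)ᵀ
  D := G.D

/-- `diag(σ)` solves both Lyapunov equations of `G`. -/
structure StateSpace.Balanced (G : StateSpace n m p) (σ : Fin n → ℝ) : Prop where
  controllability : G.A * diagonal (fun i => (σ i : ℂ))
    + diagonal (fun i => (σ i : ℂ)) * G.Aᴴ + G.B * G.Bᴴ = 0
  observability : G.Aᴴ * diagonal (fun i => (σ i : ℂ))
    + diagonal (fun i => (σ i : ℂ)) * G.A + G.Cᴴ * G.C = 0

lemma StateSpace.truncate_self (G : StateSpace n m p) : G.truncate n = G := by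
  simp [StateSpace.truncate, trunc_self, Z_self]

lemma StateSpace.balanced_iff {G : StateSpace n m p} {σ : Fin n → ℝ} : G.Balanced σ ↔
    (∀ i j, G.A i j * σ j + σ i * star (G.A j i) + ∑ l, G.B i l * star (G.B j l) = 0) ∧
    ∀ i j, star (G.A j i) * σ j + σ i * G.A i j + ∑ l, star (G.C l i) * G.C l j = 0 := by
  have hc : ∀ i j, (G.A * diagonal (fun i => (σ i : ℂ)) + diagonal (fun i => (σ i : ℂ)) * G.Aᴴ
      + G.B * G.Bᴴ) i j
      = G.A i j * σ j + σ i * star (G.A j i) + ∑ l, G.B i l * star (G.B j l) := by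
    intro i j
    rw [Matrix.add_apply, Matrix.add_apply, mul_diagonal, diagonal_mul, Matrix.mul_apply]
    rfl
  have ho : ∀ i j, (G.Aᴴ * diagonal (fun i => (σ i : ℂ)) + diagonal (fun i => (σ i : ℂ)) * G.A
      + G.Cᴴ * G.C) i j
      = star (G.A j i) * σ j + σ i * G.A i j + ∑ l, star (G.C l i) * G.C l j := by
    intro i j
    rw [Matrix.add_apply, Matrix.add_apply, mul_diagonal, diagonal_mul, Matrix.mul_apply]
    rfl
  constructor
  · rintro ⟨h1, h2⟩
    exact ⟨fun i j => by rw [← hc, h1]; rfl, fun i j => by rw [← ho, h2]; rfl⟩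
  · rintro ⟨h1, h2⟩
    exact ⟨by ext i j; rw [hc, h1]; rfl, by ext i j; rw [ho, h2]; rfl⟩

/-- With a diagonal Gramian, entry (i, j) of a Lyapunov equation involves no state other than i and
j. -/
lemma StateSpace.Balanced.truncate {G : StateSpace n m p} {σ : Fin n → ℝ} (h : G.Balanced σ)
    {k : ℕ} (hk : k ≤ n) : (G.truncate k).Balanced fun i => σ (Fin.castLE hk i) := by
  rw [StateSpace.balanced_iff] at h ⊢
  simp only [StateSpace.truncate, trunc_apply hk, Z_mul_apply hk, mul_Z_transpose_apply hk]
  exact ⟨fun i j => h.1 _ _, fun i j => h.2 _ _⟩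

lemma StateSpace.truncate_truncate (G : StateSpace n m p) {k l : ℕ} (h : k ≤ l) :
    (G.truncate l).truncate k = G.truncate k := by
  simp only [StateSpace.truncate, trunc_trunc h, StateSpace.mk.injEq, true_and, and_true]
  rw [← Z_mul_Z (n := n) h, transpose_mul]
  simp only [Matrix.mul_assoc, and_self]

lemma one_sub_Z_gram (k : ℕ) :
    1 - (Z k (k + 1))ᴴ * Z k (k + 1) = vecMulVec (Pi.single (Fin.last k) (1 : ℂ))
      (star (Pi.single (Fin.last k) (1 : ℂ))) := by
  rw [Z_conjTranspose]
  ext i j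
  rw [Matrix.sub_apply, Matrix.mul_apply, vecMulVec_apply, one_apply, Pi.star_apply]
  simp only [transpose_apply, Z, of_apply]
  refine Fin.lastCases ?_ (fun i => ?_) i
  · have : ∀ x : Fin k, (x : ℕ) ≠ k := fun x => x.2.ne
    simp [this, Pi.single_apply, eq_comm]
  · have h1 : ∀ x : Fin k, ((x : ℕ) = (i : ℕ)) ↔ x = i := fun x => Fin.ext_iff.symm
    rw [Finset.sum_eq_single i (by intro x _ hx; simp [h1, hx]) (by simp)]
    simp [Pi.single_apply, Fin.ext_iff, i.2.ne]

lemma truncationStep {G : StateSpace n m p} {σ : Fin n → ℝ} (h : G.Balanced σ)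
    {k : ℕ} (hk : k + 1 = n) (hσ : ∀ i, 0 < σ i) :
    TruncationStep (Z k n) G.A (diagonal fun i => (σ i : ℂ)) (diagonal fun i => (σ i : ℂ)⁻¹)
      G.B G.C (σ ⟨k, by omega⟩) := by
  subst hk
  refine ⟨?_, ?_, ?_, ?_, hσ _, h.controllability, h.observability⟩
  · rw [Z_conjTranspose, Z_mul_transpose (Nat.le_succ k)]
  · rw [diagonal_mul_diagonal, ← diagonal_one]
    congr 1
    funext i
    exact inv_mul_cancel₀ (by exact_mod_cast (hσ i).ne')
  · rw [diagonal_conjTranspose]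
    congr 1
    funext i
    simp
  · rw [one_sub_Z_gram]
    ext i j
    rw [diagonal_mul, Matrix.smul_apply, smul_eq_mul, vecMulVec_apply]
    rcases eq_or_ne i (Fin.last k) with rfl | hi
    · rfl
    · simp [Pi.single_apply, hi]

/-- Truncating a state with zero singular value does not change the frequency response. -/
lemma freq_truncate_eq_of_eq_zero {G : StateSpace n m p} {σ : Fin n → ℝ} (h : G.Balanced σ)
    {k : ℕ} (hk : k + 1 = n) (hσ : σ ⟨k, by omega⟩ = 0) {ω : ℝ}
    (hω : G.Regular ω) (hω' : (G.truncate k).Regular ω) :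
    (G.truncate k).freq ω = G.freq ω := by
  have hkn : k ≤ n := by omega
  obtain ⟨hc, ho⟩ := StateSpace.balanced_iff.1 h
  -- A diagonal entry with zero singular value is a vanishing sum of squares. The off-diagonal
  -- entries then decouple A between states of zero and nonzero singular value.
  have hB : ∀ i, σ i = 0 → ∀ j, G.B i j = 0 := by
    intro i hi j
    have h1 := hc i i
    simp only [hi, Complex.ofReal_zero, mul_zero, zero_mul, zero_add,
      Complex.star_def, Complex.mul_conj, ← Complex.ofReal_sum] at h1
    exact congrFun (eq_zero_of_sum_normSq_nonpos (x := G.B i) (Complex.ofReal_eq_zero.1 h1).le) j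
  have hC : ∀ i, σ i = 0 → ∀ j, G.C j i = 0 := by
    intro i hi j
    have h1 := ho i i
    simp only [hi, Complex.ofReal_zero, mul_zero, zero_mul, zero_add,
      Complex.star_def, ← Complex.normSq_eq_conj_mul_self, ← Complex.ofReal_sum] at h1
    exact congrFun (eq_zero_of_sum_normSq_nonpos (x := fun j => G.C j i)
      (Complex.ofReal_eq_zero.1 h1).le) j
  have hA : ∀ i j, σ i = 0 → σ j ≠ 0 → G.A i j = 0 := by
    intro i j hi hj
    have h1 := hc i j
    simp only [hi, Complex.ofReal_zero, zero_mul, add_zero, hB i hi, Finset.sum_const_zero] at h1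
    exact (mul_eq_zero.1 h1).resolve_right (by exact_mod_cast hj)
  have hA' : ∀ i j, σ i ≠ 0 → σ j = 0 → G.A i j = 0 := by
    intro i j hi hj
    have h1 := ho i j
    simp only [hj, Complex.ofReal_zero, mul_zero, zero_add, hC j hj, Finset.sum_const_zero,
      add_zero] at h1
    exact (mul_eq_zero.1 h1).resolve_left (by exact_mod_cast hi)
  set e := Fin.castLE hkn with he
  set R : Matrix (Fin k) (Fin k) ℂ := diagonal fun i => if σ (e i) = 0 then 0 else 1 with hR
  set Pk := pencil ω (trunc k G.A) with hPk
  have hd : IsUnit Pk.det := (isUnit_iff_isUnit_det _).1 hω'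
  have hd' := (isUnit_iff_isUnit_det _).1 hω
  have hRP : R * Pk = Pk * R := by
    rw [hPk, pencil, Matrix.mul_sub, Matrix.sub_mul, Matrix.mul_smul, Matrix.smul_mul,
      Matrix.mul_one, Matrix.one_mul]
    congr 1
    ext i j
    rw [hR, diagonal_mul, mul_diagonal, trunc_apply hkn]
    by_cases hi : σ (e i) = 0 <;> by_cases hj : σ (e j) = 0
    · simp [hi, hj]
    · simp [hi, hj, hA _ _ hi hj, ← he]
    · simp [hi, hj, hA' _ _ hi hj, ← he]
    · simp [hi, hj]
  have hRB : R * (Z k n * G.B) = Z k n * G.B := by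
    ext i j
    rw [hR, diagonal_mul, Z_mul_apply hkn]
    by_cases hi : σ (e i) = 0
    · simp [hi, hB _ hi, ← he]
    · simp [hi]
  set X := Pk⁻¹ * (Z k n * G.B) with hX
  have hRX : R * X = X := by
    calc R * X = Pk⁻¹ * (Pk * R) * Pk⁻¹ * (Z k n * G.B) := by
          rw [nonsing_inv_mul_cancel_left _ _ hd, hX, Matrix.mul_assoc]
      _ = _ := by
          rw [← hRP, ← Matrix.mul_assoc Pk⁻¹, mul_nonsing_inv_cancel_right _ _ hd, Matrix.mul_assoc,
            hRB]
  have hX0 : ∀ i, σ (e i) = 0 → ∀ j, X i j = 0 := by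
    intro i hi j
    rw [← hRX, hR, diagonal_mul, if_pos hi, zero_mul]
  have hPX : Pk * X = Z k n * G.B := by rw [hX, mul_nonsing_inv_cancel_left _ _ hd]
  -- X lives on the states with nonzero singular value, so padding it with a zero solves the full
  -- system.
  have hmain : pencil ω G.A * ((Z k n)ᵀ * X) = G.B := by
    subst hk
    ext i j
    refine Fin.lastCases ?_ (fun i => ?_) i
    · rw [show G.B (Fin.last k) j = 0 from hB _ hσ j, pencil, Matrix.sub_mul, Matrix.sub_apply,
        Matrix.smul_mul, Matrix.one_mul, Matrix.smul_apply, ← Matrix.mul_assoc G.A]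
      have h1 : ((Z k (k + 1))ᵀ * X) (Fin.last k) j = 0 := by
        rw [Matrix.mul_apply]
        refine Finset.sum_eq_zero fun l _ => ?_
        have : (l : ℕ) ≠ k := l.2.ne
        simp [Z, this]
      have h2 : (G.A * (Z k (k + 1))ᵀ * X) (Fin.last k) j = 0 := by
        rw [Matrix.mul_apply]
        refine Finset.sum_eq_zero fun l _ => ?_
        rw [mul_Z_transpose_apply hkn]
        by_cases hl : σ (e l) = 0
        · rw [hX0 l hl, mul_zero]
        · rw [show G.A (Fin.last k) (Fin.castLE hkn l) = 0 from hA _ _ hσ hl, zero_mul]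
      rw [h1, h2]
      simp
    · have h1 := congrFun (congrFun hPX i) j
      rw [Z_mul_apply hkn] at h1
      have h2 : Pk * X = Z k (k + 1) * (pencil ω G.A * ((Z k (k + 1))ᵀ * X)) := by
        rw [hPk, pencil, pencil, trunc]
        simp only [Matrix.sub_mul, Matrix.mul_sub, Matrix.smul_mul, Matrix.mul_smul,
          Matrix.one_mul, Matrix.mul_assoc]
        rw [← Matrix.mul_assoc (Z k (k + 1)) _ X, Z_mul_transpose hkn, Matrix.one_mul]
      rw [h2, Z_mul_apply hkn] at h1
      exact h1
  have hfin : (pencil ω G.A)⁻¹ * G.B = (Z k n)ᵀ * X := by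
    nth_rewrite 1 [← hmain]
    exact nonsing_inv_mul_cancel_left _ _ hd'
  rw [StateSpace.freq, StateSpace.freq, Matrix.mul_assoc G.C, hfin]
  simp only [StateSpace.truncate, Matrix.mul_assoc, ← hPk, hX]

lemma norm_freq_sub_truncate_le_of_succ {G : StateSpace n m p} {σ : Fin n → ℝ} (h : G.Balanced σ)
    (hanti : Antitone σ) (hnonneg : ∀ i, 0 ≤ σ i)
    {k : ℕ} (hk : k + 1 = n) {ω : ℝ} (hω : G.Regular ω) (hω' : (G.truncate k).Regular ω) :
    ‖G.freq ω - (G.truncate k).freq ω‖ ≤ 2 * σ ⟨k, by omega⟩ := by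
  rcases (hnonneg ⟨k, by omega⟩).eq_or_lt with h0 | h0
  · rw [freq_truncate_eq_of_eq_zero h hk h0.symm hω hω', sub_self, norm_zero, ← h0, mul_zero]
  · have hpos : ∀ i, 0 < σ i := fun i => h0.trans_le (hanti (by
      rw [Fin.le_iff_val_le_val]; have := i.2; simp only; omega))
    have h1 := (truncationStep h hk hpos).norm_freq_sub_le (z := Complex.I * ω) (by simp)
      (X := (pencil ω G.A)⁻¹) (Y := (pencil ω (trunc k G.A))⁻¹)
      (nonsing_inv_mul _ ((isUnit_iff_isUnit_det _).1 hω)) (by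
        rw [Z_conjTranspose]
        exact nonsing_inv_mul _ ((isUnit_iff_isUnit_det _).1 hω'))
    rw [StateSpace.freq, StateSpace.freq, StateSpace.truncate, add_sub_add_right_eq_sub,
      ← Z_conjTranspose]
    exact h1

lemma norm_freq_truncate_succ_sub_le {G : StateSpace n m p} {σ : Fin n → ℝ} (h : G.Balanced σ)
    (hanti : Antitone σ) (hnonneg : ∀ i, 0 ≤ σ i) (k : Fin n) {ω : ℝ}
    (hω : (G.truncate (k + 1)).Regular ω) (hω' : (G.truncate k).Regular ω) :
    ‖(G.truncate (k + 1)).freq ω - (G.truncate k).freq ω‖ ≤ 2 * σ k := by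
  have hk : (k : ℕ) + 1 ≤ n := k.2
  have h1 := norm_freq_sub_truncate_le_of_succ (h.truncate hk)
    (fun i j hij => hanti (by simpa using hij)) (fun i => hnonneg _) rfl hω
    (by rwa [StateSpace.truncate_truncate _ (Nat.le_succ _)])
  rwa [StateSpace.truncate_truncate _ (Nat.le_succ _)] at h1

/-- Telescoping an error bound along a chain of frequency responses, all but finitely many of
whose values are under control. -/
lemma norm_sub_le_sum_of_chain {E : Type*} [NormedAddCommGroup E] {r : ℕ} (hr : r ≤ n)
    (f : ℕ → ℝ → E) (c : Fin n → ℝ) {U F : Set ℝ} (hU : IsOpen U) (hF : F.Finite)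
    (h : ∀ ω ∈ U, ω ∉ F → ∀ k : Fin n, r ≤ (k : ℕ) → ‖f (k + 1) ω - f k ω‖ ≤ c k) {ω : ℝ}
    (hω : ω ∈ closure U) (hn : ContinuousAt (f n) ω) (hrc : ContinuousAt (f r) ω) :
    ‖f n ω - f r ω‖ ≤ ∑ k ∈ Finset.univ.filter (fun k : Fin n => r ≤ (k : ℕ)), c k := by
  have hbound : ∀ w ∈ U ∩ Fᶜ,
      ‖f n w - f r w‖ ≤ ∑ k ∈ Finset.univ.filter (fun k : Fin n => r ≤ (k : ℕ)), c k := by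
    rintro w ⟨hwU, hwF⟩
    have h1 := dist_le_Ico_sum_dist (fun k => f k w) hr
    rw [dist_comm, dist_eq_norm] at h1
    refine h1.trans ?_
    have h2 : ∑ k ∈ Finset.Ico r n, dist (f k w) (f (k + 1) w)
        = ∑ k ∈ Finset.univ.filter (fun k : Fin n => r ≤ (k : ℕ)),
          dist (f k w) (f (k + 1) w) := by
      rw [Finset.sum_filter,
        Fin.sum_univ_eq_sum_range (fun k => if r ≤ k then dist (f k w) (f (k + 1) w) else 0),
        ← Finset.sum_filter]
      refine Finset.sum_congr ?_ fun _ _ => rfl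
      ext k
      simp [and_comm]
    rw [h2]
    refine Finset.sum_le_sum fun k hk => ?_
    rw [dist_comm, dist_eq_norm]
    exact h w hwU hwF k (Finset.mem_filter.1 hk).2
  -- Removing finitely many points from an open subset of the line does not change its closure. Only
  -- the two end responses have to be continuous at ω.
  have hcl : ω ∈ closure (U ∩ Fᶜ) := by
    have hd : Dense Fᶜ := hF.countable.dense_compl ℝ
    rw [hd.open_subset_closure_inter hU |> fun hs =>
      Set.Subset.antisymm (closure_mono Set.inter_subset_left)
        (closure_minimal hs isClosed_closure)]
    exact hω
  have := mem_closure_iff_nhdsWithin_neBot.1 hcl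
  refine le_of_tendsto (((hn.sub hrc).norm).mono_left nhdsWithin_le_nhds)
    (Filter.eventually_of_mem self_mem_nhdsWithin hbound)

lemma finite_not_regular (G : StateSpace n m p) :
    {ω : ℝ | ∃ k ∈ Finset.range (n + 1), ¬ (G.truncate k).Regular ω}.Finite := by
  have : {ω : ℝ | ∃ k ∈ Finset.range (n + 1), ¬ (G.truncate k).Regular ω}
      = ⋃ k ∈ Finset.range (n + 1), {ω : ℝ | ¬ (G.truncate k).Regular ω} := by
    ext ω
    simp
  rw [this]
  exact Set.Finite.biUnion (Finset.finite_toSet _) fun k _ => finite_not_isUnit_pencil _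

/-- The error bound of balanced truncation, at every regular frequency and without any stability
assumption. -/
lemma norm_freq_sub_truncate_le {G : StateSpace n m p} {σ : Fin n → ℝ} (h : G.Balanced σ)
    (hanti : Antitone σ) (hnonneg : ∀ i, 0 ≤ σ i) {r : ℕ} (hr : r ≤ n) {ω : ℝ}
    (hω : G.Regular ω) (hω' : (G.truncate r).Regular ω) :
    ‖G.freq ω - (G.truncate r).freq ω‖ ≤
      2 * ∑ k ∈ Finset.univ.filter (fun k : Fin n => r ≤ (k : ℕ)), σ k := by
  have h1 := norm_sub_le_sum_of_chain hr (fun k => (G.truncate k).freq) (fun k => 2 * σ k)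
    isOpen_univ (finite_not_regular G) (ω := ω) (by
      intro w _ hwF k _
      simp only [Set.mem_ofPred_eq, not_exists, not_and, not_not, Finset.mem_range] at hwF
      have hk := k.2
      exact norm_freq_truncate_succ_sub_le h hanti hnonneg k (hwF _ (by omega)) (hwF _ (by omega)))
    (by simp) (by
      rw [StateSpace.truncate_self]
      exact G.continuousAt_freq hω) ((G.truncate r).continuousAt_freq hω')
  rw [Finset.mul_sum]
  rwa [StateSpace.truncate_self] at h1

end TruncatedSystem

/-! ### The frequency-dependent truncation step -/

section BandStep

open scoped ComplexOrder

/-! ### The matrix in `eta` for an abstract truncation step -/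

section Abstract

variable {ι κ a b : Type} [Fintype ι] [Fintype κ] [Fintype a] [Fintype b]
  [DecidableEq ι] [DecidableEq κ] [DecidableEq a] [DecidableEq b]
  {J : Matrix ι κ ℂ} {A S T : Matrix κ κ ℂ} {B : Matrix κ b ℂ} {C : Matrix a κ ℂ} {s : ℝ}

/-- S preserves the range of J*, so the truncated system keeps its observability equation. This
provides the positive definite Gramian that `sqrt_sandwich` needs. -/
lemma TruncationStep.block_observability (h : TruncationStep J A S T B C s) :
    (errorA J A)ᴴ * fromBlocks (J * S * Jᴴ) 0 0 S + fromBlocks (J * S * Jᴴ) 0 0 S * errorA J A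
      + (fromBlocks (C * Jᴴ) 0 0 C)ᴴ * fromBlocks (C * Jᴴ) 0 0 C = 0 := by
  have hSJ : Jᴴ * J * (S * Jᴴ) = S * Jᴴ := by
    have h1 := congrArg conjTranspose h.discarded
    simp only [conjTranspose_mul, conjTranspose_smul, compl_conjTranspose, h.hermitian,
      Complex.star_def, Complex.conj_ofReal] at h1
    have h2 : (1 - Jᴴ * J) * (S * Jᴴ) = 0 := by
      rw [← Matrix.mul_assoc, h1, Matrix.smul_mul, h.compl_mul, smul_zero]
    rw [Matrix.sub_mul, Matrix.one_mul, sub_eq_zero] at h2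
    exact h2.symm
  have hJS : J * S * (Jᴴ * J) = J * S := by
    have := congrArg conjTranspose hSJ
    simpa only [conjTranspose_mul, conjTranspose_conjTranspose, h.hermitian] using this
  have e1 : (J * A * Jᴴ)ᴴ * (J * S * Jᴴ) = J * (Aᴴ * S) * Jᴴ := by
    calc (J * A * Jᴴ)ᴴ * (J * S * Jᴴ) = J * Aᴴ * (Jᴴ * J * (S * Jᴴ)) := by
          simp only [conjTranspose_mul, conjTranspose_conjTranspose, Matrix.mul_assoc]
      _ = _ := by rw [hSJ]; simp only [Matrix.mul_assoc]
  have e2 : J * S * Jᴴ * (J * A * Jᴴ) = J * (S * A) * Jᴴ := by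
    calc J * S * Jᴴ * (J * A * Jᴴ) = J * S * (Jᴴ * J) * (A * Jᴴ) := by
          simp only [Matrix.mul_assoc]
      _ = _ := by rw [hJS]; simp only [Matrix.mul_assoc]
  have e3 : (C * Jᴴ)ᴴ * (C * Jᴴ) = J * (Cᴴ * C) * Jᴴ := by
    simp only [conjTranspose_mul, conjTranspose_conjTranspose, Matrix.mul_assoc]
  rw [errorA, fromBlocks_conjTranspose, fromBlocks_conjTranspose, fromBlocks_multiply,
    fromBlocks_multiply, fromBlocks_multiply, fromBlocks_add, fromBlocks_add]
  simp only [conjTranspose_zero, Matrix.mul_zero, Matrix.zero_mul, add_zero, zero_add, e1, e2, e3,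
    h.observability]
  rw [← Matrix.add_mul, ← Matrix.add_mul, ← Matrix.mul_add, ← Matrix.mul_add, h.observability]
  simp

lemma TruncationStep.posSemidef_errorP (hS : S.PosSemidef) (hT : T.PosSemidef) :
    (errorP J S T s).PosSemidef := by
  refine (hS.mul_mul_conjTranspose_same _).add ?_
  rw [← Complex.ofReal_pow]
  exact (hT.mul_mul_conjTranspose_same _).smul (by exact_mod_cast sq_nonneg s)

/-- The matrix in the definition of `eta` dominates `(2s)²` plus the squared norm of the first
Markov parameter of the all-pass dilation. -/
lemma TruncationStep.add_sq_le_norm (h : TruncationStep J A S T B C s) [Nonempty (a ⊕ b)]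
    (hS : S.PosSemidef) (hT : T.PosSemidef) (hQ : (fromBlocks (J * S * Jᴴ) 0 0 S).PosDef)
    {c d : ℝ} (hd : 0 < d) {E M N : Matrix (ι ⊕ κ) (ι ⊕ κ) ℂ}
    (hE : E = errorA J A - (Complex.I * (c : ℂ)) • 1)
    (hM : M * M * (E * E + ((d ^ 2 : ℝ) : ℂ) • 1) = ((d ^ 2 : ℝ) : ℂ) • 1)
    (hN : N = -(((d ^ 2 : ℝ) : ℂ)⁻¹ • (E * (M * M)))) :
    (2 * s) ^ 2 + (‖errorC J T B C s * errorB J T B C s‖ / (2 * d)) ^ 2 ≤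
      ‖(((2 * s) ^ 2 : ℝ) : ℂ) • (1 : Matrix (a ⊕ b) (a ⊕ b) ℂ)
        + He (-(errorC J T B C s * M⁻¹ * N * (M⁻¹ * errorB J T B C s)
          * ((1 / 2 : ℂ) • (errorD a b s)ᴴ)))‖ := by
  set Q := errorC J T B C s * errorB J T B C s with hQdef
  have hEH : Eᴴ = (errorA J A)ᴴ + (Complex.I * (c : ℂ)) • 1 := by
    rw [hE]
    simp [conjTranspose_sub, conjTranspose_smul]
  have hd2 : ((d ^ 2 : ℝ) : ℂ) ≠ 0 := by exact_mod_cast (pow_pos hd 2).ne'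
  -- An imaginary multiple of the identity drops out of both Lyapunov equations.
  have hEP : E * errorP J S T s + errorP J S T s * Eᴴ
      + errorB J T B C s * (errorB J T B C s)ᴴ = 0 := by
    rw [← h.errorP_lyapunov, hEH, hE]
    simp only [Matrix.sub_mul, Matrix.mul_add, Matrix.smul_mul, Matrix.mul_smul, Matrix.one_mul,
      Matrix.mul_one]
    abel
  have hEQ : Eᴴ * fromBlocks (J * S * Jᴴ) 0 0 S + fromBlocks (J * S * Jᴴ) 0 0 S * E
      + (fromBlocks (C * Jᴴ) 0 0 C)ᴴ * fromBlocks (C * Jᴴ) 0 0 C = 0 := by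
    rw [← h.block_observability, hEH, hE]
    simp only [Matrix.add_mul, Matrix.mul_sub, Matrix.smul_mul, Matrix.mul_smul, Matrix.one_mul,
      Matrix.mul_one]
    abel
  have hsand := sqrt_sandwich hd2 (TruncationStep.posSemidef_errorP hS hT) hQ hEP hEQ hM
  have hprod : errorC J T B C s * M⁻¹ * N * (M⁻¹ * errorB J T B C s)
      * ((1 / 2 : ℂ) • (errorD a b s)ᴴ)
      = -((((d ^ 2 : ℝ) : ℂ)⁻¹ / 2) •
        (errorC J T B C s * E * errorB J T B C s * (errorD a b s)ᴴ)) := by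
    have h1 : errorC J T B C s * M⁻¹ * N * (M⁻¹ * errorB J T B C s)
        = -(((d ^ 2 : ℝ) : ℂ)⁻¹ • (errorC J T B C s
          * (M⁻¹ * (E * (M * M)) * (M⁻¹ * errorB J T B C s)))) := by
      rw [hN]
      simp only [Matrix.mul_neg, Matrix.neg_mul, Matrix.mul_smul, Matrix.smul_mul,
        Matrix.mul_assoc]
    rw [h1, hsand, Matrix.neg_mul, Matrix.smul_mul, Matrix.mul_smul, smul_smul,
      ← Matrix.mul_assoc (errorC J T B C s)]
    congr 2
    ring
  -- Once M is gone, `allPass_mul_feedthrough` applies to E. The constant 1/(4d²) is d⁻² times one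
  -- half from `He` and one half from the swap matrix.
  have hHe : He (-(errorC J T B C s * M⁻¹ * N * (M⁻¹ * errorB J T B C s)
      * ((1 / 2 : ℂ) • (errorD a b s)ᴴ)))
      = (((1 / (2 * d) : ℝ) : ℂ) • Q) * (((1 / (2 * d) : ℝ) : ℂ) • Q)ᴴ := by
    have h1 := allPass_mul_feedthrough h.errorP_conjTranspose hEP h.errorP_mul_errorC
    have h2 : star (((d ^ 2 : ℝ) : ℂ)⁻¹ / 2) = ((d ^ 2 : ℝ) : ℂ)⁻¹ / 2 := by
      rw [← Complex.ofReal_inv, ← Complex.ofReal_ofNat, ← Complex.ofReal_div]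
      exact Complex.conj_ofReal _
    rw [hprod, neg_neg, He, conjTranspose_smul, h2, ← smul_add, h1, ← hQdef, conjTranspose_smul,
      Matrix.smul_mul, Matrix.mul_smul, smul_smul, smul_smul, Complex.star_def, Complex.conj_ofReal]
    congr 1
    push_cast
    have : (d : ℂ) ≠ 0 := by exact_mod_cast hd.ne'
    field_simp
  rw [hHe]
  refine le_trans (le_of_eq ?_) (add_norm_sq_le_norm_smul_one_add _ _)
  rw [norm_smul, Complex.norm_real, Real.norm_of_nonneg (by positivity)]
  ring

end Abstract

/-! ### Identification of the dilated matrices with the abstract dilation -/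

section Dilated

variable {n m p : ℕ} {G : StateSpace n m p} {w₁ w₂ : ℝ} {σ : Fin n → ℝ} {k : Fin n}
  {M₀ : Matrix (Fin (k : ℕ)) (Fin (k : ℕ)) ℂ} {M₁ : Matrix (Fin (k + 1 : ℕ)) (Fin (k + 1 : ℕ)) ℂ}

lemma errorA_trunc (G : StateSpace n m p) (k : ℕ) :
    errorA (Z k (k + 1)) (trunc (k + 1) G.A)
      = fromBlocks (trunc k G.A) 0 0 (trunc (k + 1) G.A) := by
  rw [errorA, Z_conjTranspose]
  congr 1
  exact trunc_trunc (Nat.le_succ k) G.A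

lemma dilSigma_eq (σ : Fin n → ℝ) (k : Fin n) : dilSigma σ k = diagonal (Sum.elim
    (fun i => (σ (Fin.castLE k.2.le i) : ℂ))
    (fun i : Fin (k + 1) => (σ (Fin.castLE k.2 i) : ℂ))) := by
  rw [dilSigma, trunc_diagonal k.2.le, trunc_diagonal (k := k + 1) k.2, fromBlocks_diagonal]

lemma dilSigma_eq_fromBlocks (σ : Fin n → ℝ) (k : Fin n) : dilSigma σ k
    = fromBlocks (Z k (k + 1)
        * (diagonal fun i : Fin (k + 1) => (σ (Fin.castLE k.2 i) : ℂ)) * (Z k (k + 1))ᴴ) 0 0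
      (diagonal fun i : Fin (k + 1) => (σ (Fin.castLE k.2 i) : ℂ)) := by
  rw [Z_conjTranspose, ← trunc, trunc_diagonal (Nat.le_succ _), dilSigma,
    trunc_diagonal k.2.le, trunc_diagonal (k := k + 1) k.2]
  rfl

lemma dilSigma_inv (hσ : ∀ i, 0 < σ i) : (dilSigma σ k)⁻¹ = diagonal (Sum.elim
    (fun i => (σ (Fin.castLE k.2.le i) : ℂ)⁻¹)
    (fun i : Fin (k + 1) => (σ (Fin.castLE k.2 i) : ℂ)⁻¹)) := by
  refine inv_eq_right_inv ?_
  rw [dilSigma_eq, diagonal_mul_diagonal, ← diagonal_one]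
  congr 1
  funext i
  rcases i with i | i
  · exact mul_inv_cancel₀ (Complex.ofReal_ne_zero.2 (hσ _).ne')
  · exact mul_inv_cancel₀ (Complex.ofReal_ne_zero.2 (hσ _).ne')

/-- The values c = 1 and c = -1 give the two stackings; Σ⁻¹ passes through them because it is
diagonal and truncates with the states. -/
lemma dilSigma_inv_mul_fromRows (hσ : ∀ i, 0 < σ i) (c : ℂ) :
    (dilSigma σ k)⁻¹ * fromRows (Z k (k + 1)) (c • (1 : Matrix (Fin (k + 1)) (Fin (k + 1)) ℂ))
      = fromRows (Z k (k + 1)) (c • (1 : Matrix (Fin (k + 1)) (Fin (k + 1)) ℂ))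
        * (diagonal fun i : Fin (k + 1) => (σ (Fin.castLE k.2 i) : ℂ)⁻¹) := by
  rw [dilSigma_inv hσ]
  ext i j
  rw [diagonal_mul, mul_diagonal]
  rcases i with i | i
  · by_cases hij : (i : ℕ) = (j : ℕ)
    · have : Fin.castLE k.2.le i = Fin.castLE (n := k + 1) k.2 j := Fin.ext hij
      simp only [Sum.elim_inl, this, mul_comm]
    · simp [Z, hij]
  · by_cases hij : i = j
    · subst hij
      exact mul_comm _ _
    · simp [hij]

lemma stackPos_Z_mul (k : Fin n) :
    stackPos (Z k (k + 1)) * Z (k + 1) n = fromRows (Z k n) (Z (k + 1) n) := by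
  rw [stackPos, fromRows_mul, Z_mul_Z (Nat.le_succ _), Matrix.one_mul]

lemma stackNeg_Z_mul (k : Fin n) :
    stackNeg (Z k (k + 1)) * Z (k + 1) n = fromRows (Z k n) (-Z (k + 1) n) := by
  rw [stackNeg, fromRows_mul, Z_mul_Z (Nat.le_succ _), Matrix.neg_mul, Matrix.one_mul]

lemma dilSigma_inv_mul_stackPos (hσ : ∀ i, 0 < σ i) :
    (dilSigma σ k)⁻¹ * stackPos (Z k (k + 1)) = stackPos (Z k (k + 1))
      * (diagonal fun i : Fin (k + 1) => (σ (Fin.castLE k.2 i) : ℂ)⁻¹) := by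
  simpa [stackPos] using dilSigma_inv_mul_fromRows (k := k) hσ 1

lemma dilSigma_inv_mul_stackNeg (hσ : ∀ i, 0 < σ i) :
    (dilSigma σ k)⁻¹ * stackNeg (Z k (k + 1)) = stackNeg (Z k (k + 1))
      * (diagonal fun i : Fin (k + 1) => (σ (Fin.castLE k.2 i) : ℂ)⁻¹) := by
  simpa [stackNeg] using dilSigma_inv_mul_fromRows (k := k) hσ (-1)

lemma conjTranspose_mul_Z_transpose {q : Type*} (C : Matrix q (Fin n) ℂ) (k : ℕ) :
    (C * (Z k n)ᵀ)ᴴ = Z k n * Cᴴ := by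
  rw [conjTranspose_mul, ← Z_conjTranspose, conjTranspose_conjTranspose]

lemma dilB_eq (hσ : ∀ i, 0 < σ i) : dilB G w₁ w₂ σ k M₀ M₁ = (dilM k M₀ M₁)⁻¹
    * errorB (Z k (k + 1)) (diagonal fun i : Fin (k + 1) => (σ (Fin.castLE k.2 i) : ℂ)⁻¹)
      (Z (k + 1) n * (G.extend w₁ w₂).B) ((G.extend w₁ w₂).C * (Z (k + 1) n)ᵀ) (σ k) := by
  rw [dilB, errorB, mul_fromCols, conjTranspose_mul_Z_transpose, ← Matrix.mul_assoc (stackPos _),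
    stackPos_Z_mul, ← Matrix.mul_assoc (stackNeg _), ← dilSigma_inv_mul_stackNeg hσ,
    ← Matrix.mul_assoc, Matrix.mul_smul, Matrix.mul_assoc (dilSigma σ k)⁻¹,
    ← Matrix.mul_assoc (stackNeg _), stackNeg_Z_mul]
  simp only [Matrix.mul_assoc]

lemma dilC_eq (hσ : ∀ i, 0 < σ i) : dilC G w₁ w₂ σ k M₀ M₁ =
    errorC (Z k (k + 1)) (diagonal fun i : Fin (k + 1) => (σ (Fin.castLE k.2 i) : ℂ)⁻¹)
      (Z (k + 1) n * (G.extend w₁ w₂).B) ((G.extend w₁ w₂).C * (Z (k + 1) n)ᵀ) (σ k)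
      * (dilM k M₀ M₁)⁻¹ := by
  have h1 : (dilM k M₀ M₁)⁻¹ = ((dilM k M₀ M₁)⁻¹)ᴴᴴ := by rw [conjTranspose_conjTranspose]
  rw [h1, dilC, errorC, ← conjTranspose_mul, mul_fromCols, conjTranspose_mul_Z_transpose,
    ← Matrix.mul_assoc (stackNeg _), stackNeg_Z_mul, ← Matrix.mul_assoc (stackPos _),
    ← dilSigma_inv_mul_stackPos hσ, Matrix.mul_assoc (dilSigma σ k)⁻¹,
    ← Matrix.mul_assoc (stackPos _), stackPos_Z_mul]
  have h2 : fromRows (-Z k n) (Z (k + 1) n) = -fromRows (Z k n) (-Z (k + 1) n) := by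
    ext (i | i) j <;> simp
  have h3 : fromRows (-Z k n) (-Z (k + 1) n) = -fromRows (Z k n) (Z (k + 1) n) := by
    ext (i | i) j <;> simp
  rw [h2, h3]
  simp only [Matrix.mul_assoc, Matrix.mul_neg, Matrix.neg_mul, smul_neg, Matrix.mul_smul]

lemma dilSwap_eq (s : ℝ) :
    dilSwap m p s = (1 / 2 : ℂ) • (errorD (Fin p) (Fin m) s)ᴴ := by
  have hs : star (((2 * s : ℝ) : ℂ)) = ((2 * s : ℝ) : ℂ) := Complex.conj_ofReal _
  rw [dilSwap, errorD, fromBlocks_conjTranspose]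
  simp only [conjTranspose_zero, conjTranspose_smul, conjTranspose_one, hs]

lemma add_sq_le_eta (hw : w₁ < w₂) (hbal : (G.extend w₁ w₂).Balanced σ) (hσ : ∀ i, 0 < σ i)
    (hM₀ : IsInvertibleSqrt M₀ (bandMatrix w₁ w₂ (trunc k G.A)))
    (hM₁ : IsInvertibleSqrt M₁ (bandMatrix w₁ w₂ (trunc (k + 1) G.A)))
    [Nonempty (Fin p ⊕ Fin m)] :
    (2 * σ k) ^ 2 + (2 * ‖(G.extend w₁ w₂).C * (Z (k + 1) n)ᵀ
        * (1 - (Z k (k + 1))ᴴ * Z k (k + 1)) * (Z (k + 1) n * (G.extend w₁ w₂).B)‖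
      / (2 * ((w₂ - w₁) / 2))) ^ 2 ≤ eta G w₁ w₂ σ k M₀ M₁ := by
  have hk : (k : ℕ) + 1 ≤ n := k.2
  set c := (w₂ + w₁) / 2 with hc
  set d := (w₂ - w₁) / 2 with hd
  have hd0 : 0 < d := by rw [hd]; linarith
  have hσ' : ∀ i : Fin (k + 1), 0 < σ (Fin.castLE hk i) := fun i => hσ _
  have h := truncationStep (hbal.truncate hk) rfl hσ'
  have hu : ∀ {l : ℕ} {M X : Matrix (Fin l) (Fin l) ℂ}, IsInvertibleSqrt M X → IsUnit X :=
    fun hM => hM.2 ▸ hM.1.mul hM.1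
  have e0 := bandMatrix_mul_shift (hu hM₀)
  have e1 := bandMatrix_mul_shift (hu hM₁)
  rw [← hc, ← hd] at e0 e1
  set E := errorA (Z k (k + 1)) (trunc (k + 1) G.A) - (Complex.I * (c : ℂ)) • 1 with hE
  have hE' : E = -fromBlocks (pencil c (trunc k G.A)) 0 0 (pencil c (trunc (k + 1) G.A)) := by
    rw [hE, errorA_trunc, ← fromBlocks_one, fromBlocks_smul, fromBlocks_neg, sub_eq_add_neg,
      fromBlocks_neg, fromBlocks_add, pencil, pencil]
    simp [← sub_eq_add_neg]
  have hMM : dilM k M₀ M₁ * dilM k M₀ M₁ = fromBlocks (bandMatrix w₁ w₂ (trunc k G.A)) 0 0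
      (bandMatrix w₁ w₂ (trunc (k + 1) G.A)) := by
    rw [dilM, fromBlocks_multiply, ← hM₀.2, ← hM₁.2]
    simp
  have hM : dilM k M₀ M₁ * dilM k M₀ M₁ * (E * E + ((d ^ 2 : ℝ) : ℂ) • 1)
      = ((d ^ 2 : ℝ) : ℂ) • 1 := by
    rw [hMM, hE', neg_mul_neg, fromBlocks_multiply, ← fromBlocks_one, fromBlocks_smul,
      fromBlocks_add, fromBlocks_multiply]
    simp only [Matrix.mul_zero, Matrix.zero_mul, add_zero, zero_add, smul_zero, e0, e1]
  have hN : dilN G w₁ w₂ k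
      = -(((d ^ 2 : ℝ) : ℂ)⁻¹ • (E * (dilM k M₀ M₁ * dilM k M₀ M₁))) := by
    rw [hMM, hE', dilN, centerMatrix_eq hw, centerMatrix_eq hw, ← hc, ← hd, Matrix.neg_mul,
      smul_neg, neg_neg, fromBlocks_multiply, fromBlocks_smul]
    simp
  have hS : (diagonal fun i : Fin (k + 1) => (σ (Fin.castLE hk i) : ℂ)).PosSemidef :=
    PosSemidef.diagonal fun i => Complex.zero_le_real.2 (hσ' i).le
  have hT : (diagonal fun i : Fin (k + 1) => (σ (Fin.castLE hk i) : ℂ)⁻¹).PosSemidef :=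
    PosSemidef.diagonal fun i => by
      rw [← Complex.ofReal_inv]
      exact Complex.zero_le_real.2 (inv_pos.2 (hσ' i)).le
  have hQ := dilSigma_eq_fromBlocks σ k ▸ dilSigma_eq σ k ▸ PosDef.diagonal (d := Sum.elim
    (fun i => (σ (Fin.castLE k.2.le i) : ℂ)) (fun i => (σ (Fin.castLE hk i) : ℂ)))
    (fun i => by rcases i with i | i <;> exact Complex.zero_lt_real.2 (hσ _))
  have hmain := h.add_sq_le_norm hS hT hQ hd0 hE hM hN
  have hQn := h.two_mul_norm_le_norm_errorC_mul_errorB (one_sub_Z_gram k) (by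
    rw [Matrix.mulVec_single_one]
    ext i
    have : (i : ℕ) ≠ k := i.2.ne
    simp [Z, this]) (by
    intro y
    rw [one_sub_Z_gram, dotProduct, dotProduct, Complex.re_sum, Complex.re_sum, Finset.mul_sum]
    refine Finset.sum_le_sum fun i _ => ?_
    have hyi : ∀ v : ℝ, (star y i * ((v : ℂ) * y i)).re = v * Complex.normSq (y i) := by
      intro v
      rw [Pi.star_apply, mul_left_comm, Complex.star_def, ← Complex.normSq_eq_conj_mul_self,
        ← Complex.ofReal_mul, Complex.ofReal_re]
    rw [mulVec_diagonal, vecMulVec_mulVec, ← Complex.ofReal_inv, hyi, ← mul_assoc]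
    rcases eq_or_ne i (Fin.last k) with rfl | hi
    · have h1 := hyi 1
      rw [Complex.ofReal_one, one_mul, one_mul] at h1
      refine le_of_eq ?_
      rw [show σ (Fin.castLE hk ⟨k, by omega⟩) = σ (Fin.castLE hk (Fin.last k)) from rfl,
        mul_inv_cancel₀ (hσ _).ne', one_mul, ← h1]
      simp
    · have h2 := hσ (Fin.castLE hk ⟨k, by omega⟩)
      have h3 := hσ (Fin.castLE hk i)
      have h4 := Complex.normSq_nonneg (y i)
      refine le_trans (le_of_eq ?_) (mul_nonneg (mul_nonneg h2.le (inv_pos.2 h3).le) h4)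
      simp [hi])
  rw [FDBT.eta, dilB_eq hσ, dilC_eq hσ, dilSwap_eq, sigmaMax_eq_norm]
  refine le_trans (add_le_add le_rfl ?_) hmain
  exact pow_le_pow_left₀ (by positivity) (div_le_div_of_nonneg_right hQn (by positivity)) 2

end Dilated

end BandStep

/-! ### Error bounds for the reduced model -/

section ErrorBounds

variable {n m p : ℕ}

/-- The frequency response of the system whose extended system is `K`. -/
def bandFreq (w₁ w₂ : ℝ) (K : StateSpace n m p) (ω : ℝ) : Matrix (Fin p) (Fin m) ℂ :=
  K.D + ((1 - ((ω - (w₂ + w₁) / 2) / ((w₂ - w₁) / 2)) ^ 2 : ℝ) : ℂ) • (K.freq ω - K.D)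
    - (Complex.I * (((ω - (w₂ + w₁) / 2) / ((w₂ - w₁) / 2) ^ 2 : ℝ) : ℂ)) • (K.C * K.B)

/-- Stated for a pair (extended K, original L) so that it serves both the full and the reduced
model. The principal root commutes with the state matrix, which `inv_sqrt_mul_resolvent` requires.
-/
lemma freq_eq_bandFreq {w₁ w₂ : ℝ} (hw : w₁ < w₂) {K L : StateSpace n m p}
    {S : Matrix (Fin n) (Fin n) ℂ} (hS : IsPrincipalSqrt S (bandMatrix w₁ w₂ K.A)) (hA : L.A = K.A)
    (hB : L.B = S⁻¹ * K.B) (hC : L.C = K.C * S⁻¹)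
    (hD : L.D = K.D - L.C * centerMatrix w₁ w₂ L.A * L.B) {ω : ℝ} (hω : K.Regular ω) :
    L.freq ω = bandFreq w₁ w₂ K ω := by
  have hu := hS.isUnit
  have hAS := hS.commute (commute_bandMatrix (hS.1 ▸ hu.mul hu))
  have h := congrArg (fun X => K.C * X * K.B) (inv_sqrt_mul_resolvent hw hu hS.1 hAS hω)
  simp only [Matrix.mul_sub, Matrix.sub_mul, Matrix.mul_smul, Matrix.smul_mul,
    Matrix.mul_one] at h
  rw [bandFreq, StateSpace.freq, StateSpace.freq, hD, hA, hB, hC, add_sub_cancel_right,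
    add_sub_assoc, ← h]
  simp only [Matrix.mul_assoc]
  abel

lemma bandFreq_sub (w₁ w₂ : ℝ) {k l : ℕ} (K : StateSpace k m p) (L : StateSpace l m p)
    (hD : K.D = L.D) (ω : ℝ) : bandFreq w₁ w₂ K ω - bandFreq w₁ w₂ L ω
      = ((1 - ((ω - (w₂ + w₁) / 2) / ((w₂ - w₁) / 2)) ^ 2 : ℝ) : ℂ) • (K.freq ω - L.freq ω)
        - (Complex.I * (((ω - (w₂ + w₁) / 2) / ((w₂ - w₁) / 2) ^ 2 : ℝ) : ℂ))
          • (K.C * K.B - L.C * L.B) := by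
  rw [bandFreq, bandFreq, hD]
  module

lemma continuousAt_bandFreq (w₁ w₂ : ℝ) (K : StateSpace n m p) {ω : ℝ} (hω : K.Regular ω) :
    ContinuousAt (bandFreq w₁ w₂ K) ω := by
  have h1 := K.continuousAt_freq hω
  have h2 : ContinuousAt (fun ω : ℝ =>
      ((1 - ((ω - (w₂ + w₁) / 2) / ((w₂ - w₁) / 2)) ^ 2 : ℝ) : ℂ)) ω :=
    Continuous.continuousAt (by fun_prop)
  have h3 : ContinuousAt (fun ω : ℝ =>
      Complex.I * (((ω - (w₂ + w₁) / 2) / ((w₂ - w₁) / 2) ^ 2 : ℝ) : ℂ)) ω :=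
    Continuous.continuousAt (by fun_prop)
  exact ((h2.smul (h1.sub (continuousAt_const (y := K.D)))).const_add K.D).sub
    (h3.smul (continuousAt_const (y := K.C * K.B)))

/-- Cauchy–Schwarz for (1 - t², |t|) and (2s, q), with (1 - t²)² + t² = 1 - t²(1 - t²) ≤ 1. -/
lemma interpolation_le_sqrt {t s x d q η : ℝ} (ht : |t| ≤ 1)
    (hq : q = 2 * x / (2 * d)) (h : (2 * s) ^ 2 + q ^ 2 ≤ η) :
    (1 - t ^ 2) * (2 * s) + |t| / d * x ≤ √η := by
  have e : |t| / d * x = |t| * q := by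
    rw [hq, mul_div_mul_left _ _ two_ne_zero]
    ring
  have ht0 := abs_nonneg t
  rw [e, ← sq_abs t]
  refine Real.le_sqrt_of_sq_le (le_trans ?_ h)
  set u := |t|
  have hu : u ^ 2 ≤ 1 := by nlinarith
  nlinarith [sq_nonneg (u * (2 * s) - (1 - u ^ 2) * q), mul_nonneg (mul_nonneg (sq_nonneg u)
    (sub_nonneg.2 hu)) (add_nonneg (sq_nonneg (2 * s)) (sq_nonneg q))]

lemma compl_gram_mul (H : StateSpace n m p) (k : ℕ) :
    H.C * (Z (k + 1) n)ᵀ * (1 - (Z k (k + 1))ᴴ * Z k (k + 1)) * (Z (k + 1) n * H.B)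
      = (H.truncate (k + 1)).C * (H.truncate (k + 1)).B - (H.truncate k).C * (H.truncate k).B := by
  rw [← H.truncate_truncate (Nat.le_succ k), Z_conjTranspose]
  simp only [StateSpace.truncate, Matrix.mul_sub, Matrix.sub_mul, Matrix.mul_one, Matrix.mul_assoc]

lemma norm_bandFreq_sub_le_sqrt_eta {G : StateSpace n m p} {w₁ w₂ : ℝ} {σ : Fin n → ℝ}
    (hw : w₁ < w₂) (hbal : (G.extend w₁ w₂).Balanced σ) (hanti : Antitone σ) (hσ : ∀ i, 0 < σ i)
    {k : Fin n} {M₀ : Matrix (Fin (k : ℕ)) (Fin (k : ℕ)) ℂ}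
    {M₁ : Matrix (Fin (k + 1 : ℕ)) (Fin (k + 1 : ℕ)) ℂ}
    (hM₀ : IsInvertibleSqrt M₀ (bandMatrix w₁ w₂ (trunc k G.A)))
    (hM₁ : IsInvertibleSqrt M₁ (bandMatrix w₁ w₂ (trunc (k + 1) G.A)))
    {ω : ℝ} (hω : ω ∈ Set.Icc w₁ w₂) (h₁ : ((G.extend w₁ w₂).truncate (k + 1)).Regular ω)
    (h₀ : ((G.extend w₁ w₂).truncate k).Regular ω) :
    ‖bandFreq w₁ w₂ ((G.extend w₁ w₂).truncate (k + 1)) ω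
      - bandFreq w₁ w₂ ((G.extend w₁ w₂).truncate k) ω‖ ≤ √(eta G w₁ w₂ σ k M₀ M₁) := by
  -- `add_sq_le_eta` needs a nonempty index type; without inputs and outputs the difference is zero.
  rcases isEmpty_or_nonempty (Fin p ⊕ Fin m) with he | he
  · have : IsEmpty (Fin p) := (isEmpty_sum.1 he).1
    rw [Subsingleton.elim (bandFreq w₁ w₂ ((G.extend w₁ w₂).truncate (k + 1)) ω
      - bandFreq w₁ w₂ ((G.extend w₁ w₂).truncate k) ω) 0, norm_zero]
    exact Real.sqrt_nonneg _
  have heta := add_sq_le_eta hw hbal hσ hM₀ hM₁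
  rw [compl_gram_mul] at heta
  have hfreq := norm_freq_truncate_succ_sub_le hbal hanti (fun i => (hσ i).le) k h₁ h₀
  rw [bandFreq_sub _ _ ((G.extend w₁ w₂).truncate (k + 1)) ((G.extend w₁ w₂).truncate k) rfl]
  set d := (w₂ - w₁) / 2 with hd
  have hd0 : 0 < d := by rw [hd]; linarith
  have ht : |(ω - (w₂ + w₁) / 2) / d| ≤ 1 := by
    rw [abs_div, abs_of_pos hd0, div_le_one hd0, abs_le, hd]
    constructor <;> linarith [hω.1, hω.2]
  refine le_trans ?_ (interpolation_le_sqrt ht rfl heta)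
  refine (norm_sub_le _ _).trans (add_le_add ?_ ?_)
  · rw [norm_smul, Complex.norm_real, Real.norm_of_nonneg]
    · refine mul_le_mul_of_nonneg_left hfreq ?_
      rw [sub_nonneg]
      exact (sq_le_one_iff_abs_le_one _).2 ht
    · rw [sub_nonneg]
      exact (sq_le_one_iff_abs_le_one _).2 ht
  · rw [norm_smul, norm_mul, Complex.norm_I, one_mul, Complex.norm_real, Real.norm_eq_abs,
      abs_div, abs_div, abs_of_pos (pow_pos hd0 2), abs_of_pos hd0, div_div, ← pow_two]

lemma freq_eq_bandFreq_extend {G : StateSpace n m p} {w₁ w₂ : ℝ} (hw : w₁ < w₂)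
    (hS : HasPrincipalSqrt (bandMatrix w₁ w₂ G.A)) {ω : ℝ} (hω : G.Regular ω) :
    G.freq ω = bandFreq w₁ w₂ (G.extend w₁ w₂) ω := by
  have hP := isPrincipalSqrt_principalSqrt hS
  have hd := (isUnit_iff_isUnit_det _).1 hP.isUnit
  have hB : G.B = (principalSqrt (bandMatrix w₁ w₂ G.A))⁻¹ * (G.extend w₁ w₂).B :=
    (nonsing_inv_mul_cancel_left _ _ hd).symm
  have hC : G.C = (G.extend w₁ w₂).C * (principalSqrt (bandMatrix w₁ w₂ G.A))⁻¹ :=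
    (mul_nonsing_inv_cancel_right _ _ hd).symm
  have hD : G.D = (G.extend w₁ w₂).D - G.C * centerMatrix w₁ w₂ G.A * G.B :=
    (add_sub_cancel_right _ _).symm
  exact freq_eq_bandFreq hw (K := G.extend w₁ w₂) (L := G) hP rfl hB hC hD hω

lemma freq_reducedModel_eq_bandFreq {G : StateSpace n m p} {w₁ w₂ : ℝ} (hw : w₁ < w₂) {r : ℕ}
    (hS : HasPrincipalSqrt (bandMatrix w₁ w₂ (trunc r G.A))) {ω : ℝ}
    (hω : (reducedModel G w₁ w₂ r).Regular ω) :
    (reducedModel G w₁ w₂ r).freq ω = bandFreq w₁ w₂ ((G.extend w₁ w₂).truncate r) ω := by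
  have hB : (reducedModel G w₁ w₂ r).B = (principalSqrt (bandMatrix w₁ w₂ (trunc r G.A)))⁻¹
      * ((G.extend w₁ w₂).truncate r).B := Matrix.mul_assoc _ _ _
  have hC : (reducedModel G w₁ w₂ r).C = ((G.extend w₁ w₂).truncate r).C
      * (principalSqrt (bandMatrix w₁ w₂ (trunc r G.A)))⁻¹ := rfl
  have hD : (reducedModel G w₁ w₂ r).D = ((G.extend w₁ w₂).truncate r).D
      - (reducedModel G w₁ w₂ r).C * centerMatrix w₁ w₂ (reducedModel G w₁ w₂ r).A
        * (reducedModel G w₁ w₂ r).B := rfl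
  exact freq_eq_bandFreq hw (K := (G.extend w₁ w₂).truncate r) (L := reducedModel G w₁ w₂ r)
    (isPrincipalSqrt_principalSqrt hS) rfl hB hC hD hω

/-- Both constructions use the same state matrix, hence the same root and centre matrix, and the
factors and feedthrough corrections cancel. -/
lemma reducedModel_extend {G : StateSpace n m p} {w₁ w₂ : ℝ} {r : ℕ}
    (hS : HasPrincipalSqrt (bandMatrix w₁ w₂ (trunc r G.A))) :
    (reducedModel G w₁ w₂ r).extend w₁ w₂ = (G.extend w₁ w₂).truncate r := by
  have hP := isPrincipalSqrt_principalSqrt hS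
  have hd := (isUnit_iff_isUnit_det _).1 hP.isUnit
  rw [StateSpace.truncate, StateSpace.extend, StateSpace.mk.injEq]
  refine ⟨rfl, ?_, ?_, ?_⟩
  · change principalSqrt _ * reducedB G w₁ w₂ r = _
    rw [reducedB, Matrix.mul_assoc]
    exact mul_nonsing_inv_cancel_left _ _ hd
  · change reducedC G w₁ w₂ r * principalSqrt _ = _
    exact nonsing_inv_mul_cancel_right _ _ hd
  · exact sub_add_cancel _ _

lemma norm_freq_sub_reducedModel_le_sum_sqrt_eta {G : StateSpace n m p} {w₁ w₂ : ℝ}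
    {σ : Fin n → ℝ} (hw : w₁ < w₂) (hbal : (G.extend w₁ w₂).Balanced σ) (hanti : Antitone σ)
    (hσ : ∀ i, 0 < σ i) {r : ℕ} (hr : r ≤ n)
    (hG : HasPrincipalSqrt (bandMatrix w₁ w₂ G.A))
    (hGr : HasPrincipalSqrt (bandMatrix w₁ w₂ (trunc r G.A)))
    {M : (k : ℕ) → Matrix (Fin k) (Fin k) ℂ}
    (hM : ∀ k, r ≤ k → k ≤ n → IsInvertibleSqrt (M k) (bandMatrix w₁ w₂ (trunc k G.A)))
    {ω : ℝ} (hω : ω ∈ Set.Icc w₁ w₂) (h : G.Regular ω)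
    (hred : (reducedModel G w₁ w₂ r).Regular ω) :
    ‖G.freq ω - (reducedModel G w₁ w₂ r).freq ω‖ ≤
      ∑ k ∈ Finset.univ.filter (fun k : Fin n => r ≤ (k : ℕ)),
        √(eta G w₁ w₂ σ k (M k) (M (k + 1))) := by
  -- The chain is run on the open band; closure and continuity supply the endpoints and the
  -- exceptional frequencies.
  have h1 := norm_sub_le_sum_of_chain hr
    (fun k => bandFreq w₁ w₂ ((G.extend w₁ w₂).truncate k))
    (fun k => √(eta G w₁ w₂ σ k (M k) (M (k + 1))))
    isOpen_Ioo (finite_not_regular (G.extend w₁ w₂)) (ω := ω) (by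
      intro w hw' hwF k hk
      simp only [Set.mem_ofPred_eq, not_exists, not_and, not_not, Finset.mem_range] at hwF
      have hk' := k.2
      exact norm_bandFreq_sub_le_sqrt_eta hw hbal hanti hσ (hM _ hk hk'.le)
        (hM _ (by omega) (by omega)) ⟨hw'.1.le, hw'.2.le⟩ (hwF _ (by omega)) (hwF _ (by omega)))
    (by rwa [closure_Ioo hw.ne]) (by
      rw [StateSpace.truncate_self]
      exact continuousAt_bandFreq _ _ _ h) (continuousAt_bandFreq _ _ _ hred)
  rw [StateSpace.truncate_self] at h1
  rwa [freq_eq_bandFreq_extend hw hG h, freq_reducedModel_eq_bandFreq hw hGr hred]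

lemma ofReal_norm_freq_sub_le_hinfDist {n' : ℕ} (G : StateSpace n m p) (H : StateSpace n' m p)
    {ω : ℝ} (hG : G.Regular ω) (hH : H.Regular ω) :
    ENNReal.ofReal ‖G.freq ω - H.freq ω‖ ≤ hinfDist G H := by
  rw [← sigmaMax_eq_norm, hinfDist]
  exact le_iSup_of_le ω (le_iSup_of_le hG (le_iSup_of_le hH le_rfl))

lemma ofReal_norm_freq_sub_reducedModel_le {G : StateSpace n m p} {w₁ w₂ : ℝ}
    {σ : Fin n → ℝ} (hbal : (G.extend w₁ w₂).Balanced σ) (hanti : Antitone σ)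
    (hσ : ∀ i, 0 ≤ σ i) {r : ℕ} (hr : r ≤ n)
    (hGr : HasPrincipalSqrt (bandMatrix w₁ w₂ (trunc r G.A)))
    {ω : ℝ} (h : G.Regular ω) (hred : (reducedModel G w₁ w₂ r).Regular ω) :
    ENNReal.ofReal ‖G.freq ω - (reducedModel G w₁ w₂ r).freq ω‖ ≤
      ENNReal.ofReal (2 * ∑ k ∈ Finset.univ.filter (fun k : Fin n => r ≤ (k : ℕ)), σ k)
        + hinfDist G (G.extend w₁ w₂)
        + hinfDist (reducedModel G w₁ w₂ r) ((reducedModel G w₁ w₂ r).extend w₁ w₂) := by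
  have h1 := norm_freq_sub_truncate_le hbal hanti hσ hr (ω := ω) h hred
  have h2 := ofReal_norm_freq_sub_le_hinfDist G (G.extend w₁ w₂) h h
  have h3 := ofReal_norm_freq_sub_le_hinfDist (reducedModel G w₁ w₂ r)
    ((reducedModel G w₁ w₂ r).extend w₁ w₂) hred hred
  rw [reducedModel_extend hGr] at h3 ⊢
  set g := G.freq ω
  set f := (reducedModel G w₁ w₂ r).freq ω
  set g' := (G.extend w₁ w₂).freq ω
  set f' := ((G.extend w₁ w₂).truncate r).freq ω
  have h4 : ‖g - f‖ ≤ ‖g' - f'‖ + ‖g - g'‖ + ‖f - f'‖ := by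
    rw [show g - f = (g' - f') + (g - g') - (f - f') by abel]
    exact (norm_sub_le _ _).trans (add_le_add (norm_add_le _ _) le_rfl)
  refine (ENNReal.ofReal_le_ofReal h4).trans ?_
  rw [ENNReal.ofReal_add (by positivity) (norm_nonneg _),
    ENNReal.ofReal_add (norm_nonneg _) (norm_nonneg _)]
  exact add_le_add (add_le_add (ENNReal.ofReal_le_ofReal h1) h2) h3

/-- All sufficiently large frequencies are regular and the responses tend to the feedthroughs, so a
bound uniform in ω passes to the limit. -/
lemma ofReal_norm_feedthrough_sub_le {n' : ℕ} {G : StateSpace n m p} {H : StateSpace n' m p}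
    {c : ENNReal} (h : ∀ ω, G.Regular ω → H.Regular ω →
      ENNReal.ofReal ‖G.freq ω - H.freq ω‖ ≤ c) : ENNReal.ofReal ‖G.D - H.D‖ ≤ c := by
  have hreg : ∀ {l : ℕ} (K : StateSpace l m p), ∀ᶠ ω in Filter.atTop, K.Regular ω := by
    intro l K
    have h1 : Filter.Tendsto (id : ℝ → ℝ) Filter.atTop Filter.cofinite :=
      Filter.tendsto_id'.2 Filter.atTop_le_cofinite
    have h2 := h1.eventually (finite_not_isUnit_pencil K.A).compl_mem_cofinite
    filter_upwards [h2] with ω hω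
    exact not_not.1 hω
  refine le_of_tendsto ((ENNReal.continuous_ofReal.comp continuous_norm).continuousAt.tendsto.comp
    (G.tendsto_freq_atTop.sub H.tendsto_freq_atTop)) ?_
  filter_upwards [hreg G, hreg H] with ω h1 h2
  exact h ω h1 h2

end ErrorBounds

end FDBT

end

theorem theorem2 {n m p : ℕ} (G : FDBT.StateSpace n m p) (w₁ w₂ : ℝ) (hw : w₁ < w₂)
    (σ : Fin n → ℝ) (hσ_anti : Antitone σ) (hσ_nonneg : ∀ i, 0 ≤ σ i)
    (hbal : FDBT.IsIntervalBalanced G w₁ w₂ σ) (r : ℕ) (hr : r < n) :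
    -- Part 1: stability is preserved, and then the reduced model is well defined.
    (G.Stable → (∀ i j : Fin n, (i : ℕ) < r → r ≤ (j : ℕ) → σ j < σ i) →
      (FDBT.reducedModel G w₁ w₂ r).Stable ∧
      FDBT.HasPrincipalSqrt (FDBT.bandMatrix w₁ w₂ (FDBT.trunc r G.A))) ∧
    -- Parts 2 and 3, whenever the square root defining the reduced model exists.
    (FDBT.HasPrincipalSqrt (FDBT.bandMatrix w₁ w₂ (FDBT.trunc r G.A)) →
      -- Part 2: the interval-type error bound, for every choice of the square roots `M k`.
      ((∀ i, 0 < σ i) →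
        ∀ M : (k : ℕ) → Matrix (Fin k) (Fin k) ℂ,
          (∀ k, r ≤ k → k ≤ n →
            FDBT.IsInvertibleSqrt (M k) (FDBT.bandMatrix w₁ w₂ (FDBT.trunc k G.A))) →
          ∀ ω ∈ Set.Icc w₁ w₂, G.Regular ω → (FDBT.reducedModel G w₁ w₂ r).Regular ω →
            FDBT.sigmaMax (G.freq ω - (FDBT.reducedModel G w₁ w₂ r).freq ω) ≤
              ∑ k ∈ Finset.univ.filter (fun k : Fin n => r ≤ (k : ℕ)),
                Real.sqrt (FDBT.eta G w₁ w₂ σ k (M k) (M (k + 1)))) ∧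
      -- Part 3: the extended system of the reduced model is the truncated extended system,
      ((FDBT.reducedModel G w₁ w₂ r).extend w₁ w₂ =
        ⟨FDBT.trunc r (G.extend w₁ w₂).A,
          FDBT.Z r n * (G.extend w₁ w₂).B,
          (G.extend w₁ w₂).C * (FDBT.Z r n).transpose,
          (G.extend w₁ w₂).D⟩) ∧
      -- the entire-frequency error bound holds at all finite frequencies,
      (∀ ω : ℝ, G.Regular ω → (FDBT.reducedModel G w₁ w₂ r).Regular ω →
        ENNReal.ofReal (FDBT.sigmaMax (G.freq ω - (FDBT.reducedModel G w₁ w₂ r).freq ω)) ≤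
          ENNReal.ofReal (2 * ∑ k ∈ Finset.univ.filter (fun k : Fin n => r ≤ (k : ℕ)), σ k)
            + FDBT.hinfDist G (G.extend w₁ w₂)
            + FDBT.hinfDist (FDBT.reducedModel G w₁ w₂ r)
                ((FDBT.reducedModel G w₁ w₂ r).extend w₁ w₂)) ∧
      -- and at the frequencies `±∞`.
      ENNReal.ofReal (FDBT.sigmaMax (G.D - (FDBT.reducedModel G w₁ w₂ r).D)) ≤
        ENNReal.ofReal (2 * ∑ k ∈ Finset.univ.filter (fun k : Fin n => r ≤ (k : ℕ)), σ k)
          + FDBT.hinfDist G (G.extend w₁ w₂)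
          + FDBT.hinfDist (FDBT.reducedModel G w₁ w₂ r)
              ((FDBT.reducedModel G w₁ w₂ r).extend w₁ w₂)) := by
  have hbal' : (G.extend w₁ w₂).Balanced σ := ⟨hbal.controllability, hbal.observability⟩
  refine ⟨fun hG hgap => ?_, fun hGr => ?_⟩
  · have hst : (FDBT.reducedModel G w₁ w₂ r).Stable :=
      FDBT.re_neg_of_mem_spectrum_trunc hr hσ_nonneg hbal.controllability hbal.observability hgap hG
    exact ⟨hst, FDBT.hasPrincipalSqrt_bandMatrix hw hst⟩
  · have hentire : ∀ ω : ℝ, G.Regular ω → (FDBT.reducedModel G w₁ w₂ r).Regular ω → _ :=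
      fun ω h hred => FDBT.ofReal_norm_freq_sub_reducedModel_le hbal' hσ_anti hσ_nonneg hr.le hGr
        h hred
    simp only [FDBT.sigmaMax_eq_norm]
    exact ⟨fun hσ M hM ω hω h hred => FDBT.norm_freq_sub_reducedModel_le_sum_sqrt_eta hw hbal'
      hσ_anti hσ hr.le hbal.hasSqrt hGr hM hω h hred, FDBT.reducedModel_extend hGr, hentire,
      FDBT.ofReal_norm_feedthrough_sub_le hentire⟩
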